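/- Throughout, $\mathbb S=\mathbb P^1(\mathbb C)$ and $Y,Z$ are finite sets with at least three elements each. **Portraits and marked maps.** A portrait $\mathbf F=(F,\deg)$ of degree $d\ge 2$ is a map $F:Y\to Z$ with a function $\deg:Y\to\mathbb N\setminus\{0\}$ such that $\sum_{a\in Y}(\deg(a)-1)=2d-2$ and $\sum_{a\in F^{-1}(b)}\deg(a)=d$ for all $b\in Z$. A rational map marked by $\mathbf F$ is a triple $(f,y,z)$, where $f:\mathbb S\to\mathbb S$ is a rational map of degree $d$, $y:Y\to\mathbb S$ and $z:Z\to\mathbb S$ are injective, $f\circ y=z\circ F$, and the local degree of $f$ at $y(a)$ is $\deg(a)$ for all $a\in Y$. **Trees of spheres.** A tree of spheres $\mathcal T^X$ marked by a finite set $X$ consists of a finite tree whose leaves (vertices of valence 1) are the elements of $X$ and whose internal vertices have valence at least $3$, and, for every internal vertex $v$, a Riemann sphere $\mathbb S_v$ (a copy of $\mathbb S$) and an injection $i_v$ of the set $E_v$ of edges at $v$ into $\mathbb S_v$. Put $X_v=i_v(E_v)$, and let $a_v:X\to\mathbb S_v$ send $x$ to $i_v(e)$, where $e$ is the first edge of the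 path from $v$ to $x$. A sequence of injections $x_n:X\to\mathbb S$ converges to $\mathcal T^X$ if for every internal vertex $v$ there are Moebius isomorphisms $\phi_{n,v}:\mathbb S\to\mathbb S_v$ with $\phi_{n,v}\circ x_n\to a_v$ pointwise on $X$. **Covers.** A cover $\mathcal F:\mathcal T^Y\to\mathcal T^Z$ consists of a map $F$ of the underlying trees that sends leaves to leaves, internal vertices to internal vertices and edges to edges and, for each internal vertex $v$ of $T^Y$ with $w=F(v)$, a nonconstant rational map $f_v:\mathbb S_v\to\mathbb S_w$ such that $f_v$ restricts to a covering map $\mathbb S_v\setminus Y_v\to\mathbb S_w\setminus Z_w$; $f_v(i_v(e))=i_w(F(e))$ for every edge $e$ at $v$; and, if $e$ is an edge between internal vertices $v$ and $v'$, the local degree of $f_v$ at $i_v(e)$ equals that of $f_{v'}$ at $i_{v'}(e)$. It has portrait $\mathbf F$ if the tree map restricts to the map of $\mathbf F$ on leaves and, for every leaf $a\in Y$ with its edge $e$ at the internal vertex $v$, the local degree of $f_v$ at $i_v(e)$ is $\deg(a)$. **Convergence of maps.** A sequence $(f_n,y_n,z_n)$ of rational maps marked by $\mathbf F$ converges to a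 cover $\mathcal F:\mathcal T^Y\to\mathcal T^Z$ of portrait $\mathbf F$ if there are Moebius isomorphisms $\phi^Y_{n,v}:\mathbb S\to\mathbb S_v$ and $\phi^Z_{n,w}:\mathbb S\to\mathbb S_w$, for all internal vertices $v$ of $T^Y$ and $w$ of $T^Z$, such that $\phi^Y_{n,v}\circ y_n\to a^Y_v$, $\phi^Z_{n,w}\circ z_n\to a^Z_w$, and, for every $v$ and $w=F(v)$, $\phi^Z_{n,w}\circ f_n\circ(\phi^Y_{n,v})^{-1}\to f_v$ locally uniformly on $\mathbb S_v\setminus Y_v$. **Theorem.** Let $(f_n,y_n,z_n)_n$ be a sequence of rational maps marked by a fixed portrait $\mathbf F$. 1. If $y_n$ converges to a tree of spheres $\mathcal T^Y$ and $z_n$ converges to a tree of spheres $\mathcal T^Z$, then there is a cover $\mathcal F:\mathcal T^Y\to\mathcal T^Z$ of portrait $\mathbf F$ such that $(f_n,y_n,z_n)$ converges to $\mathcal F$. 2. If for every quadruple $(a_0,a_1,a_\infty,a)$ of distinct elements of $Y$ the cross ratio of $(y_n(a_0),y_n(a_1),y_n(a_\infty),y_n(a))$, i.e. the image of $y_n(a)$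 under the Moebius transformation sending $y_n(a_0),y_n(a_1),y_n(a_\infty)$ to $0,1,\infty$, converges in $\mathbb S$ as $n\to\infty$, then there are trees of spheres $\mathcal T^Y$ and $\mathcal T^Z$ marked by $Y$ and $Z$ and a cover $\mathcal F:\mathcal T^Y\to\mathcal T^Z$ of portrait $\mathbf F$ such that $(f_n,y_n,z_n)$ converges to $\mathcal F$. -/

import Mathlib

open Filter Topology
open scoped OnePoint Polynomial

universe u v w₁ w₂

noncomputable section

namespace TreesOfSpheres

/-! ### The Riemann sphere, its automorphisms, and rational maps

The group of Moebius transformations is represented by Mathlib's action of `GL (Fin 2) ℂ` on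
`OnePoint ℂ`. -/

/-- The Riemann sphere `ℙ¹(ℂ)`. -/
abbrev Sphere : Type := OnePoint ℂ

/-- The point `[a : b]` of `ℙ¹(ℂ)`, for `(a, b) ≠ (0, 0)`. -/
def pt (a b : ℂ) : Sphere := if b = 0 then ∞ else ((a / b : ℂ) : Sphere)

/-- The degree of a rational map, written in lowest terms. -/
def ratDegree (r : RatFunc ℂ) : ℕ := max r.num.natDegree r.denom.natDegree

/-- The self-map of the Riemann sphere defined by a rational function. -/
def ratMap (r : RatFunc ℂ) : Sphere → Sphere
  | ∞ => pt (r.num.coeff (ratDegree r)) (r.denom.coeff (ratDegree r))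
  | (z : ℂ) => pt (r.num.eval z) (r.denom.eval z)

/-- The polynomial whose finite roots are the finite solutions of `r(z) = b`, with
multiplicity. -/
def fiberPoly (r : RatFunc ℂ) : Sphere → ℂ[X]
  | ∞ => r.denom
  | (b : ℂ) => r.num - Polynomial.C b * r.denom

/-- The multiplicity of the point `p` as a solution of `r(p) = b` on the Riemann sphere: at a
finite point it is the multiplicity of `p` as a root of `fiberPoly r b`; the point `∞` has
the multiplicity that is missing to the total number `ratDegree r`. -/
def multiplicityAt (r : RatFunc ℂ) (b : Sphere) : Sphere → ℕ
  | ∞ => ratDegree r - (fiberPoly r b).natDegree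
  | (z : ℂ) => (fiberPoly r b).rootMultiplicity z

/-- The local degree of a nonconstant rational map at a point. -/
def localDegree (r : RatFunc ℂ) (p : Sphere) : ℕ := multiplicityAt r (ratMap r p) p

/-- Homogeneous coordinates: `det p q` is the determinant of the vectors `(z, 1)` (for a finite
point `z`), respectively `(1, 0)` (for `∞`). -/
def homDet : Sphere → Sphere → ℂ
  | ∞, ∞ => 0
  | ∞, (_ : ℂ) => 1
  | (_ : ℂ), ∞ => -1
  | (p : ℂ), (q : ℂ) => p - q

/-- The cross ratio of four distinct points: the image of `p` under the Moebius transformation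
that maps `p₀, p₁, p_∞` to `0, 1, ∞`. -/
def crossRatio (p₀ p₁ pinf p : Sphere) : Sphere :=
  pt (homDet p p₀ * homDet p₁ pinf) (homDet p pinf * homDet p₁ p₀)

/-- The family of all cross ratios of a marking, indexed by the quadruples of distinct elements
of the marking set. -/
def crossRatios {X : Type u} (x : X → Sphere) : (Fin 4 ↪ X) → Sphere :=
  fun q => crossRatio (x (q 0)) (x (q 1)) (x (q 2)) (x (q 3))

/-! ### Portraits and marked rational maps -/

open scoped Classical in
/-- A portrait of degree `degree ≥ 2`. -/
structure Portrait (Y : Type u) (Z : Type v) [Fintype Y] where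
  degree : ℕ
  two_le_degree : 2 ≤ degree
  F : Y → Z
  deg : Y → ℕ
  deg_pos : ∀ a, 0 < deg a
  sum_deg_sub_one : ∑ a, (deg a - 1) = 2 * degree - 2
  sum_fiber : ∀ b, ∑ a with F a = b, deg a = degree

/-- A rational map marked by a portrait. -/
structure MarkedRationalMap {Y : Type u} {Z : Type v} [Fintype Y] (P : Portrait Y Z) where
  f : RatFunc ℂ
  y : Y → Sphere
  z : Z → Sphere
  degree_f : ratDegree f = P.degree
  y_injective : Function.Injective y
  z_injective : Function.Injective z
  comm : ∀ a, ratMap f (y a) = z (P.F a)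
  localDegree_y : ∀ a, localDegree f (y a) = P.deg a

/-! ### Trees of spheres -/

/-- A tree of spheres marked by `X`. The vertices of the combinatorial tree are the elements of
`X` (the leaves) and of `I` (the internal vertices). An edge adjacent to a vertex is given by its
other end point. The sphere at each internal vertex is a copy of the Riemann sphere. -/
structure TreeOfSpheres (X : Type u) where
  I : Type w₁
  finite_I : Finite I
  graph : SimpleGraph (X ⊕ I)
  isTree : graph.IsTree
  leaf : ∀ x : X, (graph.neighborSet (Sum.inl x)).ncard = 1
  stable : ∀ v : I, 3 ≤ (graph.neighborSet (Sum.inr v)).ncard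
  attach : ∀ v : I, graph.neighborSet (Sum.inr v) → Sphere
  attach_injective : ∀ v : I, Function.Injective (attach v)

namespace TreeOfSpheres

variable {X : Type u}

/-- The set of attaching points of edges on the sphere at `v`. -/
def attachSet (T : TreeOfSpheres.{u, w₁} X) (v : T.I) : Set Sphere := Set.range (T.attach v)

/-- The path in the tree from an internal vertex to a leaf. -/
def pathTo (T : TreeOfSpheres.{u, w₁} X) (v : T.I) (x : X) :
    T.graph.Walk (Sum.inr v) (Sum.inl x) :=
  (T.isTree.existsUnique_path (Sum.inr v) (Sum.inl x)).choose

theorem pathTo_not_nil (T : TreeOfSpheres.{u, w₁} X) (v : T.I) (x : X) :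
    ¬ (T.pathTo v x).Nil :=
  SimpleGraph.Walk.not_nil_of_ne (by simp)

/-- The map `a_v`: the leaf `x` is sent to the attaching point of the edge at `v` that lies in the
same connected component of the tree minus `v` as `x`, i.e. of the first edge of the path from `v`
to `x`. -/
def marking (T : TreeOfSpheres.{u, w₁} X) (v : T.I) (x : X) : Sphere :=
  T.attach v ⟨(T.pathTo v x).snd, (T.pathTo v x).adj_snd (T.pathTo_not_nil v x)⟩

/-- Convergence of a sequence of marked spheres to a tree of spheres with respect to given
isomorphisms `φ n v` from the `n`-th sphere to the sphere at `v`. -/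
def TendstoVia (x : ℕ → X → Sphere) (T : TreeOfSpheres.{u, w₁} X)
    (φ : ℕ → T.I → GL (Fin 2) ℂ) : Prop :=
  ∀ v : T.I, Tendsto (fun n => fun a : X => φ n v • x n a) atTop (𝓝 (T.marking v))

/-- Convergence of a sequence of marked spheres to a tree of spheres. -/
def SpheresTendsto (x : ℕ → X → Sphere) (T : TreeOfSpheres.{u, w₁} X) : Prop :=
  ∃ φ : ℕ → T.I → GL (Fin 2) ℂ, TendstoVia x T φ

end TreeOfSpheres

/-! ### Covers between trees of spheres -/

/-- A cover between trees of spheres. The tree map is `Sum.map leafMap vertexMap`, and the sphere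
at `v` is mapped by the nonconstant rational map `f v` to the sphere at `vertexMap v`. -/
structure Cover {Y : Type u} {Z : Type v} (TY : TreeOfSpheres.{u, w₁} Y)
    (TZ : TreeOfSpheres.{v, w₂} Z) where
  leafMap : Y → Z
  vertexMap : TY.I → TZ.I
  map_adj : ∀ {s t : Y ⊕ TY.I}, TY.graph.Adj s t →
    TZ.graph.Adj (Sum.map leafMap vertexMap s) (Sum.map leafMap vertexMap t)
  f : TY.I → RatFunc ℂ
  nonconstant : ∀ v, 1 ≤ ratDegree (f v)
  mapsTo : ∀ v, Set.MapsTo (ratMap (f v)) (TY.attachSet v)ᶜ (TZ.attachSet (vertexMap v))ᶜ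
  isCoveringMap : ∀ v, IsCoveringMap ((mapsTo v).restrict)
  map_attach : ∀ v (t : TY.graph.neighborSet (Sum.inr v)),
    ratMap (f v) (TY.attach v t) =
      TZ.attach (vertexMap v) ⟨Sum.map leafMap vertexMap t.1, map_adj t.2⟩
  localDegree_eq : ∀ (v v' : TY.I) (h : TY.graph.Adj (Sum.inr v) (Sum.inr v')),
    localDegree (f v) (TY.attach v ⟨Sum.inr v', h⟩) =
      localDegree (f v') (TY.attach v' ⟨Sum.inr v, h.symm⟩)

namespace Cover

variable {Y : Type u} {Z : Type v} {TY : TreeOfSpheres.{u, w₁} Y}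
  {TZ : TreeOfSpheres.{v, w₂} Z}

/-- The cover has portrait `P`: on leaves it is `P.F`, and `P.deg` is the local degree at the edge
of each leaf. -/
def HasPortrait [Fintype Y] (C : Cover TY TZ) (P : Portrait Y Z) : Prop :=
  C.leafMap = P.F ∧
    ∀ (a : Y) (v : TY.I) (h : TY.graph.Adj (Sum.inr v) (Sum.inl a)),
      localDegree (C.f v) (TY.attach v ⟨Sum.inl a, h⟩) = P.deg a

/-- The uniform structure of the compact Hausdorff space `ℙ¹(ℂ)`. -/
abbrev sphereUniformSpace : UniformSpace Sphere := uniformSpaceOfCompactR1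

/-- Locally uniform convergence on a set of a sequence of self-maps of the Riemann sphere. -/
def TendstoLocUnifOn (g : ℕ → Sphere → Sphere) (h : Sphere → Sphere) (s : Set Sphere) : Prop :=
  letI : UniformSpace Sphere := sphereUniformSpace
  TendstoLocallyUniformlyOn g h atTop s

/-- Convergence of a sequence of rational maps marked by `P` to a cover of portrait `P`. -/
def MapsTendsto [Fintype Y] {P : Portrait Y Z} (R : ℕ → MarkedRationalMap P)
    (C : Cover TY TZ) : Prop :=
  C.HasPortrait P ∧
    ∃ (φY : ℕ → TY.I → GL (Fin 2) ℂ) (φZ : ℕ → TZ.I → GL (Fin 2) ℂ),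
      TreeOfSpheres.TendstoVia (fun n => (R n).y) TY φY ∧
      TreeOfSpheres.TendstoVia (fun n => (R n).z) TZ φZ ∧
      ∀ v : TY.I, TendstoLocUnifOn
        (fun n p => φZ n (C.vertexMap v) • ratMap (R n).f ((φY n v)⁻¹ • p))
        (ratMap (C.f v)) (TY.attachSet v)ᶜ

end Cover

end TreesOfSpheres

end

/-! Everything rests on a statement about one internal vertex `v` of the source tree. In coordinates
on the source in which the marks converge to a map with at least three values, there are coordinates
on the target in which the maps converge, off the limit marks, to a nonconstant rational map `G`,
and the target marks also converge, to a map with at least three values. `VertexLimit` collects what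
is needed about `G`.

The proof is algebraic. A portrait marks all critical points and the full fibers over the marked
values. If the marks `x a` are finite, the fiber over `b` is the zero set of the monic polynomial
p_b = ∏ (X - x a)^deg a of degree d. These polynomials lie in one pencil, p_b = p_{b₀} + s_b q with
deg q < d, and q can be scaled so that the Wronskian of p_{b₀} and q is ∏ (X - x a)^(deg a - 1) over
all marks. In suitable target coordinates the map is -p_{b₀}/q and the marks are the s_b
(`MarkedRationalMap.exists_normal_form`). The Wronskian equation determines the coefficients of q
from the top down, dividing only by the nonzero integers k - d. So q and s converge with the marks,
even when marks collide (`exists_limit_normal_form`). The limit Wronskian is still monic, so the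
limit of q is not zero. Cancelling the common factor U of the limits of p_{b₀} and q leaves G =
-A/B, and convergence holds away from the roots of U, which are limit marks.

The factorization p_b = U (A + s_b B) yields the counting formula: the degrees of the marks over `b`
that collide at a point e add up to a number N independent of `b`, plus the local degree of `G` at e
if `b` goes to G(e). A winding number argument for coverings (`mem_range_of_tendsto_covering`) shows
that limit marks are sent to limit marks, and a Riemann–Hurwitz count (`IsReduced.exists_three`)
gives three values on the target.

For the first assertion, three target marks separated at `v` have a median `w` in the target tree,
and `v` is sent to `w`; the target coordinates can be exchanged for those of `w`, because both
separate the same triple. Along an edge of the source tree the two branches together contain the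
whole fiber over each `b`, so the counting formulas at the two ends add up to d. This forces
complementary sets of target leaves and equal local degrees (`VertexLimit.eq_iff_ne`), and
complementary branches in a tree are the two sides of an edge (`TreeOfSpheres.eq_of_compl_branch`).

For the second assertion, convergent cross ratios give for each triple a normalization with
convergent marks that separates it. The partitions of the marking set by limit positions are
pairwise compatible, because a degenerating sequence of Moebius maps is in the limit constant off
one point (`ker_eq_or_cover`). Compatible partitions that separate all triples form a tree
(`IsSystem.tree`). On the target, triples are separated by the limits at the vertices of the source
tree (`exists_separating_vertex`), so the same construction applies and the first assertion finishes
the proof. -/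

noncomputable section
namespace TreesOfSpheres

section

/-! ### Homogeneous coordinates on the sphere -/

/-- The point of the sphere with given homogeneous coordinates. -/
def ptv (v : ℂ × ℂ) : Sphere := pt v.1 v.2

/-- Homogeneous coordinates of a point of the sphere. -/
def vec : Sphere → ℂ × ℂ
  | ∞ => (1, 0)
  | (z : ℂ) => (z, 1)

@[simp] theorem vec_coe (z : ℂ) : vec (z : Sphere) = (z, 1) := rfl
@[simp] theorem vec_infty : vec (∞ : Sphere) = (1, 0) := rfl

theorem vec_ne_zero (p : Sphere) : vec p ≠ 0 := by
  induction p using OnePoint.rec <;> simp [Prod.ext_iff]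

@[simp] theorem ptv_vec (p : Sphere) : ptv (vec p) = p := by
  induction p using OnePoint.rec <;> simp [ptv, pt]

theorem ptv_smul {c : ℂ} (hc : c ≠ 0) (v : ℂ × ℂ) : ptv (c • v) = ptv v := by
  simp only [ptv, pt, Prod.smul_fst, Prod.smul_snd, smul_eq_mul, mul_eq_zero, hc, false_or]
  split_ifs with h
  · rfl
  · rw [mul_div_mul_left _ _ hc]

theorem exists_smul_vec {v : ℂ × ℂ} (hv : v ≠ 0) : ∃ c : ℂ, c ≠ 0 ∧ v = c • vec (ptv v) := by
  by_cases h : v.2 = 0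
  · refine ⟨v.1, fun h1 => hv (Prod.ext h1 h), ?_⟩
    simp [ptv, pt, h, Prod.ext_iff]
  · refine ⟨v.2, h, ?_⟩
    simp [ptv, pt, h, mul_div_cancel₀]

/-- The determinant of two vectors. -/
def cross (v w : ℂ × ℂ) : ℂ := v.1 * w.2 - w.1 * v.2

theorem ptv_eq_ptv_iff {v w : ℂ × ℂ} (hv : v ≠ 0) (hw : w ≠ 0) :
    ptv v = ptv w ↔ cross v w = 0 := by
  simp only [ptv, pt, cross]
  by_cases h : v.2 = 0 <;> by_cases h' : w.2 = 0
  · simp [h, h']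
  · have : v.1 ≠ 0 := fun h1 => hv (Prod.ext h1 h)
    simp [h, h', this]
  · have : w.1 ≠ 0 := fun h1 => hw (Prod.ext h1 h')
    simp [h, h', this]
  · simp only [h, h', if_false, OnePoint.coe_eq_coe]
    rw [div_eq_div_iff h h', sub_eq_zero]

theorem cross_vec_eq_zero {p q : Sphere} : cross (vec p) (vec q) = 0 ↔ p = q := by
  rw [← ptv_eq_ptv_iff (vec_ne_zero p) (vec_ne_zero q), ptv_vec, ptv_vec]

theorem cross_vec (p q : Sphere) : cross (vec p) (vec q) = homDet p q := by
  induction p using OnePoint.rec <;> induction q using OnePoint.rec <;> simp [cross, homDet]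

/-- The action of a matrix on vectors. -/
def mv (M : Matrix (Fin 2) (Fin 2) ℂ) (v : ℂ × ℂ) : ℂ × ℂ :=
  (M 0 0 * v.1 + M 0 1 * v.2, M 1 0 * v.1 + M 1 1 * v.2)

theorem mv_smul (M : Matrix (Fin 2) (Fin 2) ℂ) (c : ℂ) (v : ℂ × ℂ) : mv M (c • v) = c • mv M v := by
  ext <;> simp [mv] <;> ring

theorem mv_smul_left (M : Matrix (Fin 2) (Fin 2) ℂ) (c : ℂ) (v : ℂ × ℂ) :
    mv (c • M) v = c • mv M v := by
  ext <;> simp [mv] <;> ring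

theorem mv_mul (M N : Matrix (Fin 2) (Fin 2) ℂ) (v : ℂ × ℂ) : mv (M * N) v = mv M (mv N v) := by
  ext <;> simp [mv, Matrix.mul_apply, Fin.sum_univ_two] <;> ring

theorem cross_mv (M : Matrix (Fin 2) (Fin 2) ℂ) (v w : ℂ × ℂ) :
    cross (mv M v) (mv M w) = M.det * cross v w := by
  simp [mv, cross, Matrix.det_fin_two]; ring

theorem mv_ne_zero {M : Matrix (Fin 2) (Fin 2) ℂ} (hM : M.det ≠ 0) {v : ℂ × ℂ} (hv : v ≠ 0) :
    mv M v ≠ 0 := by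
  intro h
  have h1 : ∀ w, cross v w = 0 := fun w => by
    have := cross_mv M v w
    rw [h] at this
    simpa [cross, hM] using this
  apply hv
  have h2 := h1 (0, 1)
  have h3 := h1 (1, 0)
  simp only [cross] at h2 h3
  ext <;> simp_all

theorem smul_ptv (g : GL (Fin 2) ℂ) {v : ℂ × ℂ} (hv : v ≠ 0) : g • ptv v = ptv (mv g v) := by
  obtain ⟨c, hc, hv'⟩ := exists_smul_vec hv
  generalize ptv v = p at hv' ⊢
  rw [hv', mv_smul, ptv_smul hc]
  induction p using OnePoint.rec with
  | infty => rw [OnePoint.smul_infty_eq_ite]; simp [ptv, mv, pt]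
  | coe z => rw [OnePoint.smul_some_eq_ite]; simp [ptv, mv, pt]

theorem smul_eq_ptv (g : GL (Fin 2) ℂ) (p : Sphere) : g • p = ptv (mv g (vec p)) := by
  rw [← smul_ptv g (vec_ne_zero p), ptv_vec]

/-- The element of `GL₂` defined by a matrix of nonzero determinant. -/
def glOf (M : Matrix (Fin 2) (Fin 2) ℂ) (hM : M.det ≠ 0) : GL (Fin 2) ℂ :=
  Matrix.GeneralLinearGroup.mkOfDetNeZero M hM

@[simp] theorem coe_glOf (M : Matrix (Fin 2) (Fin 2) ℂ) (hM : M.det ≠ 0) :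
    (glOf M hM : Matrix (Fin 2) (Fin 2) ℂ) = M := rfl

theorem det_coe_ne_zero (g : GL (Fin 2) ℂ) : (g : Matrix (Fin 2) (Fin 2) ℂ).det ≠ 0 :=
  g.det_ne_zero

theorem continuous_mv : Continuous fun p : Matrix (Fin 2) (Fin 2) ℂ × (ℂ × ℂ) => mv p.1 p.2 := by
  unfold mv
  have h : ∀ i j, Continuous fun p : Matrix (Fin 2) (Fin 2) ℂ × (ℂ × ℂ) => p.1 i j := fun i j =>
    (continuous_apply_apply i j).comp continuous_fst
  have := h 0 0; have := h 0 1; have := h 1 0; have := h 1 1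
  fun_prop

/-! ### Continuity -/

theorem tendsto_coe_infty {ι : Type*} {l : Filter ι} {f : ι → ℂ}
    (hf : Tendsto (fun i => ‖f i‖) l atTop) : Tendsto (fun i => (f i : Sphere)) l (𝓝 ∞) := by
  have h1 : Tendsto f l (cocompact ℂ) := tendsto_norm_atTop_iff_cobounded.1 hf |>.trans
    (Metric.cobounded_eq_cocompact (α := ℂ)).le
  have h2 : Tendsto ((↑) : ℂ → Sphere) (coclosedCompact ℂ) (𝓝 ∞) := OnePoint.tendsto_coe_infty
  rw [coclosedCompact_eq_cocompact] at h2
  exact h2.comp h1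

theorem continuousAt_ptv {v : ℂ × ℂ} (hv : v ≠ 0) : ContinuousAt ptv v := by
  by_cases h : v.2 = 0
  · have h1 : v.1 ≠ 0 := fun h1 => hv (Prod.ext h1 h)
    have e : ptv v = ∞ := by simp [ptv, pt, h]
    rw [ContinuousAt, e]
    -- Over ∞ the two ways of approach are treated separately: along `w.2 = 0` the value is
    -- constantly ∞, and along `w.2 ≠ 0` the quotient tends to infinity in norm.
    have hsub : (𝓝 v) = 𝓝[{w | w.2 = 0}] v ⊔ 𝓝[{w | w.2 ≠ 0}] v := by
      rw [← nhdsWithin_union]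
      have : ({w : ℂ × ℂ | w.2 = 0} ∪ {w | w.2 ≠ 0}) = Set.univ := by
        ext w; simp [em]
      rw [this, nhdsWithin_univ]
    rw [hsub]
    refine Tendsto.sup ?_ ?_
    · refine tendsto_const_nhds.congr' ?_
      filter_upwards [self_mem_nhdsWithin] with w hw
      replace hw : w.2 = 0 := hw
      simp [ptv, pt, hw]
    · have h3 : Tendsto (fun w : ℂ × ℂ => ((w.1 / w.2 : ℂ) : Sphere)) (𝓝[{w | w.2 ≠ 0}] v)
          (𝓝 ∞) := by
        apply tendsto_coe_infty
        simp only [norm_div]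
        have h4 : Tendsto (fun w : ℂ × ℂ => ‖w.1‖) (𝓝[{w | w.2 ≠ 0}] v) (𝓝 ‖v.1‖) :=
          (continuous_fst.norm.tendsto v).mono_left nhdsWithin_le_nhds
        have h5 : Tendsto (fun w : ℂ × ℂ => ‖w.2‖) (𝓝[{w | w.2 ≠ 0}] v) (𝓝[>] 0) := by
          refine tendsto_nhdsWithin_iff.2 ⟨?_, ?_⟩
          · have := (continuous_snd.norm.tendsto v).mono_left
              (nhdsWithin_le_nhds (s := {w : ℂ × ℂ | w.2 ≠ 0}))
            simpa [h] using this
          · filter_upwards [self_mem_nhdsWithin] with w hw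
            simpa using hw
        simp only [div_eq_mul_inv]
        exact h4.pos_mul_atTop (norm_pos_iff.2 h1) (tendsto_inv_nhdsGT_zero.comp h5)
      refine h3.congr' ?_
      filter_upwards [self_mem_nhdsWithin] with w hw
      replace hw : w.2 ≠ 0 := hw
      simp [ptv, pt, hw]
  · have h1 : ∀ᶠ w : ℂ × ℂ in 𝓝 v, w.2 ≠ 0 := continuous_snd.continuousAt.eventually_ne h
    have h2 : ContinuousAt (fun w : ℂ × ℂ => ((w.1 / w.2 : ℂ) : Sphere)) v :=
      OnePoint.continuous_coe.continuousAt.comp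
        (continuous_fst.continuousAt.div continuous_snd.continuousAt h)
    refine h2.congr ?_
    filter_upwards [h1] with w hw
    simp [ptv, pt, hw]

theorem continuousAt_vec_coe (z : ℂ) : ContinuousAt vec (z : Sphere) := by
  rw [OnePoint.continuousAt_coe]
  exact (continuous_id.prodMk continuous_const).continuousAt

/-- Near every point there is a continuous choice of homogeneous coordinates. -/
theorem exists_section (p : Sphere) : ∃ σ : Sphere → ℂ × ℂ, ContinuousAt σ p ∧
    (∀ q, σ q ≠ 0) ∧ (∀ q, ptv (σ q) = q) ∧ σ p = vec p := by
  induction p using OnePoint.rec with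
  | coe z => exact ⟨vec, continuousAt_vec_coe z, vec_ne_zero, ptv_vec, rfl⟩
  | infty =>
    classical
    -- These are the coordinates (1, 1/z) of the chart at ∞, where `elim` gives (1, 0). The value at
    -- 0, where 1/z is unavailable, is replaced by (0, 1) so that all values represent their point.
    refine ⟨fun q => if q = (0 : ℂ) then (0, 1) else (1, q.elim 0 fun z => z⁻¹), ?_, ?_, ?_, ?_⟩
    · rw [OnePoint.continuousAt_infty']
      rw [coclosedCompact_eq_cocompact]
      have h1 : Tendsto (fun z : ℂ => ((1 : ℂ), z⁻¹)) (cocompact ℂ) (𝓝 (1, 0)) :=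
        tendsto_const_nhds.prodMk_nhds (by
          rw [← Metric.cobounded_eq_cocompact]; exact tendsto_inv₀_cobounded)
      have h2 : ∀ᶠ z : ℂ in cocompact ℂ, z ≠ 0 := by
        have := (isCompact_singleton (x := (0 : ℂ))).compl_mem_cocompact
        filter_upwards [this] with z hz using hz
      have h3 : (if (∞ : Sphere) = ((0 : ℂ) : Sphere) then ((0 : ℂ), (1 : ℂ)) else
        (1, (∞ : Sphere).elim 0 fun z => z⁻¹)) = (1, 0) := by simp
      rw [h3]
      refine h1.congr' ?_
      filter_upwards [h2] with z hz
      simp [hz]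
    · intro q
      dsimp only
      split_ifs <;> simp [Prod.ext_iff]
    · intro q
      dsimp only
      split_ifs with h
      · simp [ptv, pt, h]
      · induction q using OnePoint.rec with
        | infty => simp [ptv, pt]
        | coe z =>
          have : z ≠ 0 := by simpa using h
          simp [ptv, pt, this]
    · simp

theorem exists_lift {ι : Type*} {l : Filter ι} {p : ι → Sphere} {q : Sphere}
    (hp : Tendsto p l (𝓝 q)) : ∃ w : ι → ℂ × ℂ, Tendsto w l (𝓝 (vec q)) ∧ (∀ i, w i ≠ 0) ∧
      ∀ i, ptv (w i) = p i := by
  obtain ⟨σ, h1, h2, h3, h4⟩ := exists_section q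
  refine ⟨fun i => σ (p i), ?_, fun i => h2 _, fun i => h3 _⟩
  rw [← h4]
  exact h1.tendsto.comp hp

/-- Scalars do not affect the action, so only rescaled matrices need to converge. The limit `M` may
be singular, which describes a degenerating sequence of Moebius maps; convergence then persists off
the kernel of `M`. -/
theorem tendsto_smul_of_mv_ne_zero {ι : Type*} {l : Filter ι} {g : ι → GL (Fin 2) ℂ} {c : ι → ℂ}
    (hc : ∀ i, c i ≠ 0)
    {M : Matrix (Fin 2) (Fin 2) ℂ} (hg : Tendsto (fun i => c i • (g i : Matrix (Fin 2) (Fin 2) ℂ)) l (𝓝 M))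
    {p : ι → Sphere} {q : Sphere} (hp : Tendsto p l (𝓝 q)) (hM : mv M (vec q) ≠ 0) :
    Tendsto (fun i => g i • p i) l (𝓝 (ptv (mv M (vec q)))) := by
  obtain ⟨w, h1, h2, h3⟩ := exists_lift hp
  have h4 := (continuous_mv.tendsto (M, vec q)).comp (hg.prodMk_nhds h1)
  refine ((continuousAt_ptv hM).tendsto.comp h4).congr fun i => ?_
  change ptv (mv (c i • (g i : Matrix (Fin 2) (Fin 2) ℂ)) (w i)) = _
  rw [← h3 i, smul_ptv _ (h2 i), mv_smul_left, ptv_smul (hc i)]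

theorem tendsto_smul {ι : Type*} {l : Filter ι} {g : ι → GL (Fin 2) ℂ} {m : GL (Fin 2) ℂ}
    (hg : Tendsto (fun i => (g i : Matrix (Fin 2) (Fin 2) ℂ)) l (𝓝 m))
    {p : ι → Sphere} {q : Sphere} (hp : Tendsto p l (𝓝 q)) :
    Tendsto (fun i => g i • p i) l (𝓝 (m • q)) := by
  rw [smul_eq_ptv]
  exact tendsto_smul_of_mv_ne_zero (c := fun _ => 1) (by simp) (by simpa using hg) hp
    (mv_ne_zero (det_coe_ne_zero m) (vec_ne_zero q))

instance : ContinuousConstSMul (GL (Fin 2) ℂ) Sphere where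
  continuous_const_smul g := by
    rw [continuous_iff_continuousAt]
    intro p
    exact tendsto_smul tendsto_const_nhds tendsto_id

end

section

/-! ### Moebius transformations and triples of points -/

/-- The matrix of the Moebius transformation that sends the points with homogeneous coordinates
`w₀, w₁, w₂` to `0, 1, ∞`. -/
def normMat (w₀ w₁ w₂ : ℂ × ℂ) : Matrix (Fin 2) (Fin 2) ℂ :=
  !![cross w₁ w₂ * w₀.2, -(cross w₁ w₂ * w₀.1); cross w₁ w₀ * w₂.2, -(cross w₁ w₀ * w₂.1)]

theorem mv_normMat (w₀ w₁ w₂ v : ℂ × ℂ) :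
    mv (normMat w₀ w₁ w₂) v = (cross v w₀ * cross w₁ w₂, cross v w₂ * cross w₁ w₀) := by
  ext <;> simp [mv, normMat, cross] <;> ring

theorem det_normMat (w₀ w₁ w₂ : ℂ × ℂ) :
    (normMat w₀ w₁ w₂).det = cross w₁ w₂ * cross w₁ w₀ * cross w₀ w₂ := by
  simp [normMat, cross, Matrix.det_fin_two]; ring

theorem continuous_normMat :
    Continuous fun p : (ℂ × ℂ) × (ℂ × ℂ) × (ℂ × ℂ) => normMat p.1 p.2.1 p.2.2 := by
  refine continuous_matrix fun i j => ?_
  fin_cases i <;> fin_cases j <;> simp [normMat, cross] <;> fun_prop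

theorem cross_ne_zero_of_ptv_ne {v w : ℂ × ℂ} (hv : v ≠ 0) (hw : w ≠ 0) (h : ptv v ≠ ptv w) :
    cross v w ≠ 0 := fun h' => h ((ptv_eq_ptv_iff hv hw).2 h')

theorem det_normMat_ne_zero {w₀ w₁ w₂ : ℂ × ℂ} (h0 : w₀ ≠ 0) (h1 : w₁ ≠ 0) (h2 : w₂ ≠ 0)
    (h01 : ptv w₀ ≠ ptv w₁) (h02 : ptv w₀ ≠ ptv w₂) (h12 : ptv w₁ ≠ ptv w₂) :
    (normMat w₀ w₁ w₂).det ≠ 0 := by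
  rw [det_normMat]
  exact mul_ne_zero (mul_ne_zero (cross_ne_zero_of_ptv_ne h1 h2 h12)
    (cross_ne_zero_of_ptv_ne h1 h0 h01.symm)) (cross_ne_zero_of_ptv_ne h0 h2 h02)

theorem ptv_mv_normMat_zero {w₀ w₁ w₂ : ℂ × ℂ} (h : (normMat w₀ w₁ w₂).det ≠ 0) :
    ptv (mv (normMat w₀ w₁ w₂) w₀) = (0 : ℂ) := by
  rw [det_normMat] at h
  have h1 : cross w₀ w₀ = 0 := by simp [cross]
  rw [mv_normMat, h1]
  simp only [ptv, pt, zero_mul, zero_div]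
  rw [if_neg]
  exact mul_ne_zero (right_ne_zero_of_mul h) (right_ne_zero_of_mul (left_ne_zero_of_mul h))

theorem ptv_mv_normMat_one {w₀ w₁ w₂ : ℂ × ℂ} (h : (normMat w₀ w₁ w₂).det ≠ 0) :
    ptv (mv (normMat w₀ w₁ w₂) w₁) = (1 : ℂ) := by
  rw [det_normMat] at h
  have h2 : cross w₁ w₂ * cross w₁ w₀ ≠ 0 := left_ne_zero_of_mul h
  rw [mv_normMat, mul_comm (cross w₁ w₀)]
  simp only [ptv, pt, div_self h2, h2, if_false]

theorem ptv_mv_normMat_infty (w₀ w₁ w₂ : ℂ × ℂ) :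
    ptv (mv (normMat w₀ w₁ w₂) w₂) = ∞ := by
  have h1 : cross w₂ w₂ = 0 := by simp [cross]
  rw [mv_normMat, h1]
  simp [ptv, pt]

theorem exists_smul_eq_zero_one_infty {p₀ p₁ p₂ : Sphere} (h01 : p₀ ≠ p₁) (h02 : p₀ ≠ p₂)
    (h12 : p₁ ≠ p₂) : ∃ g : GL (Fin 2) ℂ, g • p₀ = ((0 : ℂ) : Sphere) ∧
      g • p₁ = ((1 : ℂ) : Sphere) ∧ g • p₂ = ∞ := by
  have hd : (normMat (vec p₀) (vec p₁) (vec p₂)).det ≠ 0 :=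
    det_normMat_ne_zero (vec_ne_zero _) (vec_ne_zero _) (vec_ne_zero _) (by simpa) (by simpa)
      (by simpa)
  refine ⟨glOf _ hd, ?_, ?_, ?_⟩
  · rw [smul_eq_ptv, coe_glOf, ptv_mv_normMat_zero hd]
  · rw [smul_eq_ptv, coe_glOf, ptv_mv_normMat_one hd]
  · rw [smul_eq_ptv, coe_glOf, ptv_mv_normMat_infty]

theorem smul_eq_self_of_fix {h : GL (Fin 2) ℂ} (h0 : h • ((0 : ℂ) : Sphere) = ((0 : ℂ) : Sphere))
    (h1 : h • ((1 : ℂ) : Sphere) = ((1 : ℂ) : Sphere)) (h2 : h • (∞ : Sphere) = ∞) (p : Sphere) :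
    h • p = p := by
  have e2 : h 1 0 = 0 := OnePoint.smul_infty_eq_self_iff.1 h2
  have hd := h.det_ne_zero
  rw [Matrix.det_fin_two, e2, mul_zero, sub_zero] at hd
  have h00 := left_ne_zero_of_mul hd
  have h11 := right_ne_zero_of_mul hd
  rw [OnePoint.smul_some_eq_ite] at h0 h1
  simp only [e2, mul_zero, zero_add, h11, if_false, OnePoint.coe_eq_coe, mul_one, div_eq_zero_iff,
    or_false] at h0 h1
  rw [h0, add_zero, div_eq_one_iff_eq h11] at h1
  induction p using OnePoint.rec with
  | infty => exact h2
  | coe z =>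
    rw [OnePoint.smul_some_eq_ite]
    simp [e2, h0, h11, h1]

theorem smul_eq_of_three {g h : GL (Fin 2) ℂ} {p : Fin 3 → Sphere} (hp : Function.Injective p)
    (hgh : ∀ i, g • p i = h • p i) (q : Sphere) : g • q = h • q := by
  obtain ⟨k, k0, k1, k2⟩ := exists_smul_eq_zero_one_infty
    (hp.ne (show (0 : Fin 3) ≠ 1 by decide)) (hp.ne (show (0 : Fin 3) ≠ 2 by decide))
    (hp.ne (show (1 : Fin 3) ≠ 2 by decide))
  have key : ∀ i, (k * h⁻¹ * g * k⁻¹) • (k • p i) = k • p i := fun i => by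
    simp only [mul_smul, inv_smul_smul, hgh]
  have := smul_eq_self_of_fix (h := k * h⁻¹ * g * k⁻¹) (k0 ▸ key 0) (k1 ▸ key 1) (k2 ▸ key 2)
    (k • q)
  simp only [mul_smul, inv_smul_smul] at this
  exact (inv_smul_eq_iff.1 ((smul_left_cancel_iff k).1 this))

theorem tendsto_coe_inv {ι : Type*} {l : Filter ι} {g : ι → GL (Fin 2) ℂ} {m : GL (Fin 2) ℂ}
    (hg : Tendsto (fun i => (g i : Matrix (Fin 2) (Fin 2) ℂ)) l (𝓝 m)) :
    Tendsto (fun i => ((g i)⁻¹ : GL (Fin 2) ℂ).1) l (𝓝 (m⁻¹ : GL (Fin 2) ℂ).1) := by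
  have e : ∀ h : GL (Fin 2) ℂ, (h⁻¹ : GL (Fin 2) ℂ).1 = (h.1.det)⁻¹ • h.1.adjugate := fun h => by
    rw [Matrix.coe_units_inv, Matrix.inv_def, Ring.inverse_eq_inv']
  simp only [e]
  have hcd : Continuous fun M : Matrix (Fin 2) (Fin 2) ℂ => M.det := continuous_id.matrix_det
  have hca : Continuous fun M : Matrix (Fin 2) (Fin 2) ℂ => M.adjugate :=
    continuous_id.matrix_adjugate
  have h1 : Tendsto (fun i => ((g i).1.det)⁻¹) l (𝓝 (m.1.det)⁻¹) :=
    ((hcd.tendsto m.1).comp hg).inv₀ (det_coe_ne_zero m)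
  have h2 : Tendsto (fun i => (g i).1.adjugate) l (𝓝 m.1.adjugate) := (hca.tendsto m.1).comp hg
  exact h1.smul h2

theorem tendsto_normMat {ι : Type*} {l : Filter ι} {w₀ w₁ w₂ : ι → ℂ × ℂ} {v₀ v₁ v₂ : ℂ × ℂ}
    (h0 : Tendsto w₀ l (𝓝 v₀)) (h1 : Tendsto w₁ l (𝓝 v₁)) (h2 : Tendsto w₂ l (𝓝 v₂)) :
    Tendsto (fun i => normMat (w₀ i) (w₁ i) (w₂ i)) l (𝓝 (normMat v₀ v₁ v₂)) := by
  have h := (continuous_normMat.tendsto (v₀, v₁, v₂)).comp (h0.prodMk_nhds (h1.prodMk_nhds h2))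
  simpa only [Function.comp_def] using h

/-- The normalizing matrix is polynomial in homogeneous coordinates of the three points, so it
converges along convergent lifts. Its determinant is nonzero only from some index on, once the three
points are distinct. -/
theorem exists_tendsto_normalization {ι : Type*} {l : Filter ι} {p : Fin 3 → ι → Sphere}
    {q : Fin 3 → Sphere} (hq : Function.Injective q) (h : ∀ i, Tendsto (p i) l (𝓝 (q i))) :
    ∃ (k : ι → GL (Fin 2) ℂ) (k' : GL (Fin 2) ℂ),
      Tendsto (fun n => (k n : Matrix (Fin 2) (Fin 2) ℂ)) l (𝓝 k') ∧
      ∀ᶠ n in l, k n • p 0 n = ((0 : ℂ) : Sphere) ∧ k n • p 1 n = ((1 : ℂ) : Sphere) ∧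
        k n • p 2 n = ∞ := by
  choose w hw1 hw2 hw3 using fun i => exists_lift (h i)
  have hlim := tendsto_normMat (hw1 0) (hw1 1) (hw1 2)
  have hd : (normMat (vec (q 0)) (vec (q 1)) (vec (q 2))).det ≠ 0 :=
    det_normMat_ne_zero (vec_ne_zero _) (vec_ne_zero _) (vec_ne_zero _)
      (by simpa using hq.ne (show (0 : Fin 3) ≠ 1 by decide))
      (by simpa using hq.ne (show (0 : Fin 3) ≠ 2 by decide))
      (by simpa using hq.ne (show (1 : Fin 3) ≠ 2 by decide))
  have hcd : Continuous fun M : Matrix (Fin 2) (Fin 2) ℂ => M.det := continuous_id.matrix_det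
  have ev : ∀ᶠ n in l, (normMat (w 0 n) (w 1 n) (w 2 n)).det ≠ 0 :=
    ((hcd.tendsto _).comp hlim).eventually_ne hd
  classical
  refine ⟨fun n => if hn : (normMat (w 0 n) (w 1 n) (w 2 n)).det ≠ 0 then glOf _ hn else 1,
    glOf _ hd, ?_, ?_⟩
  · refine hlim.congr' ?_
    filter_upwards [ev] with n hn
    rw [dif_pos hn, coe_glOf]
  · filter_upwards [ev] with n hn
    rw [dif_pos hn, ← hw3 0, ← hw3 1, ← hw3 2, smul_ptv _ (hw2 0 n), smul_ptv _ (hw2 1 n),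
      smul_ptv _ (hw2 2 n), coe_glOf]
    exact ⟨ptv_mv_normMat_zero hn, ptv_mv_normMat_one hn, ptv_mv_normMat_infty _ _ _⟩

theorem eventually_ne_of_tendsto {ι α : Type*} [TopologicalSpace α] [T2Space α] {l : Filter ι}
    {f g : ι → α} {a b : α} (hf : Tendsto f l (𝓝 a)) (hg : Tendsto g l (𝓝 b)) (hab : a ≠ b) :
    ∀ᶠ i in l, f i ≠ g i := by
  have : {p : α × α | p.1 ≠ p.2} ∈ 𝓝 (a, b) :=
    (isClosed_eq continuous_fst continuous_snd).isOpen_compl.mem_nhds hab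
  exact (hf.prodMk_nhds hg).eventually this

/-- Both coordinate systems can be normalized on the same triple by convergent matrices. A Moebius
map is determined by three points, so the two normalizations eventually coincide and the transition
is a quotient of convergent matrices. -/
theorem exists_transition {ι X : Type*} {l : Filter ι} {x : ι → X → Sphere} {g g' : ι → GL (Fin 2) ℂ}
    {a a' : X → Sphere} (h : ∀ y, Tendsto (fun n => g n • x n y) l (𝓝 (a y)))
    (h' : ∀ y, Tendsto (fun n => g' n • x n y) l (𝓝 (a' y))) {y : Fin 3 → X}
    (hy : Function.Injective (a ∘ y)) (hy' : Function.Injective (a' ∘ y)) :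
    ∃ (m : ι → GL (Fin 2) ℂ) (m' : GL (Fin 2) ℂ),
      Tendsto (fun n => (m n : Matrix (Fin 2) (Fin 2) ℂ)) l (𝓝 m') ∧
      ∀ᶠ n in l, ∀ p : Sphere, g' n • p = m n • g n • p := by
  obtain ⟨k, k₀, hk, hk2⟩ := exists_tendsto_normalization hy (fun i => h (y i))
  obtain ⟨k', k₀', hk', hk2'⟩ := exists_tendsto_normalization hy' (fun i => h' (y i))
  have hdist : ∀ᶠ n in l, Function.Injective fun i => x n (y i) := by
    have h2 : ∀ᶠ n in l, ∀ i j : Fin 3, i ≠ j → g n • x n (y i) ≠ g n • x n (y j) := by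
      simp only [eventually_all]
      exact fun i j hij => eventually_ne_of_tendsto (h (y i)) (h (y j)) (hy.ne hij)
    filter_upwards [h2] with n hn i j hij
    by_contra hne
    exact hn i j hne (congrArg _ hij)
  refine ⟨fun n => (k' n)⁻¹ * k n, k₀'⁻¹ * k₀, ?_, ?_⟩
  · simp only [Units.val_mul]
    exact (tendsto_coe_inv hk').mul hk
  · filter_upwards [hk2, hk2', hdist] with n h1 h2 h3 p
    rw [mul_smul, eq_inv_smul_iff, ← mul_smul, ← mul_smul]
    refine smul_eq_of_three h3 (fun i => ?_) p
    rw [mul_smul, mul_smul]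
    fin_cases i
    · exact h2.1.trans h1.1.symm
    · exact h2.2.1.trans h1.2.1.symm
    · exact h2.2.2.trans h1.2.2.symm

/-- Rescaled to norm one, the transition matrices have a nonzero limit along a subsequence. If it is
invertible, the two limit markings have the same fibers. If it has rank one, it sends every point
except its kernel to one point, so each mark lies in one fixed fiber of `a` or in one fixed fiber of
`a'`. -/
theorem ker_eq_or_cover {X : Type*} {x : ℕ → X → Sphere} {g g' : ℕ → GL (Fin 2) ℂ}
    {a a' : X → Sphere} (h : ∀ y, Tendsto (fun n => g n • x n y) atTop (𝓝 (a y)))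
    (h' : ∀ y, Tendsto (fun n => g' n • x n y) atTop (𝓝 (a' y)))
    (ha : ∃ y z, a y ≠ a z) :
    (∀ y z, a y = a z ↔ a' y = a' z) ∨ ∃ x x', ∀ y, a y = a x ∨ a' y = a' x' := by
  let N : ℕ → Fin 2 → Fin 2 → ℂ := fun n => ((g' n * (g n)⁻¹ : GL (Fin 2) ℂ) : Matrix (Fin 2) (Fin 2) ℂ)
  have hN0 : ∀ n, N n ≠ 0 := fun n hn => by
    have := det_coe_ne_zero (g' n * (g n)⁻¹)
    rw [show ((g' n * (g n)⁻¹ : GL (Fin 2) ℂ) : Matrix (Fin 2) (Fin 2) ℂ) = 0 from hn] at this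
    simp at this
  let c : ℕ → ℂ := fun n => ((‖N n‖⁻¹ : ℝ) : ℂ)
  have hc : ∀ n, c n ≠ 0 := fun n => by simpa [c] using hN0 n
  have hmem : ∀ n, c n • N n ∈ Metric.sphere (0 : Fin 2 → Fin 2 → ℂ) 1 := fun n => by
    rw [mem_sphere_zero_iff_norm, norm_smul]
    simp [c, hN0 n]
  obtain ⟨M, hM, φ, hφ, hlim⟩ := (isCompact_sphere (0 : Fin 2 → Fin 2 → ℂ) 1).tendsto_subseq hmem
  have hM0 : M ≠ 0 := by
    rintro rfl; simp at hM
  have hlim' : Tendsto (fun n => c (φ n) • ((g' (φ n) * (g (φ n))⁻¹ : GL (Fin 2) ℂ) : Matrix (Fin 2) (Fin 2) ℂ))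
    atTop (𝓝 (Matrix.of M)) := hlim
  have key : ∀ y, mv (Matrix.of M) (vec (a y)) ≠ 0 → a' y = ptv (mv (Matrix.of M) (vec (a y))) := by
    intro y hy
    have h1 := tendsto_smul_of_mv_ne_zero (fun n => hc (φ n)) hlim'
      ((h y).comp hφ.tendsto_atTop) hy
    refine tendsto_nhds_unique ((h' y).comp hφ.tendsto_atTop) (h1.congr fun n => ?_)
    simp [mul_smul, Function.comp]
  generalize hMM : Matrix.of M = A at key
  have hA0 : A ≠ 0 := by rintro rfl; exact hM0 hMM
  by_cases hdet : A.det = 0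
  · right
    have col : ∀ v w, cross (mv A v) (mv A w) = 0 := fun v w => by rw [cross_mv, hdet, zero_mul]
    -- The kernel is at most a line, since two independent vectors in it would make `A` zero.
    have ker : ∀ v w, mv A v = 0 → mv A w = 0 → cross v w = 0 := by
      intro v w hv hw
      by_contra hne
      apply hA0
      simp only [mv, Prod.mk_eq_zero] at hv hw
      ext i j
      simp only [cross] at hne
      fin_cases i <;> fin_cases j <;>
        refine (mul_eq_zero.1 ?_).resolve_right hne <;>
        simp only [Fin.zero_eta, Fin.mk_one]
      · linear_combination w.2 * hv.1 - v.2 * hw.1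
      · linear_combination - w.1 * hv.1 + v.1 * hw.1
      · linear_combination w.2 * hv.2 - v.2 * hw.2
      · linear_combination - w.1 * hv.2 + v.1 * hw.2
    obtain ⟨y₁, z₁, hyz⟩ := ha
    obtain ⟨x', hx'⟩ : ∃ x', mv A (vec (a x')) ≠ 0 := by
      by_contra! hall
      exact hyz (cross_vec_eq_zero.1 (ker _ _ (hall y₁) (hall z₁)))
    by_cases hex : ∃ x, mv A (vec (a x)) = 0
    · obtain ⟨x, hx⟩ := hex
      refine ⟨x, x', fun y => ?_⟩
      by_cases hy : mv A (vec (a y)) = 0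
      · exact Or.inl (cross_vec_eq_zero.1 (ker _ _ hy hx))
      · right
        rw [key y hy, key x' hx', ptv_eq_ptv_iff hy hx']
        exact col _ _
    · push Not at hex
      refine ⟨x', x', fun y => Or.inr ?_⟩
      rw [key y (hex y), key x' hx', ptv_eq_ptv_iff (hex y) hx']
      exact col _ _
  · left
    intro y z
    have hy := mv_ne_zero hdet (vec_ne_zero (a y))
    have hz := mv_ne_zero hdet (vec_ne_zero (a z))
    rw [key y hy, key z hz, ptv_eq_ptv_iff hy hz, cross_mv, mul_eq_zero, or_iff_right hdet,
      cross_vec_eq_zero]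

/-- Finitely many points can be moved into the finite plane. -/
theorem exists_smul_ne_infty (s : Set Sphere) (hs : s.Finite) :
    ∃ g : GL (Fin 2) ℂ, ∀ p ∈ s, g • p ≠ ∞ := by
  obtain ⟨z, hz⟩ : ∃ z : ℂ, (z : Sphere) ∉ s := by
    by_contra! hall
    exact Set.infinite_of_injective_forall_mem (OnePoint.coe_injective (X := ℂ)) hall hs
  -- This is p ↦ 1/(p - z), which has its only pole at the point `z` outside `s`.
  refine ⟨glOf !![0, 1; 1, -z] (by simp [Matrix.det_fin_two]), fun p hp hpe => hz ?_⟩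
  have : p = z := by
    rw [smul_eq_ptv, coe_glOf] at hpe
    induction p using OnePoint.rec with
    | infty => simp [mv, ptv, pt] at hpe
    | coe w =>
      by_contra hne
      have hne' : w - z ≠ 0 := sub_ne_zero.2 fun h => hne (by rw [h])
      simp [mv, ptv, pt, ← sub_eq_add_neg, hne'] at hpe
  rwa [← this]

end

section

open Polynomial (C X)

/-! ### Rational maps in homogeneous coordinates -/

/-- The value at `v` of the homogenization of degree `D` of a polynomial. -/
def hom (D : ℕ) (A : ℂ[X]) (v : ℂ × ℂ) : ℂ :=
  ∑ k ∈ Finset.range (D + 1), A.coeff k * v.1 ^ k * v.2 ^ (D - k)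

theorem hom_coe {D : ℕ} {A : ℂ[X]} (h : A.natDegree ≤ D) (z : ℂ) : hom D A (z, 1) = A.eval z := by
  rw [Polynomial.eval_eq_sum_range' (Nat.lt_succ_of_le h)]
  simp [hom]

theorem hom_infty (D : ℕ) (A : ℂ[X]) : hom D A (1, 0) = A.coeff D := by
  rw [hom, Finset.sum_eq_single D]
  · simp
  · intro k hk hkD
    have : D - k ≠ 0 := by have := Finset.mem_range.1 hk; omega
    simp [this]
  · simp

theorem hom_smul (D : ℕ) (A : ℂ[X]) (c : ℂ) (v : ℂ × ℂ) :
    hom D A (c • v) = c ^ D * hom D A v := by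
  simp only [hom, Finset.mul_sum]
  refine Finset.sum_congr rfl fun k hk => ?_
  have : c ^ D = c ^ k * c ^ (D - k) := by
    rw [← pow_add]; congr 1; have := Finset.mem_range.1 hk; omega
  simp only [Prod.smul_fst, Prod.smul_snd, smul_eq_mul, mul_pow, this]
  ring

theorem hom_add (D : ℕ) (A B : ℂ[X]) (v : ℂ × ℂ) : hom D (A + B) v = hom D A v + hom D B v := by
  simp only [hom, ← Finset.sum_add_distrib, Polynomial.coeff_add]
  exact Finset.sum_congr rfl fun k _ => by ring

theorem hom_C_mul (D : ℕ) (c : ℂ) (A : ℂ[X]) (v : ℂ × ℂ) : hom D (C c * A) v = c * hom D A v := by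
  simp only [hom, Finset.mul_sum, Polynomial.coeff_C_mul]
  exact Finset.sum_congr rfl fun k _ => by ring

/-- Two polynomials that define a rational map of degree `D ≥ 1` in lowest terms. -/
structure IsPair (D : ℕ) (A B : ℂ[X]) : Prop where
  coprime : IsCoprime A B
  pos : 1 ≤ D
  left_le : A.natDegree ≤ D
  right_le : B.natDegree ≤ D
  coeff_ne : A.coeff D ≠ 0 ∨ B.coeff D ≠ 0

/-- The self-map of the sphere with homogeneous coordinates given by a pair of polynomials. -/
def pairMap (D : ℕ) (A B : ℂ[X]) (p : Sphere) : Sphere :=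
  ptv (hom D A (vec p), hom D B (vec p))

theorem not_isCoprime_of_root {A B : ℂ[X]} {z : ℂ} (hA : A.eval z = 0) (hB : B.eval z = 0) :
    ¬ IsCoprime A B := by
  rintro ⟨a, b, h⟩
  have := congrArg (Polynomial.eval z) h
  simp [hA, hB] at this

theorem isCoprime_of_no_root {A B : ℂ[X]} (hne : A ≠ 0 ∨ B ≠ 0)
    (h : ∀ z, A.eval z = 0 → B.eval z ≠ 0) : IsCoprime A B := by
  rw [← EuclideanDomain.gcd_isUnit_iff]
  by_contra hu
  have hg : EuclideanDomain.gcd A B ≠ 0 := fun h0 => by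
    rw [EuclideanDomain.gcd_eq_zero_iff] at h0; tauto
  have hdeg : (EuclideanDomain.gcd A B).degree ≠ 0 := fun h0 =>
    hu (Polynomial.isUnit_iff_degree_eq_zero.2 h0)
  obtain ⟨z, hz⟩ := IsAlgClosed.exists_root _ hdeg
  exact h z (Polynomial.eval_eq_zero_of_dvd_of_eval_eq_zero (EuclideanDomain.gcd_dvd_left A B) hz)
    (Polynomial.eval_eq_zero_of_dvd_of_eval_eq_zero (EuclideanDomain.gcd_dvd_right A B) hz)

variable {D : ℕ} {A B : ℂ[X]}

theorem hom_eq_of_ptv {v : ℂ × ℂ} (hv : v ≠ 0) :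
    ∃ c : ℂ, c ≠ 0 ∧ ∀ A, hom D A v = c * hom D A (vec (ptv v)) := by
  obtain ⟨c, hc, hcv⟩ := exists_smul_vec hv
  refine ⟨c ^ D, pow_ne_zero _ hc, fun A => ?_⟩
  conv_lhs => rw [hcv]
  rw [hom_smul]

theorem IsPair.hom_vec_ne_zero (h : IsPair D A B) (p : Sphere) :
    (hom D A (vec p), hom D B (vec p)) ≠ 0 := by
  intro h0
  rw [Prod.mk_eq_zero] at h0
  induction p using OnePoint.rec with
  | infty =>
    rw [vec_infty, hom_infty, hom_infty] at h0
    exact h.coeff_ne.elim (fun h => h h0.1) fun h => h h0.2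
  | coe z =>
    rw [vec_coe, hom_coe h.left_le, hom_coe h.right_le] at h0
    exact not_isCoprime_of_root h0.1 h0.2 h.coprime

theorem pairMap_ptv (D : ℕ) (A B : ℂ[X]) {v : ℂ × ℂ} (hv : v ≠ 0) :
    pairMap D A B (ptv v) = ptv (hom D A v, hom D B v) := by
  obtain ⟨c, hc, h⟩ := hom_eq_of_ptv (D := D) hv
  rw [pairMap, h A, h B, ← ptv_smul hc]
  rfl

theorem IsPair.hom_ne_zero (h : IsPair D A B) {v : ℂ × ℂ} (hv : v ≠ 0) :
    (hom D A v, hom D B v) ≠ 0 := by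
  obtain ⟨c, hc, hcv⟩ := hom_eq_of_ptv (D := D) hv
  have := h.hom_vec_ne_zero (ptv v)
  intro h0
  apply this
  rw [Prod.mk_eq_zero, hcv A, hcv B] at h0
  simpa [hc, Prod.ext_iff] using h0

theorem natDegree_num_le (r : RatFunc ℂ) : r.num.natDegree ≤ ratDegree r := le_max_left _ _

theorem natDegree_denom_le (r : RatFunc ℂ) : r.denom.natDegree ≤ ratDegree r := le_max_right _ _

theorem ratMap_eq_pairMap (r : RatFunc ℂ) :
    ratMap r = pairMap (ratDegree r) r.num r.denom := by
  ext1 p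
  induction p using OnePoint.rec with
  | infty => rw [pairMap, vec_infty, hom_infty, hom_infty]; rfl
  | coe z =>
    rw [pairMap, vec_coe, hom_coe (natDegree_num_le r), hom_coe (natDegree_denom_le r)]; rfl

theorem isPair_num_denom {r : RatFunc ℂ} (h : 1 ≤ ratDegree r) :
    IsPair (ratDegree r) r.num r.denom where
  coprime := r.isCoprime_num_denom
  pos := h
  left_le := natDegree_num_le r
  right_le := natDegree_denom_le r
  coeff_ne := by
    rcases max_choice r.num.natDegree r.denom.natDegree with h1 | h1
    · left
      rw [ratDegree, h1]
      have : r.num ≠ 0 := by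
        rintro h0
        rw [ratDegree, h1, h0] at h
        simp at h
      simpa using this
    · right
      rw [ratDegree, h1]
      simpa using r.denom_ne_zero

/-- The quotient of two polynomials. -/
def ratOf (A B : ℂ[X]) : RatFunc ℂ := algebraMap ℂ[X] (RatFunc ℂ) A / algebraMap ℂ[X] (RatFunc ℂ) B

theorem IsPair.right_ne_zero (h : IsPair D A B) : B ≠ 0 := by
  rintro rfl
  have hu : IsUnit A := isCoprime_zero_right.1 h.coprime
  have h1 := Polynomial.natDegree_eq_zero_of_isUnit hu
  have h2 := h.pos
  rcases h.coeff_ne with h3 | h3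
  · exact h3 (Polynomial.coeff_eq_zero_of_natDegree_lt (by omega))
  · simp at h3

/-- Lowest terms are unique up to a common factor: coprimality makes `B` and the reduced denominator
divide each other, and units are constants. -/
theorem IsPair.exists_num_denom (h : IsPair D A B) : ∃ c : ℂ, c ≠ 0 ∧ (ratOf A B).num = C c * A ∧
    (ratOf A B).denom = C c * B := by
  have h1 : (ratOf A B).num * B = A * (ratOf A B).denom :=
    (RatFunc.num_mul_eq_mul_denom_iff h.right_ne_zero).2 rfl
  have h2 : B ∣ (ratOf A B).denom := h.coprime.symm.dvd_of_dvd_mul_left ⟨(ratOf A B).num, by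
    rw [← h1]; ring⟩
  have h3 : (ratOf A B).denom ∣ B := RatFunc.denom_div_dvd A B
  obtain ⟨u, hu⟩ := associated_of_dvd_dvd h2 h3
  obtain ⟨c, hc, hcu⟩ := Polynomial.isUnit_iff.1 u.isUnit
  refine ⟨c, hc.ne_zero, ?_, ?_⟩
  · refine mul_right_cancel₀ h.right_ne_zero ?_
    rw [h1, ← hu, ← hcu]; ring
  · rw [← hu, ← hcu]; ring

theorem IsPair.max_natDegree (h : IsPair D A B) : max A.natDegree B.natDegree = D := by
  refine le_antisymm (max_le h.left_le h.right_le) ?_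
  rcases h.coeff_ne with h1 | h1
  · exact (Polynomial.le_natDegree_of_ne_zero h1).trans (le_max_left _ _)
  · exact (Polynomial.le_natDegree_of_ne_zero h1).trans (le_max_right _ _)

theorem IsPair.ratDegree_ratOf (h : IsPair D A B) : ratDegree (ratOf A B) = D := by
  obtain ⟨c, hc, h1, h2⟩ := h.exists_num_denom
  rw [ratDegree, h1, h2, Polynomial.natDegree_C_mul hc, Polynomial.natDegree_C_mul hc,
    h.max_natDegree]

theorem IsPair.ratMap_ratOf (h : IsPair D A B) : ratMap (ratOf A B) = pairMap D A B := by
  obtain ⟨c, hc, h1, h2⟩ := h.exists_num_denom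
  ext1 p
  rw [ratMap_eq_pairMap, h.ratDegree_ratOf, h1, h2, pairMap, pairMap, hom_C_mul, hom_C_mul,
    ← ptv_smul hc (hom D A (vec p), _)]
  rfl

/-- The multiplicity of a point of the sphere as a zero of the homogenization of degree `D`. -/
def mulAt (D : ℕ) (A : ℂ[X]) : Sphere → ℕ
  | ∞ => D - A.natDegree
  | (z : ℂ) => A.rootMultiplicity z

theorem mulAt_C_mul {c : ℂ} (hc : c ≠ 0) (D : ℕ) (A : ℂ[X]) (p : Sphere) :
    mulAt D (C c * A) p = mulAt D A p := by
  induction p using OnePoint.rec with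
  | infty => simp [mulAt, Polynomial.natDegree_C_mul hc]
  | coe z =>
    by_cases hA : A = 0
    · simp [hA]
    · have h0 : C c * A ≠ 0 := mul_ne_zero (by simpa using hc) hA
      simp only [mulAt]
      rw [Polynomial.rootMultiplicity_mul h0, Polynomial.rootMultiplicity_C, zero_add]

theorem exists_fiberPoly_eq (r : RatFunc ℂ) {w : ℂ × ℂ} (hw : w ≠ 0) :
    ∃ c : ℂ, c ≠ 0 ∧ C c * fiberPoly r (ptv w) = C w.2 * r.num - C w.1 * r.denom := by
  by_cases h : w.2 = 0
  · have h1 : w.1 ≠ 0 := fun h1 => hw (Prod.ext h1 h)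
    refine ⟨-w.1, neg_ne_zero.2 h1, ?_⟩
    have : ptv w = ∞ := by simp [ptv, pt, h]
    rw [this, h]
    simp [fiberPoly]
  · refine ⟨w.2, h, ?_⟩
    have : ptv w = ((w.1 / w.2 : ℂ) : Sphere) := by simp [ptv, pt, h]
    rw [this]
    simp only [fiberPoly]
    rw [mul_sub, ← mul_assoc (C w.2) (C _), ← Polynomial.C_mul, mul_div_cancel₀ _ h]

theorem multiplicityAt_eq (r : RatFunc ℂ) {w : ℂ × ℂ} (hw : w ≠ 0) (p : Sphere) :
    multiplicityAt r (ptv w) p = mulAt (ratDegree r) (C w.2 * r.num - C w.1 * r.denom) p := by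
  obtain ⟨c, hc, h⟩ := exists_fiberPoly_eq r hw
  rw [← h, mulAt_C_mul hc]
  induction p using OnePoint.rec <;> rfl

theorem IsPair.localDegree_ratOf (h : IsPair D A B) {p : Sphere} {w : ℂ × ℂ} (hw : w ≠ 0)
    (hp : pairMap D A B p = ptv w) :
    localDegree (ratOf A B) p = mulAt D (C w.2 * A - C w.1 * B) p := by
  obtain ⟨c, hc, h1, h2⟩ := h.exists_num_denom
  rw [localDegree, h.ratMap_ratOf, hp, multiplicityAt_eq _ hw, h.ratDegree_ratOf, h1, h2,
    show C w.2 * (C c * A) - C w.1 * (C c * B) = C c * (C w.2 * A - C w.1 * B) by ring,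
    mulAt_C_mul hc]

theorem localDegree_eq_mulAt {r : RatFunc ℂ} {p : Sphere} {w : ℂ × ℂ} (hw : w ≠ 0)
    (hp : ratMap r p = ptv w) :
    localDegree r p = mulAt (ratDegree r) (C w.2 * r.num - C w.1 * r.denom) p := by
  rw [localDegree, hp, multiplicityAt_eq _ hw]

/-! ### Composition with Moebius transformations -/

/-- Substitution of a linear map in the homogenization of degree `D` of a polynomial. -/
def substPoly (D : ℕ) (g : Matrix (Fin 2) (Fin 2) ℂ) (A : ℂ[X]) : ℂ[X] :=
  ∑ k ∈ Finset.range (D + 1), C (A.coeff k) * (C (g 0 0) * X + C (g 0 1)) ^ k *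
    (C (g 1 0) * X + C (g 1 1)) ^ (D - k)

theorem natDegree_linear_pow_le (a b : ℂ) (k : ℕ) : ((C a * X + C b) ^ k).natDegree ≤ k :=
  (Polynomial.natDegree_pow_le_of_le k (m := 1) Polynomial.natDegree_linear_le).trans (by simp)

theorem coeff_linear_pow (a b : ℂ) (k : ℕ) : ((C a * X + C b) ^ k).coeff k = a ^ k := by
  have := Polynomial.coeff_pow_of_natDegree_le (p := C a * X + C b) (m := k) (n := 1)
    Polynomial.natDegree_linear_le
  rw [mul_one] at this
  simpa using this

theorem natDegree_subst_le (D : ℕ) (g : Matrix (Fin 2) (Fin 2) ℂ) (A : ℂ[X]) :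
    (substPoly D g A).natDegree ≤ D := by
  refine Polynomial.natDegree_sum_le_of_forall_le _ _ fun k hk => ?_
  have hk' : k ≤ D := by have := Finset.mem_range.1 hk; omega
  refine Polynomial.natDegree_mul_le.trans ?_
  have h1 := Polynomial.natDegree_C_mul_le (A.coeff k) ((C (g 0 0) * X + C (g 0 1)) ^ k)
  have h2 := natDegree_linear_pow_le (g 0 0) (g 0 1) k
  have h3 := natDegree_linear_pow_le (g 1 0) (g 1 1) (D - k)
  omega

theorem eval_subst (D : ℕ) (g : Matrix (Fin 2) (Fin 2) ℂ) (A : ℂ[X]) (z : ℂ) :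
    (substPoly D g A).eval z = hom D A (mv g (z, 1)) := by
  simp [substPoly, hom, mv, Polynomial.eval_finsetSum]

theorem coeff_subst (D : ℕ) (g : Matrix (Fin 2) (Fin 2) ℂ) (A : ℂ[X]) :
    (substPoly D g A).coeff D = hom D A (mv g (1, 0)) := by
  simp only [substPoly, hom, mv, Polynomial.finsetSum_coeff, mul_one, mul_zero, add_zero]
  refine Finset.sum_congr rfl fun k hk => ?_
  have hk' : k ≤ D := by have := Finset.mem_range.1 hk; omega
  rw [mul_assoc, Polynomial.coeff_C_mul]
  have := Polynomial.coeff_mul_add_eq_of_natDegree_le (natDegree_linear_pow_le (g 0 0) (g 0 1) k)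
    (natDegree_linear_pow_le (g 1 0) (g 1 1) (D - k))
  rw [Nat.add_sub_cancel' hk'] at this
  rw [this, coeff_linear_pow, coeff_linear_pow, mul_assoc]

theorem hom_subst_vec (D : ℕ) (g : Matrix (Fin 2) (Fin 2) ℂ) (A : ℂ[X]) (p : Sphere) :
    hom D (substPoly D g A) (vec p) = hom D A (mv g (vec p)) := by
  induction p using OnePoint.rec with
  | infty => rw [vec_infty, hom_infty, coeff_subst]
  | coe z => rw [vec_coe, hom_coe (natDegree_subst_le _ _ _), eval_subst]

theorem hom_subst (D : ℕ) (g : Matrix (Fin 2) (Fin 2) ℂ) (A : ℂ[X]) {v : ℂ × ℂ} (hv : v ≠ 0) :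
    hom D (substPoly D g A) v = hom D A (mv g v) := by
  obtain ⟨c, hc, hcv⟩ := exists_smul_vec hv
  generalize ptv v = p at hcv
  rw [hcv, hom_smul, mv_smul, hom_smul, hom_subst_vec]

theorem subst_add (D : ℕ) (g : Matrix (Fin 2) (Fin 2) ℂ) (A B : ℂ[X]) :
    substPoly D g (A + B) = substPoly D g A + substPoly D g B := by
  simp only [substPoly, ← Finset.sum_add_distrib, Polynomial.coeff_add, Polynomial.C_add]
  exact Finset.sum_congr rfl fun k _ => by ring

theorem subst_C_mul (D : ℕ) (g : Matrix (Fin 2) (Fin 2) ℂ) (c : ℂ) (A : ℂ[X]) :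
    substPoly D g (C c * A) = C c * substPoly D g A := by
  simp only [substPoly, Finset.mul_sum, Polynomial.coeff_C_mul, Polynomial.C_mul]
  exact Finset.sum_congr rfl fun k _ => by ring

theorem IsPair.subst (h : IsPair D A B) (g : GL (Fin 2) ℂ) :
    IsPair D (substPoly D g A) (substPoly D g B) := by
  have hne : ∀ v : ℂ × ℂ, v ≠ 0 → (hom D A (mv g v), hom D B (mv g v)) ≠ 0 := fun v hv =>
    h.hom_ne_zero (mv_ne_zero (det_coe_ne_zero g) hv)
  have hc := hne (1, 0) (by simp)
  rw [Ne, Prod.mk_eq_zero, not_and_or, ← coeff_subst, ← coeff_subst] at hc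
  refine ⟨isCoprime_of_no_root ?_ fun z h1 h2 => ?_, h.pos, natDegree_subst_le _ _ _,
    natDegree_subst_le _ _ _, hc⟩
  · refine hc.imp (fun h1 h2 => h1 ?_) (fun h1 h2 => h1 ?_) <;> rw [h2, Polynomial.coeff_zero]
  · rw [eval_subst] at h1 h2
    exact hne (z, 1) (by simp) (by rw [h1, h2]; rfl)

theorem pairMap_subst (g : GL (Fin 2) ℂ) (p : Sphere) :
    pairMap D (substPoly D g A) (substPoly D g B) p = pairMap D A B (g • p) := by
  rw [pairMap, hom_subst_vec, hom_subst_vec, smul_eq_ptv, pairMap_ptv]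
  exact mv_ne_zero (det_coe_ne_zero g) (vec_ne_zero p)

theorem IsPair.linear (h : IsPair D A B) (g : GL (Fin 2) ℂ) :
    IsPair D (C (g 0 0) * A + C (g 0 1) * B) (C (g 1 0) * A + C (g 1 1) * B) := by
  have e1 : ∀ v, (hom D (C (g 0 0) * A + C (g 0 1) * B) v,
      hom D (C (g 1 0) * A + C (g 1 1) * B) v) = mv g (hom D A v, hom D B v) := fun v => by
    simp [hom_add, hom_C_mul, mv]
  have hne : ∀ v, v ≠ 0 → (hom D (C (g 0 0) * A + C (g 0 1) * B) v,
      hom D (C (g 1 0) * A + C (g 1 1) * B) v) ≠ 0 := fun v hv => by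
    rw [e1]; exact mv_ne_zero (det_coe_ne_zero g) (h.hom_ne_zero hv)
  have hd : ∀ a b, (C a * A + C b * B).natDegree ≤ D := fun a b =>
    (Polynomial.natDegree_add_le _ _).trans (max_le
      ((Polynomial.natDegree_C_mul_le _ _).trans h.left_le)
      ((Polynomial.natDegree_C_mul_le _ _).trans h.right_le))
  have hc := hne (1, 0) (by simp)
  rw [Ne, Prod.mk_eq_zero, not_and_or, hom_infty, hom_infty] at hc
  refine ⟨isCoprime_of_no_root ?_ fun z h1 h2 => ?_, h.pos, hd _ _, hd _ _, hc⟩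
  · refine hc.imp (fun h1 h2 => h1 ?_) (fun h1 h2 => h1 ?_) <;> rw [h2, Polynomial.coeff_zero]
  · refine hne (z, 1) (by simp) ?_
    rw [hom_coe (hd _ _), hom_coe (hd _ _), h1, h2]; rfl

theorem IsPair.pairMap_linear (h : IsPair D A B) (g : GL (Fin 2) ℂ) (p : Sphere) :
    pairMap D (C (g 0 0) * A + C (g 0 1) * B) (C (g 1 0) * A + C (g 1 1) * B) p =
      g • pairMap D A B p := by
  rw [pairMap, pairMap, smul_ptv g (h.hom_vec_ne_zero p)]
  simp [hom_add, hom_C_mul, mv]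

/-- The factor of the homogenization of `E` that vanishes at the image of `z`, including the factors
at ∞ that count the missing degree, is pulled back to a power of a linear polynomial vanishing at
`z`; the remaining factor does not vanish there. -/
theorem mulAt_subst_coe {E : ℂ[X]} (hE : E ≠ 0) (hD : E.natDegree ≤ D) (g : GL (Fin 2) ℂ) (z : ℂ) :
    (substPoly D g E).rootMultiplicity z = mulAt D E (g • (z : Sphere)) := by
  have hv : mv g (z, 1) ≠ 0 := mv_ne_zero (det_coe_ne_zero g) (by simp)
  rw [smul_eq_ptv, vec_coe]
  -- the factor of multiplicity one
  have lin : ∀ a b : ℂ, (C a * X + C b).eval z = 0 → C a * X + C b ≠ 0 →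
      ∀ (k : ℕ) (S : ℂ[X]), S.eval z ≠ 0 →
        ((C a * X + C b) ^ k * S).rootMultiplicity z = k := by
    intro a b h0 hne k S hS
    have ha : a ≠ 0 := by
      rintro rfl
      apply hne
      simpa using h0
    have e : C a * X + C b = C a * (X - C z) := by
      have : b = -(a * z) := by simp at h0; linear_combination h0
      rw [this]; simp; ring
    have hS0 : S ≠ 0 := by rintro rfl; simp at hS
    have hne2 : C a * (X - C z) ≠ 0 := e ▸ hne
    rw [e, mul_pow, mul_assoc, ← Polynomial.C_pow, Polynomial.rootMultiplicity_mul,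
      Polynomial.rootMultiplicity_C, zero_add, mul_comm,
      Polynomial.rootMultiplicity_mul_X_sub_C_pow hS0, Polynomial.rootMultiplicity_eq_zero hS,
      zero_add]
    rw [← mul_assoc, Polynomial.C_pow, ← mul_pow]
    exact mul_ne_zero (pow_ne_zero _ hne2) hS0
  by_cases h : (mv g (z, 1)).2 = 0
  · have e : ptv (mv g (z, 1)) = ∞ := by simp [ptv, pt, h]
    rw [e]
    simp only [mulAt]
    have h1 : (mv g (z, 1)).1 ≠ 0 := fun h1 => hv (Prod.ext h1 h)
    set m := E.natDegree
    -- The homogenization of degree `D` is that of degree `m` times the power D - m of the second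
    -- coordinate. This power pulls back to the factor whose multiplicity is wanted.
    have es : substPoly D g E = (C (g 1 0) * X + C (g 1 1)) ^ (D - m) * substPoly m g E := by
      rw [substPoly, substPoly, Finset.mul_sum]
      rw [← Finset.sum_subset (Finset.range_mono (Nat.succ_le_succ hD))]
      · refine Finset.sum_congr rfl fun k hk => ?_
        have hk' : k ≤ m := by have := Finset.mem_range.1 hk; omega
        rw [show D - k = (D - m) + (m - k) by omega, pow_add]; ring
      · intro k _ hk
        rw [Polynomial.coeff_eq_zero_of_natDegree_lt (by
          have := Finset.mem_range.not.1 hk; omega)]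
        simp
    rw [es]
    refine lin _ _ (by simpa [mv] using h) ?_ _ _ ?_
    · intro h0
      have c1 := congrArg (fun P => Polynomial.coeff P 1) h0
      have c0 := congrArg (fun P => Polynomial.coeff P 0) h0
      simp at c0 c1
      have := det_coe_ne_zero g
      rw [Matrix.det_fin_two] at this
      simp [c0, c1] at this
    · rw [eval_subst]
      have hsum : hom m E (mv g (z, 1)) = E.leadingCoeff * (mv g (z, 1)).1 ^ m := by
        have : mv g (z, 1) = (mv g (z, 1)).1 • ((1 : ℂ), (0 : ℂ)) := by
          ext <;> simp [h]
        rw [this, hom_smul, hom_infty]; simp [m, mul_comm]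
      rw [hsum]
      exact mul_ne_zero (by simpa using hE) (pow_ne_zero _ h1)
  · set p := (mv g (z, 1)).1 / (mv g (z, 1)).2 with hp
    have e : ptv (mv g (z, 1)) = (p : Sphere) := by simp [ptv, pt, h, hp]
    rw [e]
    simp only [mulAt]
    obtain ⟨F, hF, hF2⟩ := Polynomial.exists_eq_pow_rootMultiplicity_mul_and_not_dvd E hE p
    set k := E.rootMultiplicity p
    have hF0 : F ≠ 0 := by rintro rfl; simp at hF2
    have hFp : F.eval p ≠ 0 := fun h0 => hF2 (Polynomial.dvd_iff_isRoot.2 h0)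
    have hdeg : E.natDegree = k + F.natDegree := by
      rw [hF, Polynomial.natDegree_mul (pow_ne_zero _ (Polynomial.X_sub_C_ne_zero p)) hF0,
        Polynomial.natDegree_pow, Polynomial.natDegree_X_sub_C, mul_one]
    have hFD : F.natDegree ≤ D - k := by omega
    have es : substPoly D g E = (C (g 0 0 - p * g 1 0) * X + C (g 0 1 - p * g 1 1)) ^ k *
        substPoly (D - k) g F := by
      -- Away from the finitely many poles of `g` the vector can be scaled to second coordinate 1,
      -- where `hom` is evaluation and the factorization of `E` applies.
      refine Polynomial.eq_of_infinite_eval_eq _ _ ?_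
      refine (Set.Finite.infinite_compl (s := {x : ℂ | (mv g (x, 1)).2 = 0}) ?_).mono ?_
      · have : (C (g 1 0) * X + C (g 1 1) : ℂ[X]) ≠ 0 := fun h0 => h (by
          have := congrArg (Polynomial.eval z) h0
          simpa [mv] using this)
        refine (Polynomial.finite_setOfPred_isRoot this).subset fun x hx => ?_
        simpa [mv] using hx
      · intro x hx
        replace hx : (mv g (x, 1)).2 ≠ 0 := hx
        have hw : mv g (x, 1) = (mv g (x, 1)).2 • ((mv g (x, 1)).1 / (mv g (x, 1)).2, (1 : ℂ)) := by
          ext <;> simp [mul_div_cancel₀ _ hx]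
        change Polynomial.eval x _ = Polynomial.eval x _
        rw [Polynomial.eval_mul, eval_subst, eval_subst, hw, hom_smul, hom_smul, hom_coe hD,
          hom_coe hFD]
        conv_lhs => rw [hF]
        have hDk : D = k + (D - k) := by omega
        conv_lhs => rw [hDk, pow_add]
        simp only [Polynomial.eval_mul, Polynomial.eval_pow, Polynomial.eval_sub, Polynomial.eval_X,
          Polynomial.eval_C, Polynomial.eval_add]
        have : ((g 0 0 - p * g 1 0) * x + (g 0 1 - p * g 1 1)) =
            (mv g (x, 1)).2 * ((mv g (x, 1)).1 / (mv g (x, 1)).2 - p) := by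
          rw [mul_sub, mul_div_cancel₀ _ hx]
          simp only [mv]; ring
        rw [this, mul_pow]; ring
    rw [es]
    have hroot : (g 0 0 - p * g 1 0) * z + (g 0 1 - p * g 1 1) = 0 := by
      have h3 : (mv g (z, 1)).1 = p * (mv g (z, 1)).2 := by rw [hp, div_mul_cancel₀ _ h]
      simp only [mv] at h3
      linear_combination h3
    refine lin _ _ (by simpa using hroot) ?_ _ _ ?_
    · intro h0
      have c1 := congrArg (fun P => Polynomial.coeff P 1) h0
      have c0 := congrArg (fun P => Polynomial.coeff P 0) h0
      simp only [Polynomial.coeff_add, Polynomial.coeff_C_mul, Polynomial.coeff_X_one, mul_one,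
        Polynomial.coeff_C_succ, add_zero, Polynomial.coeff_zero, Polynomial.coeff_X_zero, mul_zero,
        Polynomial.coeff_C_zero, zero_add] at c0 c1
      have := det_coe_ne_zero g
      rw [Matrix.det_fin_two] at this
      exact this (by linear_combination g 1 1 * c1 - g 1 0 * c0)
    · rw [eval_subst]
      have hw : mv g (z, 1) = (mv g (z, 1)).2 • (p, (1 : ℂ)) := by
        ext <;> simp [hp, mul_div_cancel₀ _ h]
      rw [hw, hom_smul, hom_coe hFD]
      exact mul_ne_zero (pow_ne_zero _ h) hFp

theorem subst_mul (D : ℕ) (g h : GL (Fin 2) ℂ) (E : ℂ[X]) :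
    substPoly D h (substPoly D g E) = substPoly D (g * h : GL (Fin 2) ℂ) E := by
  refine Polynomial.funext fun z => ?_
  rw [eval_subst, eval_subst, hom_subst _ _ _ (mv_ne_zero (det_coe_ne_zero h) (by simp)),
    Units.val_mul, mv_mul]

theorem subst_ne_zero {E : ℂ[X]} (hE : E ≠ 0) (hD : E.natDegree ≤ D) (g : GL (Fin 2) ℂ) :
    substPoly D g E ≠ 0 := by
  intro h0
  have h1 : substPoly D (g * g⁻¹ : GL (Fin 2) ℂ) E = 0 := by
    rw [← subst_mul, h0]
    simp [substPoly]
  apply hE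
  refine Polynomial.funext fun z => ?_
  have := eval_subst D (g * g⁻¹ : GL (Fin 2) ℂ) E z
  rw [h1, mul_inv_cancel] at this
  rw [← hom_coe hD, Polynomial.eval_zero]
  simpa [mv] using this.symm

theorem mulAt_subst {E : ℂ[X]} (hE : E ≠ 0) (hD : E.natDegree ≤ D) (g : GL (Fin 2) ℂ) (p : Sphere) :
    mulAt D (substPoly D g E) p = mulAt D E (g • p) := by
  -- Writing `p` as h⁻¹ • z with `z` finite reduces both sides to the finite case, by composition of
  -- substitutions.
  obtain ⟨h, hh⟩ := exists_smul_ne_infty {h | h = p} (Set.finite_singleton p)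
  have h1 := hh p rfl
  obtain ⟨z, hz⟩ := OnePoint.ne_infty_iff_exists.1 h1
  have hp : p = h⁻¹ • (z : Sphere) := by rw [hz, inv_smul_smul]
  rw [hp, ← mul_smul, ← mulAt_subst_coe hE hD, ← subst_mul,
    ← mulAt_subst_coe (subst_ne_zero hE hD g) (natDegree_subst_le _ _ _)]

/-- Each member of the pencil is the denominator of the pair after a Moebius change of the target,
and denominators are nonzero. -/
theorem IsPair.pencil_ne_zero (h : IsPair D A B) {w : ℂ × ℂ} (hw : w ≠ 0) :
    C w.2 * A - C w.1 * B ≠ 0 := by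
  by_cases h2 : w.2 = 0
  · have h1 : w.1 ≠ 0 := fun h1 => hw (Prod.ext h1 h2)
    have := (h.linear (glOf !![1, 0; w.2, -w.1] (by simpa [Matrix.det_fin_two] using h1))).right_ne_zero
    simpa [sub_eq_add_neg] using this
  · have := (h.linear (glOf !![0, 1; w.2, -w.1] (by simpa [Matrix.det_fin_two] using h2))).right_ne_zero
    simpa [sub_eq_add_neg] using this

theorem natDegree_pencil_le (hA : A.natDegree ≤ D) (hB : B.natDegree ≤ D) (a b : ℂ) :
    (C a * A - C b * B).natDegree ≤ D :=
  (Polynomial.natDegree_sub_le _ _).trans (max_le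
    ((Polynomial.natDegree_C_mul_le _ _).trans hA) ((Polynomial.natDegree_C_mul_le _ _).trans hB))

theorem subst_pencil (g : Matrix (Fin 2) (Fin 2) ℂ) (a b : ℂ) :
    substPoly D g (C a * A - C b * B) = C a * substPoly D g A - C b * substPoly D g B := by
  rw [sub_eq_add_neg, ← neg_mul, ← Polynomial.C_neg, subst_add, subst_C_mul, subst_C_mul,
    Polynomial.C_neg, neg_mul, ← sub_eq_add_neg]

/-- Composition of a rational map with Moebius transformations on both sides. -/
theorem exists_ratMap_comp {r : RatFunc ℂ} (hr : 1 ≤ ratDegree r) (g h : GL (Fin 2) ℂ) :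
    ∃ r' : RatFunc ℂ, ratDegree r' = ratDegree r ∧ (∀ p, ratMap r' p = h • ratMap r (g • p)) ∧
      ∀ p, localDegree r' p = localDegree r (g • p) := by
  have hp := isPair_num_denom hr
  have hs := hp.subst g
  have hl := hs.linear h
  refine ⟨_, hl.ratDegree_ratOf, fun p => ?_, fun p => ?_⟩
  · rw [hl.ratMap_ratOf, hs.pairMap_linear, pairMap_subst, ratMap_eq_pairMap]
  · have hw := vec_ne_zero (ratMap r (g • p))
    set w := vec (ratMap r (g • p)) with hwdef
    rw [localDegree_eq_mulAt hw (ptv_vec _).symm, hl.localDegree_ratOf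
      (mv_ne_zero (det_coe_ne_zero h) hw) (by
        rw [hs.pairMap_linear, pairMap_subst, ← ratMap_eq_pairMap, smul_eq_ptv])]
    rw [← mulAt_subst (hp.pencil_ne_zero hw) (natDegree_pencil_le hp.left_le hp.right_le _ _) g,
      subst_pencil]
    -- The pencil member at the moved vector is det h times the old one, because `cross` is
    -- multiplied by the determinant.
    refine Eq.trans ?_ (mulAt_C_mul (det_coe_ne_zero h) _ _ _)
    congr 1
    rw [Matrix.det_fin_two]
    simp only [mv, Polynomial.C_add, Polynomial.C_mul, Polynomial.C_sub]
    ring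

end

section

open Polynomial (C X)

/-! ### Continuity of rational maps -/

theorem tendsto_hom {ι : Type*} {l : Filter ι} (D : ℕ) {A : ι → ℂ[X]} {A' : ℂ[X]}
    (hA : ∀ k, Tendsto (fun i => (A i).coeff k) l (𝓝 (A'.coeff k))) {w : ι → ℂ × ℂ} {v : ℂ × ℂ}
    (hw : Tendsto w l (𝓝 v)) : Tendsto (fun i => hom D (A i) (w i)) l (𝓝 (hom D A' v)) := by
  refine tendsto_finsetSum _ fun k _ => ?_
  exact ((hA k).mul (((continuous_fst.tendsto v).comp hw).pow k)).mul
    (((continuous_snd.tendsto v).comp hw).pow (D - k))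

theorem tendsto_pairMap {ι : Type*} {l : Filter ι} (D : ℕ) {A B : ι → ℂ[X]} {A' B' : ℂ[X]}
    (hA : ∀ k, Tendsto (fun i => (A i).coeff k) l (𝓝 (A'.coeff k)))
    (hB : ∀ k, Tendsto (fun i => (B i).coeff k) l (𝓝 (B'.coeff k)))
    {p : ι → Sphere} {q : Sphere} (hp : Tendsto p l (𝓝 q))
    (h0 : (hom D A' (vec q), hom D B' (vec q)) ≠ 0) :
    Tendsto (fun i => pairMap D (A i) (B i) (p i)) l (𝓝 (pairMap D A' B' q)) := by
  obtain ⟨w, h1, h2, h3⟩ := exists_lift hp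
  have h4 := (tendsto_hom D hA h1).prodMk_nhds (tendsto_hom D hB h1)
  refine ((continuousAt_ptv h0).tendsto.comp h4).congr fun i => ?_
  rw [← h3 i, pairMap_ptv _ _ _ (h2 i)]
  rfl

variable {D : ℕ} {A B : ℂ[X]}

theorem IsPair.continuous_pairMap (h : IsPair D A B) : Continuous (pairMap D A B) :=
  continuous_iff_continuousAt.2 fun p =>
    tendsto_pairMap D (fun _ => tendsto_const_nhds) (fun _ => tendsto_const_nhds) tendsto_id
      (h.hom_vec_ne_zero p)

theorem continuous_ratMap {r : RatFunc ℂ} (h : 1 ≤ ratDegree r) : Continuous (ratMap r) := by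
  rw [ratMap_eq_pairMap]
  exact (isPair_num_denom h).continuous_pairMap

/-! ### Local homeomorphisms and coverings -/

theorem isLocalHomeomorphOn_smul (g : GL (Fin 2) ℂ) (s : Set Sphere) :
    IsLocalHomeomorphOn (fun p : Sphere => g • p) s :=
  (Homeomorph.smul g).isLocalHomeomorph.isLocalHomeomorphOn

theorem isLocalHomeomorphOn_coe (s : Set ℂ) : IsLocalHomeomorphOn ((↑) : ℂ → Sphere) s :=
  OnePoint.isOpenEmbedding_coe.isLocalHomeomorph.isLocalHomeomorphOn

theorem isLocalHomeomorphOn_congr {α β : Type*} [TopologicalSpace α] [TopologicalSpace β]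
    {f g : α → β} {x : α} (hf : IsLocalHomeomorphOn f {x}) (hfg : f =ᶠ[𝓝 x] g) :
    IsLocalHomeomorphOn g {x} := by
  obtain ⟨e, hxe, rfl⟩ := hf x rfl
  obtain ⟨U, hU, hUo, hxU⟩ := eventually_nhds_iff.1 hfg
  refine IsLocalHomeomorphOn.mk _ _ fun y hy => ?_
  rw [Set.mem_singleton_iff] at hy
  subst hy
  refine ⟨e.restr U, ?_, fun z hz => ?_⟩
  · rw [e.restr_source' U hUo]; exact ⟨hxe, hxU⟩
  · rw [e.restr_source' U hUo] at hz
    exact (hU z hz.2).symm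

theorem isLocalHomeomorphOn_of_forall {α β : Type*} [TopologicalSpace α] [TopologicalSpace β]
    {f : α → β} {s : Set α} (h : ∀ x ∈ s, IsLocalHomeomorphOn f {x}) : IsLocalHomeomorphOn f s :=
  fun x hx => h x hx x rfl

theorem pairMap_coe (hA : A.natDegree ≤ D) (hB : B.natDegree ≤ D) (z : ℂ) :
    pairMap D A B z = pt (A.eval z) (B.eval z) := by
  rw [pairMap, vec_coe, hom_coe hA, hom_coe hB, ptv]

/-- The derivative of A/B is minus the Wronskian divided by B², so the inverse function theorem
applies. -/
theorem IsPair.isLocalHomeomorphOn_of_eval_ne (h : IsPair D A B) {z : ℂ}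
    (hW : (Polynomial.wronskian A B).eval z ≠ 0) (hB : B.eval z ≠ 0) :
    IsLocalHomeomorphOn (pairMap D A B) {(z : Sphere)} := by
  have e1 : ({(z : Sphere)} : Set Sphere) = ((↑) : ℂ → Sphere) '' {z} := by simp
  rw [e1]
  refine IsLocalHomeomorphOn.of_comp_right ?_ (isLocalHomeomorphOn_coe {z})
  set F : ℂ → ℂ := fun x => A.eval x / B.eval x with hF
  have hd : HasStrictDerivAt F
      ((A.derivative.eval z * B.eval z - A.eval z * B.derivative.eval z) / B.eval z ^ 2) z :=
    (A.hasStrictDerivAt z).div (B.hasStrictDerivAt z) hB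
  have hne : (A.derivative.eval z * B.eval z - A.eval z * B.derivative.eval z) / B.eval z ^ 2 ≠ 0 := by
    refine div_ne_zero (fun h0 => hW ?_) (pow_ne_zero _ hB)
    simp only [Polynomial.wronskian, Polynomial.eval_sub, Polynomial.eval_mul]
    linear_combination -h0
  have hFl : IsLocalHomeomorphOn F {z} := by
    intro x hx
    rw [Set.mem_singleton_iff] at hx
    subst hx
    have hfd := hd.hasStrictFDerivAt_equiv hne
    exact ⟨hfd.toOpenPartialHomeomorph F, hfd.mem_toOpenPartialHomeomorph_source, rfl⟩
  refine isLocalHomeomorphOn_congr ((isLocalHomeomorphOn_coe Set.univ).comp hFl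
    (fun _ _ => Set.mem_univ _)) ?_
  filter_upwards [B.continuous.continuousAt.eventually_ne hB] with x hx
  simp [pairMap_coe h.left_le h.right_le, pt, hx, hF]

/-- The transposition of the coordinates. -/
def swapGL : GL (Fin 2) ℂ := glOf !![0, 1; 1, 0] (by simp [Matrix.det_fin_two])

theorem IsPair.swap (h : IsPair D A B) : IsPair D B A :=
  ⟨h.coprime.symm, h.pos, h.right_le, h.left_le, h.coeff_ne.symm⟩

theorem IsPair.swapGL_smul_pairMap (h : IsPair D A B) (p : Sphere) :
    swapGL • pairMap D B A p = pairMap D A B p := by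
  rw [pairMap, smul_ptv _ (h.swap.hom_vec_ne_zero p)]
  simp [swapGL, mv, pairMap]

theorem IsPair.isLocalHomeomorphOn_coe (h : IsPair D A B) {z : ℂ}
    (hW : (Polynomial.wronskian A B).eval z ≠ 0) :
    IsLocalHomeomorphOn (pairMap D A B) {(z : Sphere)} := by
  -- At a pole the coordinates of the target are interchanged, which only changes the sign of the
  -- Wronskian.
  by_cases hB : B.eval z = 0
  · have hA : A.eval z ≠ 0 := fun hA => not_isCoprime_of_root hA hB h.coprime
    have hW' : (Polynomial.wronskian B A).eval z ≠ 0 := by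
      rw [← Polynomial.wronskian_neg_eq, Polynomial.eval_neg]
      exact neg_ne_zero.2 hW
    have := (isLocalHomeomorphOn_smul swapGL Set.univ).comp
      (h.swap.isLocalHomeomorphOn_of_eval_ne hW' hA) (fun _ _ => Set.mem_univ _)
    convert this using 1
    ext1 p
    exact (h.swapGL_smul_pairMap p).symm
  · exact h.isLocalHomeomorphOn_of_eval_ne hW hB

theorem coeff_subst_swapGL (D : ℕ) (A : ℂ[X]) {j : ℕ} (hj : j ≤ D) :
    (substPoly D swapGL A).coeff j = A.coeff (D - j) := by
  have e : substPoly D swapGL A = ∑ k ∈ Finset.range (D + 1), C (A.coeff k) * X ^ (D - k) := by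
    refine Finset.sum_congr rfl fun k _ => ?_
    simp [swapGL]
  rw [e, Polynomial.finsetSum_coeff, Finset.sum_eq_single (D - j)]
  · rw [Polynomial.coeff_C_mul_X_pow, if_pos (by omega)]
  · intro k hk hkj
    rw [Polynomial.coeff_C_mul_X_pow, if_neg]
    have := Finset.mem_range.1 hk
    omega
  · intro hn
    exact absurd (Finset.mem_range.2 (by omega)) hn

theorem swapGL_smul_zero : swapGL • ((0 : ℂ) : Sphere) = ∞ := by
  rw [smul_eq_ptv]; simp [swapGL, mv, ptv, pt]

/-- In the coordinate 1/z the coefficients are reversed, and the Wronskian at 0 becomes A_D B_{D-1}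
since B_D = 0. -/
theorem IsPair.isLocalHomeomorphOn_infty (h : IsPair D A B) (hA : A.coeff D ≠ 0)
    (hB : B.coeff D = 0) (hB' : B.coeff (D - 1) ≠ 0) :
    IsLocalHomeomorphOn (pairMap D A B) {(∞ : Sphere)} := by
  have h1 : (Polynomial.wronskian (substPoly D swapGL A) (substPoly D swapGL B)).eval 0 ≠ 0 := by
    simp only [Polynomial.wronskian, Polynomial.eval_sub, Polynomial.eval_mul]
    rw [← Polynomial.coeff_zero_eq_eval_zero, ← Polynomial.coeff_zero_eq_eval_zero,
      ← Polynomial.coeff_zero_eq_eval_zero, ← Polynomial.coeff_zero_eq_eval_zero,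
      Polynomial.coeff_derivative, Polynomial.coeff_derivative,
      coeff_subst_swapGL _ _ (Nat.zero_le _), coeff_subst_swapGL _ _ (Nat.zero_le _),
      coeff_subst_swapGL _ _ h.pos, coeff_subst_swapGL _ _ h.pos, Nat.sub_zero, hB]
    simpa using ⟨hA, hB'⟩
  have h2 := (h.subst swapGL).isLocalHomeomorphOn_coe h1
  have e : ({(∞ : Sphere)} : Set Sphere) = (fun p : Sphere => swapGL • p) '' {((0 : ℂ) : Sphere)} := by
    simp [swapGL_smul_zero]
  rw [e]
  refine IsLocalHomeomorphOn.of_comp_right ?_ (isLocalHomeomorphOn_smul _ _)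
  convert h2 using 1
  ext1 p
  exact (pairMap_subst _ _).symm

theorem isCoveringMap_restrict {α β : Type*} [TopologicalSpace α] [TopologicalSpace β] {f : α → β}
    {S : Set α} {T : Set β} (h : Set.MapsTo f S T) (hST : f ⁻¹' T = S) (hf : IsCoveringMapOn f T) :
    IsCoveringMap h.restrict := by
  subst hST
  exact hf.isCoveringMap_restrictPreimage

/-! ### Winding numbers and coverings -/

/-- The integral of the logarithmic derivative over the circle would be the increment of `L` over a
period, which is 0. By Cauchy it is 2πi, since `u₁` lies inside and `u₂` outside. -/
theorem not_exists_log_on_circle {e u₁ u₂ : ℂ} {ρ : ℝ} (h1 : u₁ ∈ Metric.ball e ρ)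
    (h2 : u₂ ∉ Metric.closedBall e ρ) {L : ℝ → ℂ} (hL : Continuous L)
    (hper : L (2 * Real.pi) = L 0)
    (hexp : ∀ θ, Complex.exp (L θ) = (circleMap e ρ θ - u₁) / (circleMap e ρ θ - u₂)) : False := by
  have hρ : 0 < ρ := dist_nonneg.trans_lt h1
  have hn1 : ∀ θ, circleMap e ρ θ - u₁ ≠ 0 := fun θ h0 => by
    rw [sub_eq_zero] at h0
    have := circleMap_mem_sphere e hρ.le θ
    rw [h0, Metric.mem_sphere] at this
    rw [Metric.mem_ball, this] at h1
    exact lt_irrefl _ h1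
  have hn2 : ∀ θ, circleMap e ρ θ - u₂ ≠ 0 := fun θ h0 => by
    rw [sub_eq_zero] at h0
    exact h2 (h0 ▸ circleMap_mem_closedBall e hρ.le θ)
  set k : ℝ → ℂ := fun θ => (circleMap e ρ θ - u₁) / (circleMap e ρ θ - u₂) with hk
  have hk0 : ∀ θ, k θ ≠ 0 := fun θ => div_ne_zero (hn1 θ) (hn2 θ)
  have hcd : ∀ θ, HasDerivAt (circleMap e ρ) (deriv (circleMap e ρ) θ) θ := fun θ =>
    (differentiable_circleMap e ρ θ).hasDerivAt
  have hkd : ∀ θ, HasDerivAt k (k θ * (deriv (circleMap e ρ) θ *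
      ((circleMap e ρ θ - u₁)⁻¹ - (circleMap e ρ θ - u₂)⁻¹))) θ := fun θ => by
    have := ((hcd θ).sub_const u₁).div ((hcd θ).sub_const u₂) (hn2 θ)
    refine this.congr_deriv ?_
    have h3 := hn1 θ
    have h4 := hn2 θ
    simp only [hk]
    field_simp
  -- Only continuity of `L` is given. Near θ the increment of `L` has norm less than π, so it is the
  -- principal logarithm of the quotient of the exponentials, and this is differentiable.
  have hLd : ∀ θ, HasDerivAt L (deriv (circleMap e ρ) θ *
      ((circleMap e ρ θ - u₁)⁻¹ - (circleMap e ρ θ - u₂)⁻¹)) θ := fun θ => by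
    have h3 : HasDerivAt (fun t => L θ + Complex.log (k t / k θ)) (deriv (circleMap e ρ) θ *
      ((circleMap e ρ θ - u₁)⁻¹ - (circleMap e ρ θ - u₂)⁻¹)) θ := by
      have := (((hkd θ).div_const (k θ)).clog_real (by
        rw [div_self (hk0 θ)]; exact Complex.one_mem_slitPlane)).const_add (L θ)
      refine this.congr_deriv ?_
      rw [div_self (hk0 θ), div_one, mul_div_cancel_left₀ _ (hk0 θ)]
    refine h3.congr_of_eventuallyEq ?_
    have hcont : Tendsto (fun t => ‖L t - L θ‖) (𝓝 θ) (𝓝 0) := by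
      have := ((hL.tendsto θ).sub_const (L θ)).norm
      simpa using this
    filter_upwards [hcont.eventually_lt_const Real.pi_pos] with t ht
    have him := (abs_lt.1 ((Complex.abs_im_le_norm _).trans_lt ht))
    rw [hk]
    simp only
    rw [← hexp, ← hexp, ← Complex.exp_sub, Complex.log_exp him.1 him.2.le]
    ring
  have hcont : Continuous fun θ => deriv (circleMap e ρ) θ *
      ((circleMap e ρ θ - u₁)⁻¹ - (circleMap e ρ θ - u₂)⁻¹) := by
    have hc := continuous_circleMap e ρ
    refine Continuous.mul ?_ (((hc.sub continuous_const).inv₀ hn1).sub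
      ((hc.sub continuous_const).inv₀ hn2))
    have : deriv (circleMap e ρ) = fun θ => circleMap 0 ρ θ * Complex.I := by
      ext θ; exact deriv_circleMap e ρ θ
    rw [this]
    exact (continuous_circleMap 0 ρ).mul continuous_const
  have hint := intervalIntegral.integral_eq_sub_of_hasDerivAt (a := 0) (b := 2 * Real.pi)
    (fun θ _ => hLd θ) (hcont.intervalIntegrable _ _)
  rw [hper, sub_self] at hint
  have hc1 : CircleIntegrable (fun z => (z - u₁)⁻¹) e ρ := by
    refine ContinuousOn.circleIntegrable hρ.le (ContinuousOn.inv₀ (by fun_prop) fun z hz => ?_)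
    intro h0
    rw [sub_eq_zero] at h0
    rw [h0, Metric.mem_sphere] at hz
    rw [Metric.mem_ball, hz] at h1
    exact lt_irrefl _ h1
  have hne2 : ∀ z ∈ Metric.closedBall e ρ, z - u₂ ≠ 0 := fun z hz h0 =>
    h2 (sub_eq_zero.1 h0 ▸ hz)
  have hc2 : CircleIntegrable (fun z => (z - u₂)⁻¹) e ρ :=
    ContinuousOn.circleIntegrable hρ.le (ContinuousOn.inv₀ (by fun_prop) fun z hz =>
      hne2 z (Metric.sphere_subset_closedBall hz))
  have hI := circleIntegral.integral_sub hc1 hc2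
  have h0 : (∮ z in C(e, ρ), (z - u₂)⁻¹) = 0 := by
    refine Complex.circleIntegral_eq_zero_of_differentiable_on_off_countable hρ.le
      Set.countable_empty (ContinuousOn.inv₀ (by fun_prop) hne2) (fun z hz => ?_)
    have := hne2 z (Metric.ball_subset_closedBall hz.1)
    fun_prop (disch := assumption)
  rw [circleIntegral.integral_sub_inv_of_mem_ball h1, h0] at hI
  simp only [circleIntegral, smul_eq_mul] at hI
  rw [hint] at hI
  simp at hI

/-- The disc is simply connected and `f` is a covering over it, so the disc lifts through a point of
the circle. The lift contains the whole circle but avoids `u₁` and `u₂`, whose images lie outside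
`S`. Hence (x - u₁)/(x - u₂) has a logarithm on the lifted disc, and so on the circle, which is
impossible for a circle separating the two points. -/
theorem not_isCoveringMapOn_of_circle {f : Sphere → Sphere} {S : Set Sphere}
    (hf : IsCoveringMapOn f S) {m : GL (Fin 2) ℂ} {r : ℝ}
    (hS : ∀ t ∈ Metric.ball (0 : ℂ) r, m • (t : Sphere) ∈ S) {e u₁ u₂ : ℂ} {ρ : ℝ}
    (h1 : u₁ ∈ Metric.ball e ρ) (h2 : u₂ ∉ Metric.closedBall e ρ) (hf1 : f u₁ ∉ S) (hf2 : f u₂ ∉ S)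
    (hfc : ∀ θ, ∃ t ∈ Metric.ball (0 : ℂ) r, f (circleMap e ρ θ) = m • (t : Sphere)) : False := by
  choose τ hτ hfτ using hfc
  have hτ0 := hτ 0
  set U := Metric.ball (0 : ℂ) r
  have hcon : ContractibleSpace U := (convex_ball (0 : ℂ) r).contractibleSpace ⟨_, hτ0⟩
  have hloc : LocallyPathConnectedSpace U := Metric.isOpen_ball.locallyPathConnectedSpace
  let j : C(U, Sphere) := ⟨fun t => m • ((t : ℂ) : Sphere),
    (continuous_const_smul m).comp (OnePoint.continuous_coe.comp continuous_subtype_val)⟩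
  obtain ⟨s, ⟨hs0, hsj⟩, -⟩ := hf.existsUnique_continuousMap_lifts j (a₀ := ⟨τ 0, hτ0⟩)
    (e₀ := (circleMap e ρ 0 : Sphere)) (hfτ 0) (fun t => hS t t.2)
  have hfs : ∀ t, f (s t) = m • ((t : ℂ) : Sphere) := fun t => congrFun hsj t
  -- the parameter on the circle is continuous
  have hcircle : Continuous fun θ : ℝ => (circleMap e ρ θ : Sphere) :=
    OnePoint.continuous_coe.comp (continuous_circleMap e ρ)
  have hmemS : ∀ θ : ℝ, (circleMap e ρ θ : Sphere) ∈ f ⁻¹' S := fun θ => by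
    rw [Set.mem_preimage, hfτ]; exact hS _ (hτ θ)
  have hτc : Continuous fun θ => (⟨τ θ, hτ θ⟩ : U) := by
    refine Continuous.subtype_mk ?_ _
    rw [OnePoint.isOpenEmbedding_coe.isInducing.continuous_iff]
    have e1 : ((↑) : ℂ → Sphere) ∘ τ = fun θ => m⁻¹ • f (circleMap e ρ θ) := by
      ext1 θ; rw [hfτ, inv_smul_smul]; rfl
    rw [e1]
    refine (continuous_const_smul m⁻¹).comp ?_
    exact hf.continuousOn.comp_continuous hcircle hmemS
  -- The circle and the lifted disc along `τ` are two lifts of the same path with the same starting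
  -- point.
  have hsτ : ∀ θ, s ⟨τ θ, hτ θ⟩ = (circleMap e ρ θ : Sphere) := by
    have hcov := hf.isCoveringMap_restrictPreimage
    have hsS : ∀ θ, s ⟨τ θ, hτ θ⟩ ∈ f ⁻¹' S := fun θ => by
      rw [Set.mem_preimage, hfs]; exact hS _ (hτ θ)
    have := hcov.eq_of_comp_eq (g₁ := fun θ : ℝ => (⟨s ⟨τ θ, hτ θ⟩, hsS θ⟩ : f ⁻¹' S))
      (g₂ := fun θ : ℝ => (⟨(circleMap e ρ θ : Sphere), hmemS θ⟩ : f ⁻¹' S))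
      (Continuous.subtype_mk (s.continuous.comp hτc) _) (Continuous.subtype_mk hcircle _)
      (by
        ext1 θ
        apply Subtype.ext
        simp only [Function.comp, Set.restrictPreimage_coe]
        rw [hfs, hfτ]) 0 (Subtype.ext hs0)
    intro θ
    exact congrArg Subtype.val (congrFun this θ)
  -- a logarithm of `(x - u₁) / (x - u₂)`
  have hne : u₁ ≠ u₂ := by
    rintro rfl; exact h2 (Metric.ball_subset_closedBall h1)
  let N : GL (Fin 2) ℂ := glOf !![1, -u₁; 1, -u₂] (by
    simp [Matrix.det_fin_two]; exact fun h0 => hne (by linear_combination h0))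
  have hN : ∀ x : ℂ, N • (x : Sphere) = pt (x - u₁) (x - u₂) := fun x => by
    rw [smul_eq_ptv]; simp [N, mv, ptv, sub_eq_add_neg]
  have hNs : ∀ t, ∃ κ : ℂ, κ ≠ 0 ∧ (κ : Sphere) = N • s t := by
    intro t
    have ht1 : s t ≠ u₁ := fun h0 => hf1 (by rw [← h0, hfs]; exact hS _ t.2)
    have ht2 : s t ≠ u₂ := fun h0 => hf2 (by rw [← h0, hfs]; exact hS _ t.2)
    have hi1 : N • s t ≠ ((0 : ℂ) : Sphere) := fun h0 => ht1 (by
      refine smul_left_cancel N ?_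
      rw [h0, hN]; simp [pt, sub_ne_zero.2 hne])
    have hi2 : N • s t ≠ ∞ := fun h0 => ht2 (by
      refine smul_left_cancel N ?_
      rw [h0, hN]; simp [pt])
    obtain ⟨κ, hκ⟩ := OnePoint.ne_infty_iff_exists.1 hi2
    exact ⟨κ, fun h0 => hi1 (by rw [← hκ, h0]), hκ⟩
  choose κ hκ0 hκ using hNs
  have hκc : Continuous κ := by
    rw [OnePoint.isOpenEmbedding_coe.isInducing.continuous_iff]
    have e1 : ((↑) : ℂ → Sphere) ∘ κ = fun t => N • s t := by
      ext1 t; exact hκ t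
    rw [e1]
    exact (continuous_const_smul N).comp s.continuous
  obtain ⟨h, ⟨-, hh⟩, -⟩ := Complex.isCoveringMapOn_exp.existsUnique_continuousMap_lifts
    (⟨κ, hκc⟩ : C(U, ℂ)) (a₀ := ⟨τ 0, hτ0⟩) (Complex.exp_log (hκ0 _)) (fun t => hκ0 t)
  have hne2 : ∀ θ, circleMap e ρ θ - u₂ ≠ 0 := fun θ h0 => by
    rw [sub_eq_zero] at h0
    exact h2 (h0 ▸ circleMap_mem_closedBall e (dist_nonneg.trans_lt h1).le θ)
  refine not_exists_log_on_circle h1 h2 (L := fun θ => h ⟨τ θ, hτ θ⟩) (h.continuous.comp hτc) ?_ ?_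
  · have hc : circleMap e ρ (2 * Real.pi) = circleMap e ρ 0 := by
      have := periodic_circleMap e ρ 0
      rwa [zero_add] at this
    have : τ (2 * Real.pi) = τ 0 := by
      have h3 := hfτ (2 * Real.pi)
      rw [hc, hfτ 0] at h3
      exact (OnePoint.coe_injective (smul_left_cancel m h3)).symm
    simp only [this]
  · intro θ
    have h3 : Complex.exp (h ⟨τ θ, hτ θ⟩) = κ ⟨τ θ, hτ θ⟩ := congrFun hh _
    rw [h3]
    have h4 := hκ ⟨τ θ, hτ θ⟩
    rw [hsτ, hN] at h4
    simpa [pt, hne2 θ] using h4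

theorem eventually_forall_mem_of_isCompact {ι α : Type*} [TopologicalSpace α] {l : Filter ι}
    {K : Set α} (hK : IsCompact K) {P : ι → α → Prop}
    (h : ∀ y ∈ K, ∀ᶠ z : ι × α in l ×ˢ 𝓝 y, P z.1 z.2) : ∀ᶠ i in l, ∀ y ∈ K, P i y := by
  refine hK.induction_on (p := fun s => ∀ᶠ i in l, ∀ y ∈ s, P i y) (by simp) ?_ ?_ ?_
  · intro s t hst ht
    filter_upwards [ht] with i hi y hy using hi y (hst hy)
  · intro s t hs ht
    filter_upwards [hs, ht] with i h1 h2 y hy using hy.elim (h1 y) (h2 y)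
  · intro y hy
    obtain ⟨p, hp, q, hq, hpq⟩ := eventually_prod_iff.1 (h y hy)
    exact ⟨{z | q z}, mem_nhdsWithin_of_mem_nhds hq, by
      filter_upwards [hp] with i hi z hz using hpq hi hz⟩

end

section

open Polynomial (C X wronskian)

/-! ### Wronskians -/

theorem wronskian_C_mul_right (c : ℂ) (A B : ℂ[X]) : wronskian A (C c * B) = C c * wronskian A B := by
  simp [wronskian]; ring

theorem wronskian_linear (a b c d : ℂ) (A B : ℂ[X]) :
    wronskian (C a * A + C b * B) (C c * A + C d * B) = C (a * d - b * c) * wronskian A B := by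
  simp [wronskian]; ring

theorem wronskian_mul_mul (U A B : ℂ[X]) : wronskian (U * A) (U * B) = U ^ 2 * wronskian A B := by
  simp [wronskian]; ring

/-- Differentiation lowers the order of vanishing by at most one. -/
theorem pow_dvd_wronskian {L A : ℂ[X]} {z : ℂ} {k : ℕ} (h : (X - C z) ^ k ∣ L) :
    (X - C z) ^ (k - 1) ∣ wronskian L A := by
  obtain ⟨S, rfl⟩ := h
  rcases Nat.eq_zero_or_pos k with rfl | hk
  · simp
  obtain ⟨j, rfl⟩ : ∃ j, k = j + 1 := ⟨k - 1, by omega⟩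
  refine ⟨(X - C z) * S * A.derivative - (C (j + 1 : ℂ) * S + (X - C z) * S.derivative) * A, ?_⟩
  simp only [wronskian, Polynomial.derivative_mul, Polynomial.derivative_X_sub_C_pow,
    Nat.add_sub_cancel]
  push_cast
  rw [pow_succ]
  simp only [Polynomial.C_add, Polynomial.C_1]
  ring

/-- After multiplication by X the derivative becomes the Euler operator, which multiplies the
coefficient of X^k by k without shifting the index. -/
theorem coeff_X_mul_wronskian (A B : ℂ[X]) (n : ℕ) : (X * wronskian A B).coeff n =
    ∑ x ∈ Finset.HasAntidiagonal.antidiagonal n, ((x.2 : ℂ) - x.1) * A.coeff x.1 * B.coeff x.2 := by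
  have hX : ∀ (Q : ℂ[X]) (k : ℕ), (X * Q.derivative).coeff k = k * Q.coeff k := by
    intro Q k
    cases k with
    | zero => simp
    | succ k => rw [Polynomial.coeff_X_mul, Polynomial.coeff_derivative]; push_cast; ring
  have e : X * wronskian A B = A * (X * B.derivative) - (X * A.derivative) * B := by
    simp only [wronskian]; ring
  rw [e, Polynomial.coeff_sub, Polynomial.coeff_mul, Polynomial.coeff_mul, ← Finset.sum_sub_distrib]
  refine Finset.sum_congr rfl fun x _ => ?_
  rw [hX, hX]; ring

/-- The top coefficients of a Wronskian with a monic polynomial, as a recursion. -/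
theorem coeff_recursion {A : ℂ[X]} (hA : A.Monic) (B : ℂ[X]) (k : ℕ) :
    ((k : ℂ) - A.natDegree) * B.coeff k = (X * wronskian A B).coeff (A.natDegree + k) -
      ∑ x ∈ (Finset.HasAntidiagonal.antidiagonal (A.natDegree + k)).filter (fun x => k < x.2),
        ((x.2 : ℂ) - x.1) * A.coeff x.1 * B.coeff x.2 := by
  -- Among the terms with second index at most `k`, only the one with the leading coefficient of `A`
  -- survives: a smaller second index forces the first one beyond the degree of `A`.
  rw [coeff_X_mul_wronskian, ← Finset.sum_filter_add_sum_filter_not _ (fun x : ℕ × ℕ => k < x.2),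
    add_sub_cancel_left, Finset.sum_eq_single (A.natDegree, k)]
  · simp [hA.leadingCoeff, Polynomial.coeff_natDegree]
  · rintro ⟨i, j⟩ hx hne
    simp only [Finset.mem_filter, Finset.HasAntidiagonal.mem_antidiagonal, not_lt] at hx
    have : A.natDegree < i := by
      rcases lt_or_eq_of_le hx.2 with h | h
      · omega
      · exfalso; apply hne; ext <;> simp <;> omega
    simp [Polynomial.coeff_eq_zero_of_natDegree_lt this]
  · intro h; simp at h

theorem coeff_wronskian_top {A B : ℂ[X]} (hA : A.Monic) {k : ℕ} (hk : B.natDegree ≤ k) :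
    (X * wronskian A B).coeff (A.natDegree + k) = ((k : ℂ) - A.natDegree) * B.coeff k := by
  rw [coeff_recursion hA, Finset.sum_eq_zero, sub_zero]
  rintro ⟨i, j⟩ hx
  simp only [Finset.mem_filter] at hx
  rw [Polynomial.coeff_eq_zero_of_natDegree_lt (lt_of_le_of_lt hk hx.2), mul_zero]

/-- The top coefficient is the difference of the degrees times the leading coefficient of `B`, and
this is nonzero in characteristic 0. -/
theorem wronskian_ne_zero_of_natDegree_lt {A B : ℂ[X]} (hA : A.Monic) (hB : B ≠ 0)
    (hlt : B.natDegree < A.natDegree) : wronskian A B ≠ 0 := by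
  intro h0
  have := coeff_wronskian_top hA (le_refl B.natDegree)
  rw [h0, mul_zero, Polynomial.coeff_zero] at this
  rcases mul_eq_zero.1 this.symm with h | h
  · rw [sub_eq_zero] at h
    have : B.natDegree = A.natDegree := by exact_mod_cast h
    omega
  · exact hB (by simpa using h)

theorem natDegree_wronskian_le (A B : ℂ[X]) : (wronskian A B).natDegree ≤ A.natDegree + B.natDegree - 1 := by
  by_cases h : wronskian A B = 0
  · simp [h]
  · have := Polynomial.natDegree_wronskian_lt_add h
    omega

/-! ### The polynomials of a marked map with finite marking -/

section Portrait

variable {Y : Type u} {Z : Type v} [Fintype Y] (P : Portrait Y Z)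

open scoped Classical in
/-- The monic polynomial with the roots prescribed by the portrait over `b`. -/
def fiberProd (x : Y → ℂ) (b : Z) : ℂ[X] := ∏ a with P.F a = b, (X - C (x a)) ^ P.deg a

/-- The monic polynomial with the critical points as roots. -/
def critProd (x : Y → ℂ) : ℂ[X] := ∏ a, (X - C (x a)) ^ (P.deg a - 1)

theorem monic_fiberProd (x : Y → ℂ) (b : Z) : (fiberProd P x b).Monic :=
  Polynomial.monic_prod_of_monic _ _ fun _ _ => (Polynomial.monic_X_sub_C _).pow _

theorem monic_critProd (x : Y → ℂ) : (critProd P x).Monic :=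
  Polynomial.monic_prod_of_monic _ _ fun _ _ => (Polynomial.monic_X_sub_C _).pow _

theorem natDegree_fiberProd (x : Y → ℂ) (b : Z) : (fiberProd P x b).natDegree = P.degree := by
  rw [fiberProd, Polynomial.natDegree_prod_of_monic _ _ fun _ _ => (Polynomial.monic_X_sub_C _).pow _,
    ← P.sum_fiber b]
  exact Finset.sum_congr rfl fun a _ => by simp

theorem natDegree_critProd (x : Y → ℂ) : (critProd P x).natDegree = 2 * P.degree - 2 := by
  rw [critProd, Polynomial.natDegree_prod_of_monic _ _ fun _ _ => (Polynomial.monic_X_sub_C _).pow _,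
    ← P.sum_deg_sub_one]
  exact Finset.sum_congr rfl fun a _ => by simp

theorem eval_fiberProd_eq_zero_iff (x : Y → ℂ) (b : Z) (z : ℂ) :
    (fiberProd P x b).eval z = 0 ↔ ∃ a, P.F a = b ∧ x a = z := by
  classical
  rw [fiberProd, Polynomial.eval_prod, Finset.prod_eq_zero_iff]
  simp only [Finset.mem_filter, Finset.mem_univ, true_and, Polynomial.eval_pow, Polynomial.eval_sub,
    Polynomial.eval_X, Polynomial.eval_C]
  refine exists_congr fun a => and_congr_right fun _ => ?_
  rw [pow_eq_zero_iff (P.deg_pos a).ne', sub_eq_zero, eq_comm]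

theorem eval_critProd_ne_zero {x : Y → ℂ} {z : ℂ} (hz : z ∉ Set.range x) :
    (critProd P x).eval z ≠ 0 := by
  rw [critProd, Polynomial.eval_prod, Finset.prod_ne_zero_iff]
  intro a _
  simp only [Polynomial.eval_pow, Polynomial.eval_sub, Polynomial.eval_X, Polynomial.eval_C]
  exact pow_ne_zero _ (sub_ne_zero.2 fun h => hz ⟨a, h.symm⟩)

open scoped Classical in
theorem rootMultiplicity_fiberProd (x : Y → ℂ) (b : Z) (z : ℂ) :
    (fiberProd P x b).rootMultiplicity z = ∑ a with x a = z ∧ P.F a = b, P.deg a := by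
  have h : ∀ s : Finset Y, (∏ a ∈ s, (X - C (x a)) ^ P.deg a).rootMultiplicity z =
      ∑ a ∈ s, if x a = z then P.deg a else 0 := by
    intro s
    induction s using Finset.induction_on with
    | empty => simp
    | insert a s ha ih =>
      rw [Finset.prod_insert ha, Finset.sum_insert ha, Polynomial.rootMultiplicity_mul, ih]
      · congr 1
        split_ifs with hz
        · rw [hz, Polynomial.rootMultiplicity_X_sub_C_pow]
        · rw [Polynomial.rootMultiplicity_eq_zero]
          simp only [Polynomial.IsRoot.def, Polynomial.eval_pow, Polynomial.eval_sub,
            Polynomial.eval_X, Polynomial.eval_C]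
          exact pow_ne_zero _ (sub_ne_zero.2 (Ne.symm hz))
      · exact mul_ne_zero (pow_ne_zero _ (Polynomial.X_sub_C_ne_zero _))
          (Finset.prod_ne_zero_iff.2 fun _ _ => pow_ne_zero _ (Polynomial.X_sub_C_ne_zero _))
  rw [fiberProd, h, ← Finset.sum_filter, Finset.filter_filter]
  congr 1
  ext a
  simp [and_comm]

variable {P}

theorem Portrait.surjective (P : Portrait Y Z) : Function.Surjective P.F := by
  classical
  intro b
  by_contra! h
  have := P.sum_fiber b
  rw [Finset.sum_eq_zero] at this
  · have := P.two_le_degree; omega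
  · intro a ha
    exact absurd (Finset.mem_filter.1 ha).2 (h a)

variable (R : MarkedRationalMap P) {x : Y → ℂ}

theorem MarkedRationalMap.isPair : IsPair P.degree R.f.num R.f.denom := by
  have := P.two_le_degree
  rw [← R.degree_f]
  exact isPair_num_denom (by rw [R.degree_f]; omega)

theorem MarkedRationalMap.pairwise_isCoprime (R : MarkedRationalMap P) {x : Y → ℂ} 
    (hx : ∀ a, R.y a = x a) (k : Y → ℕ) (s : Finset Y) :
    Set.Pairwise (s : Set Y) (Function.onFun IsCoprime fun a => (X - C (x a) : ℂ[X]) ^ k a) := by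
  intro a _ a' _ hne
  refine IsCoprime.pow (Polynomial.isCoprime_X_sub_C_of_isUnit_sub ?_)
  refine (sub_ne_zero.2 fun h => hne (R.y_injective ?_)).isUnit
  rw [hx, hx, h]

/-- The marks over `b` already account for all d points of the fiber with multiplicity, so a
polynomial of degree d divides a nonzero one of degree at most d. -/
theorem MarkedRationalMap.exists_pencil_eq (hx : ∀ a, R.y a = x a) (b : Z) : ∃ c : ℂ, c ≠ 0 ∧
    C (vec (R.z b)).2 * R.f.num - C (vec (R.z b)).1 * R.f.denom = C c * fiberProd P x b := by
  classical
  have hw := vec_ne_zero (R.z b)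
  set w := vec (R.z b)
  have hp := R.isPair
  have hne := hp.pencil_ne_zero hw
  have hdeg := natDegree_pencil_le hp.left_le hp.right_le w.2 w.1
  set E := C w.2 * R.f.num - C w.1 * R.f.denom
  have hmul : ∀ a, P.F a = b → E.rootMultiplicity (x a) = P.deg a := by
    intro a ha
    have h1 := R.localDegree_y a
    rw [localDegree_eq_mulAt hw (by rw [R.comm, ha]; exact (ptv_vec _).symm), hx] at h1
    exact h1
  have hdvd : fiberProd P x b ∣ E := by
    refine Finset.prod_dvd_of_coprime (R.pairwise_isCoprime hx _ _) fun a ha => ?_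
    rw [← hmul a (Finset.mem_filter.1 ha).2]
    exact Polynomial.pow_rootMultiplicity_dvd E _
  obtain ⟨K, hK⟩ := hdvd
  have hK0 : K ≠ 0 := by rintro rfl; exact hne (by rw [hK, mul_zero])
  have hKd : K.natDegree = 0 := by
    have h2 := congrArg Polynomial.natDegree hK
    rw [(monic_fiberProd P x b).natDegree_mul' hK0, natDegree_fiberProd] at h2
    omega
  rw [Polynomial.natDegree_eq_zero] at hKd
  obtain ⟨c, rfl⟩ := hKd
  exact ⟨c, by simpa using hK0, by rw [hK, mul_comm]⟩

/-- At a mark of degree k some pencil member vanishes to order k, so its Wronskian with numerator or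
denominator vanishes to order k - 1. These Wronskians are the coordinates of `w` times that of the
map, and one coordinate is nonzero. -/
theorem MarkedRationalMap.critProd_dvd (hx : ∀ a, R.y a = x a) :
    critProd P x ∣ wronskian R.f.num R.f.denom := by
  refine Finset.prod_dvd_of_coprime (R.pairwise_isCoprime hx _ _) fun a _ => ?_
  obtain ⟨c, hc, h⟩ := R.exists_pencil_eq hx (P.F a)
  have hw := vec_ne_zero (R.z (P.F a))
  set w := vec (R.z (P.F a))
  have h1 : (X - C (x a)) ^ P.deg a ∣ C w.2 * R.f.num - C w.1 * R.f.denom := by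
    rw [h]
    refine Dvd.dvd.mul_left ?_ _
    classical
    exact Finset.dvd_prod_of_mem (fun a => (X - C (x a) : ℂ[X]) ^ P.deg a) (by simp)
  have hn := pow_dvd_wronskian (A := R.f.num) h1
  have hd := pow_dvd_wronskian (A := R.f.denom) h1
  have en : wronskian (C w.2 * R.f.num - C w.1 * R.f.denom) R.f.num =
      C w.1 * wronskian R.f.num R.f.denom := by
    simp [wronskian]; ring
  have ed : wronskian (C w.2 * R.f.num - C w.1 * R.f.denom) R.f.denom =
      C w.2 * wronskian R.f.num R.f.denom := by
    simp [wronskian]; ring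
  rw [en] at hn
  rw [ed] at hd
  by_cases h2 : w.2 = 0
  · have h1 : w.1 ≠ 0 := fun h1 => hw (Prod.ext h1 h2)
    exact (Polynomial.dvd_C_mul h1).1 hn
  · exact (Polynomial.dvd_C_mul h2).1 hd

theorem exists_linear_solution {a b c d : ℂ} (h : a * d - b * c ≠ 0) (t t' : ℂ) :
    ∃ α β : ℂ, α * (-a) + β * c = t ∧ α * (-b) + β * d = -t' := by
  refine ⟨-(t * d + t' * c) / (a * d - b * c), (-(t * b) - t' * a) / (a * d - b * c), ?_, ?_⟩ <;>
  · rw [div_mul_eq_mul_div, div_mul_eq_mul_div, ← add_div, div_eq_iff h]; ring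

/-- The fiber polynomials over two marked values span the pencil. Being monic of the same degree,
they differ by a polynomial of smaller degree, and their Wronskian is a multiple of `critProd` by a
constant because the portrait contains all 2d - 2 critical points. Rescaling the difference by that
constant fixes `q` completely. -/
theorem MarkedRationalMap.exists_normal_form (hx : ∀ a, R.y a = x a) {b₀ b₁ : Z} (hb : b₀ ≠ b₁) :
    ∃ (q : ℂ[X]) (s : Z → ℂ) (h : GL (Fin 2) ℂ),
      IsPair P.degree (-fiberProd P x b₀) q ∧ q.natDegree < P.degree ∧
      (∀ b, fiberProd P x b = fiberProd P x b₀ + C (s b) * q) ∧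
      wronskian (fiberProd P x b₀) q = critProd P x ∧
      (∀ p, h • ratMap R.f p = pairMap P.degree (-fiberProd P x b₀) q p) ∧
      ∀ b, h • R.z b = (s b : Sphere) := by
  have hd2 := P.two_le_degree
  obtain ⟨c₀, hc₀, h₀⟩ := R.exists_pencil_eq hx b₀
  obtain ⟨c₁, hc₁, h₁⟩ := R.exists_pencil_eq hx b₁
  have hm₀ := monic_fiberProd P x b₀
  have hm₁ := monic_fiberProd P x b₁
  have hn₀ := natDegree_fiberProd P x b₀
  have hn₁ := natDegree_fiberProd P x b₁
  have hpair := R.isPair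
  have hW := R.critProd_dvd hx
  have hcross : cross (vec (R.z b₀)) (vec (R.z b₁)) ≠ 0 := fun h =>
    hb (R.z_injective (cross_vec_eq_zero.1 h))
  have hrat := ratMap_eq_pairMap R.f
  rw [R.degree_f] at hrat
  set w₀ := vec (R.z b₀)
  set w₁ := vec (R.z b₁)
  set N := R.f.num
  set M := R.f.denom
  set p₀ := fiberProd P x b₀ with hp₀
  set p₁ := fiberProd P x b₁
  have e₀ : p₀ = C (w₀.2 / c₀) * N + C (-(w₀.1 / c₀)) * M := by
    have : C c₀⁻¹ * (C c₀ * p₀) = p₀ := by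
      rw [← mul_assoc, ← Polynomial.C_mul, inv_mul_cancel₀ hc₀, Polynomial.C_1, one_mul]
    rw [← this, ← h₀, div_eq_mul_inv, div_eq_mul_inv]
    simp only [Polynomial.C_mul, Polynomial.C_neg]; ring
  have e₁ : p₁ = C (w₁.2 / c₁) * N + C (-(w₁.1 / c₁)) * M := by
    have : C c₁⁻¹ * (C c₁ * p₁) = p₁ := by
      rw [← mul_assoc, ← Polynomial.C_mul, inv_mul_cancel₀ hc₁, Polynomial.C_1, one_mul]
    rw [← this, ← h₁, div_eq_mul_inv, div_eq_mul_inv]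
    simp only [Polynomial.C_mul, Polynomial.C_neg]; ring
  set δ : ℂ := w₀.2 / c₀ * -(w₁.1 / c₁) - -(w₀.1 / c₀) * (w₁.2 / c₁) with hδ
  have hδ0 : δ ≠ 0 := by
    have : δ = cross w₀ w₁ / (c₀ * c₁) := by
      rw [hδ, cross]; field_simp; ring
    rw [this]
    exact div_ne_zero hcross (mul_ne_zero hc₀ hc₁)
  have hWp : wronskian p₀ p₁ = C δ * wronskian N M := by rw [e₀, e₁, wronskian_linear]
  have hq0 : p₁ - p₀ ≠ 0 := by
    intro h
    rw [sub_eq_zero] at h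
    obtain ⟨a, ha⟩ := P.surjective b₁
    have h2 : p₀.eval (x a) = 0 := by
      rw [← h]; exact (eval_fiberProd_eq_zero_iff P x b₁ _).2 ⟨a, ha, rfl⟩
    obtain ⟨a', ha', hxa⟩ := (eval_fiberProd_eq_zero_iff P x b₀ _).1 h2
    have : a' = a := R.y_injective (by rw [hx, hx, hxa])
    exact hb (by rw [← ha', ← ha, this])
  have hqd : (p₁ - p₀).natDegree < P.degree := by
    have := Polynomial.degree_sub_lt_left (p := p₁) (q := p₀)
      (by rw [Polynomial.degree_eq_natDegree hm₁.ne_zero, Polynomial.degree_eq_natDegree hm₀.ne_zero,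
        hn₀, hn₁]) hm₁.ne_zero (by rw [hm₀.leadingCoeff, hm₁.leadingCoeff])
    rw [Polynomial.degree_eq_natDegree hm₁.ne_zero, hn₁, Polynomial.degree_eq_natDegree hq0] at this
    exact_mod_cast this
  have hWq : wronskian p₀ (p₁ - p₀) = wronskian p₀ p₁ := by
    simp [wronskian]; ring
  have hWq0 := wronskian_ne_zero_of_natDegree_lt hm₀ hq0 (by rw [hn₀]; exact hqd)
  have hWd := natDegree_wronskian_le p₀ (p₁ - p₀)
  have hdvd : critProd P x ∣ wronskian p₀ (p₁ - p₀) := by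
    rw [hWq, hWp]; exact hW.mul_left _
  obtain ⟨K, hK⟩ := hdvd
  have hK0 : K ≠ 0 := by rintro rfl; exact hWq0 (by rw [hK, mul_zero])
  have hKd : K.natDegree = 0 := by
    have h2 := congrArg Polynomial.natDegree hK
    rw [(monic_critProd P x).natDegree_mul' hK0, natDegree_critProd] at h2
    omega
  rw [Polynomial.natDegree_eq_zero] at hKd
  obtain ⟨κ, rfl⟩ := hKd
  have hκ : κ ≠ 0 := by simpa using hK0
  set q := C κ⁻¹ * (p₁ - p₀) with hq
  have hκq : C κ * q = p₁ - p₀ := by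
    rw [hq, ← mul_assoc, ← Polynomial.C_mul, mul_inv_cancel₀ hκ, Polynomial.C_1, one_mul]
  -- The rows express -p₀ and `q` in terms of numerator and denominator, read off from `e₀` and
  -- `e₁`.
  let h : GL (Fin 2) ℂ := glOf !![-(w₀.2 / c₀), w₀.1 / c₀; κ⁻¹ * (w₁.2 / c₁ - w₀.2 / c₀),
    κ⁻¹ * (-(w₁.1 / c₁) - -(w₀.1 / c₀))] (by
      have : (!![-(w₀.2 / c₀), w₀.1 / c₀; κ⁻¹ * (w₁.2 / c₁ - w₀.2 / c₀),
        κ⁻¹ * (-(w₁.1 / c₁) - -(w₀.1 / c₀))] : Matrix (Fin 2) (Fin 2) ℂ).det = -κ⁻¹ * δ := by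
        simp only [Matrix.det_fin_two_of, hδ]; ring
      rw [this]
      exact mul_ne_zero (neg_ne_zero.2 (inv_ne_zero hκ)) hδ0)
  have hl := hpair.linear h
  have hlm := hpair.pairMap_linear h
  have l1 : C (h 0 0) * N + C (h 0 1) * M = -p₀ := by
    rw [e₀]; simp [h]; ring
  have l2 : C (h 1 0) * N + C (h 1 1) * M = q := by
    rw [hq, e₀, e₁]; simp [h]; ring
  rw [l1, l2] at hl hlm
  have hdet := det_coe_ne_zero h
  rw [Matrix.det_fin_two] at hdet
  have hspan : ∀ b, ∃ t : ℂ, fiberProd P x b = p₀ + C t * q := by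
    intro b
    obtain ⟨c, hc, hcb⟩ := R.exists_pencil_eq hx b
    set w := vec (R.z b)
    obtain ⟨α, β, a1, a2⟩ := exists_linear_solution hdet (w.2 / c) (w.1 / c)
    have hb' : fiberProd P x b = C α * p₀ + C β * q := by
      have h5 : C c⁻¹ * (C c * fiberProd P x b) = fiberProd P x b := by
        rw [← mul_assoc, ← Polynomial.C_mul, inv_mul_cancel₀ hc, Polynomial.C_1, one_mul]
      have h6 : p₀ = -(C (h 0 0) * N + C (h 0 1) * M) := by rw [l1, neg_neg]
      calc fiberProd P x b = C (w.2 / c) * N + C (-(w.1 / c)) * M := by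
            rw [← h5, ← hcb, div_eq_mul_inv, div_eq_mul_inv]
            simp only [Polynomial.C_mul, Polynomial.C_neg]; ring
        _ = C α * p₀ + C β * q := by
            rw [← a1, ← a2, h6, ← l2]
            simp only [Polynomial.C_mul, Polynomial.C_neg, Polynomial.C_add]; ring
    refine ⟨β, ?_⟩
    -- Compare coefficients of degree d: both fiber polynomials are monic, and `q` has smaller
    -- degree.
    have hα1 : α = 1 := by
      have h7 := congrArg (fun E => Polynomial.coeff E P.degree) hb'
      simp only [Polynomial.coeff_add, Polynomial.coeff_C_mul] at h7
      rw [Polynomial.coeff_eq_zero_of_natDegree_lt (lt_of_le_of_lt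
        (Polynomial.natDegree_C_mul_le _ _) hqd), mul_zero, add_zero] at h7
      have h8 := hm₀.coeff_natDegree
      have h9 := (monic_fiberProd P x b).coeff_natDegree
      rw [hn₀] at h8
      rw [natDegree_fiberProd] at h9
      rw [h8, h9, mul_one] at h7
      exact h7.symm
    rw [hb', hα1, Polynomial.C_1, one_mul]
  choose s hs using hspan
  have hqlt : q.natDegree < P.degree := lt_of_le_of_lt (Polynomial.natDegree_C_mul_le _ _) hqd
  refine ⟨q, s, h, hl, hqlt, hs, ?_, fun p => ?_, fun b => ?_⟩
  · rw [hq, wronskian_C_mul_right, hK, mul_comm, mul_assoc, ← Polynomial.C_mul, mul_inv_cancel₀ hκ,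
      Polynomial.C_1, mul_one]
  · rw [hlm, hrat]
  -- The mark z(b) is the value of the map at any marked point over `b`, and there -p₀/q = s_b
  -- because p₀ + s_b q vanishes.
  · obtain ⟨a, ha⟩ := P.surjective b
    have h3 : (fiberProd P x b).eval (x a) = 0 := (eval_fiberProd_eq_zero_iff P x b _).2 ⟨a, ha, rfl⟩
    rw [hs b, Polynomial.eval_add, Polynomial.eval_mul, Polynomial.eval_C] at h3
    have hqa : q.eval (x a) ≠ 0 := by
      intro h4
      refine not_isCoprime_of_root (z := x a) ?_ h4 hl.coprime
      rw [Polynomial.eval_neg, neg_eq_zero]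
      simpa [h4] using h3
    rw [← ha, ← R.comm, hrat, ← hlm, hx, pairMap_coe hl.left_le hl.right_le, pt, if_neg hqa, ha,
      OnePoint.coe_eq_coe, div_eq_iff hqa, Polynomial.eval_neg]
    linear_combination -h3

end Portrait

end

section

open Polynomial (C X wronskian)

/-! ### Coefficientwise limits -/

section Coeff

variable {ι : Type*} {l : Filter ι}

theorem tendsto_coeff_mul {A B : ι → ℂ[X]} {A' B' : ℂ[X]}
    (hA : ∀ k, Tendsto (fun i => (A i).coeff k) l (𝓝 (A'.coeff k)))
    (hB : ∀ k, Tendsto (fun i => (B i).coeff k) l (𝓝 (B'.coeff k))) (k : ℕ) :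
    Tendsto (fun i => (A i * B i).coeff k) l (𝓝 ((A' * B').coeff k)) := by
  simp only [Polynomial.coeff_mul]
  exact tendsto_finsetSum _ fun x _ => (hA _).mul (hB _)

theorem tendsto_coeff_prod {α : Type*} (s : Finset α) {A : ι → α → ℂ[X]} {A' : α → ℂ[X]}
    (hA : ∀ a k, Tendsto (fun i => (A i a).coeff k) l (𝓝 ((A' a).coeff k))) (k : ℕ) :
    Tendsto (fun i => (∏ a ∈ s, A i a).coeff k) l (𝓝 ((∏ a ∈ s, A' a).coeff k)) := by
  classical
  induction s using Finset.induction_on generalizing k with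
  | empty => simpa using tendsto_const_nhds
  | insert a s ha ih =>
    simp only [Finset.prod_insert ha]
    exact tendsto_coeff_mul (hA a) ih k

theorem tendsto_coeff_pow {A : ι → ℂ[X]} {A' : ℂ[X]}
    (hA : ∀ k, Tendsto (fun i => (A i).coeff k) l (𝓝 (A'.coeff k))) (m k : ℕ) :
    Tendsto (fun i => (A i ^ m).coeff k) l (𝓝 ((A' ^ m).coeff k)) := by
  induction m generalizing k with
  | zero => simpa using tendsto_const_nhds
  | succ m ih =>
    simp only [pow_succ]
    exact tendsto_coeff_mul ih hA k

theorem tendsto_coeff_X_sub_C {z : ι → ℂ} {z' : ℂ} (hz : Tendsto z l (𝓝 z')) (k : ℕ) :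
    Tendsto (fun i => (X - C (z i)).coeff k) l (𝓝 ((X - C z').coeff k)) := by
  simp only [Polynomial.coeff_sub, Polynomial.coeff_C]
  refine tendsto_const_nhds.sub ?_
  split_ifs
  · exact hz
  · exact tendsto_const_nhds

theorem tendsto_coeff_wronskian {A B : ι → ℂ[X]} {A' B' : ℂ[X]}
    (hA : ∀ k, Tendsto (fun i => (A i).coeff k) l (𝓝 (A'.coeff k)))
    (hB : ∀ k, Tendsto (fun i => (B i).coeff k) l (𝓝 (B'.coeff k))) (k : ℕ) :
    Tendsto (fun i => (wronskian (A i) (B i)).coeff k) l (𝓝 ((wronskian A' B').coeff k)) := by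
  have hd : ∀ {A : ι → ℂ[X]} {A' : ℂ[X]}, (∀ k, Tendsto (fun i => (A i).coeff k) l (𝓝 (A'.coeff k))) →
      ∀ k, Tendsto (fun i => (A i).derivative.coeff k) l (𝓝 (A'.derivative.coeff k)) := by
    intro A A' h k
    simp only [Polynomial.coeff_derivative]
    exact (h _).mul tendsto_const_nhds
  simp only [wronskian, Polynomial.coeff_sub]
  exact (tendsto_coeff_mul hA (hd hB) k).sub (tendsto_coeff_mul (hd hA) hB k)

end Coeff

section Portrait

variable {Y : Type u} {Z : Type v} [Fintype Y] {P : Portrait Y Z}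

theorem tendsto_coeff_fiberProd {ι : Type*} {l : Filter ι} {x : ι → Y → ℂ} {x' : Y → ℂ}
    (hx : ∀ a, Tendsto (fun i => x i a) l (𝓝 (x' a))) (b : Z) (k : ℕ) :
    Tendsto (fun i => (fiberProd P (x i) b).coeff k) l (𝓝 ((fiberProd P x' b).coeff k)) :=
  tendsto_coeff_prod _ (fun a => tendsto_coeff_pow (tendsto_coeff_X_sub_C (hx a)) _) k

theorem tendsto_coeff_critProd {ι : Type*} {l : Filter ι} {x : ι → Y → ℂ} {x' : Y → ℂ}
    (hx : ∀ a, Tendsto (fun i => x i a) l (𝓝 (x' a))) (k : ℕ) :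
    Tendsto (fun i => (critProd P (x i)).coeff k) l (𝓝 ((critProd P x').coeff k)) :=
  tendsto_coeff_prod _ (fun a => tendsto_coeff_pow (tendsto_coeff_X_sub_C (hx a)) _) k

/-- The normal form of the pencil spanned by the polynomials `fiberProd P x b`. -/
structure IsNormalForm (P : Portrait Y Z) (x : Y → ℂ) (b₀ : Z) (q : ℂ[X]) (s : Z → ℂ) : Prop where
  natDegree_lt : q.natDegree < P.degree
  fiberProd_eq : ∀ b, fiberProd P x b = fiberProd P x b₀ + C (s b) * q
  wronskian_eq : wronskian (fiberProd P x b₀) q = critProd P x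

/-- The Wronskian equation is triangular in the coefficients of `q`, with diagonal entries k - d, so
they converge from the top down. The limit is nonzero because its Wronskian is monic, and `s` is
then recovered from one nonvanishing coefficient of `q'`. Collisions of the marks do no harm. -/
theorem exists_limit_normal_form {ι : Type*} {l : Filter ι} [l.NeBot] {x : ι → Y → ℂ} {x' : Y → ℂ}
    (hx : ∀ a, Tendsto (fun i => x i a) l (𝓝 (x' a))) {b₀ : Z} {q : ι → ℂ[X]} {s : ι → Z → ℂ}
    (h : ∀ᶠ i in l, IsNormalForm P (x i) b₀ (q i) (s i)) :
    ∃ (q' : ℂ[X]) (s' : Z → ℂ), IsNormalForm P x' b₀ q' s' ∧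
      (∀ k, Tendsto (fun i => (q i).coeff k) l (𝓝 (q'.coeff k))) ∧
      ∀ b, Tendsto (fun i => s i b) l (𝓝 (s' b)) := by
  have hp := fun b => tendsto_coeff_fiberProd (P := P) hx b
  have hω := tendsto_coeff_critProd (P := P) hx
  -- Descending induction on `k`, with `m` a bound for d - k; the base case is the vanishing of the
  -- coefficients from d on.
  have key : ∀ m k, P.degree - k ≤ m → ∃ c, Tendsto (fun i => (q i).coeff k) l (𝓝 c) ∧
      (P.degree ≤ k → c = 0) := by
    intro m
    induction m with
    | zero =>
      intro k hk
      refine ⟨0, tendsto_const_nhds.congr' ?_, fun _ => rfl⟩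
      filter_upwards [h] with i hi
      exact (Polynomial.coeff_eq_zero_of_natDegree_lt (lt_of_lt_of_le hi.natDegree_lt (by omega))).symm
    | succ m ih =>
      intro k hk
      by_cases hkd : P.degree ≤ k
      · exact ih k (by omega)
      choose c hc using fun (j : {j // k < j}) => (ih j.1 (by have := j.2; omega))
      have hne : ((k : ℂ) - P.degree) ≠ 0 := by
        rw [sub_ne_zero]; exact_mod_cast (by omega : k ≠ P.degree)
      have hXω : Tendsto (fun i => (X * critProd P (x i)).coeff (P.degree + k)) l
          (𝓝 ((X * critProd P x').coeff (P.degree + k))) :=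
        tendsto_coeff_mul (fun _ => tendsto_const_nhds) hω _
      have hsum : Tendsto (fun i => ∑ y ∈ (Finset.HasAntidiagonal.antidiagonal (P.degree + k)).filter
          (fun y => k < y.2), ((y.2 : ℂ) - y.1) * (fiberProd P (x i) b₀).coeff y.1 * (q i).coeff y.2) l
          (𝓝 (∑ y ∈ (Finset.HasAntidiagonal.antidiagonal (P.degree + k)).filter
          (fun y => k < y.2), ((y.2 : ℂ) - y.1) * (fiberProd P x' b₀).coeff y.1 *
            -- The value 0 is a dummy, as the sum runs only over indices beyond `k`.
            (if hy : k < y.2 then c ⟨y.2, hy⟩ else 0))) := by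
        refine tendsto_finsetSum _ fun y hy => ?_
        have hy' := (Finset.mem_filter.1 hy).2
        rw [dif_pos hy']
        exact (tendsto_const_nhds.mul (hp b₀ _)).mul (hc ⟨y.2, hy'⟩).1
      refine ⟨_, ((hXω.sub hsum).div_const ((k : ℂ) - P.degree)).congr' ?_, fun h => absurd h hkd⟩
      filter_upwards [h] with i hi
      have := coeff_recursion (monic_fiberProd P (x i) b₀) (q i) k
      rw [natDegree_fiberProd, hi.wronskian_eq] at this
      rw [← this, mul_div_cancel_left₀ _ hne]
  choose c hc hc0 using fun k => key _ k le_rfl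
  set q' : ℂ[X] := ∑ k ∈ Finset.range P.degree, C (c k) * X ^ k with hq'
  have hcq : ∀ k, q'.coeff k = c k := by
    intro k
    simp only [hq', Polynomial.finsetSum_coeff, Polynomial.coeff_C_mul_X_pow]
    by_cases hk : k < P.degree
    · rw [Finset.sum_eq_single k]
      · simp
      · intro j _ hj; rw [if_neg (Ne.symm hj)]
      · intro hn; exact absurd (Finset.mem_range.2 hk) hn
    · rw [hc0 k (not_lt.1 hk)]
      refine Finset.sum_eq_zero fun j hj => if_neg ?_
      have := Finset.mem_range.1 hj; omega
  have hq : ∀ k, Tendsto (fun i => (q i).coeff k) l (𝓝 (q'.coeff k)) := fun k => by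
    rw [hcq]; exact hc k
  have hdeg : q'.natDegree < P.degree := by
    have h2 := P.two_le_degree
    by_cases h0 : q' = 0
    · rw [h0, Polynomial.natDegree_zero]; omega
    · by_contra hlt
      have : q'.leadingCoeff = 0 := by
        rw [← Polynomial.coeff_natDegree, hcq]; exact hc0 _ (not_lt.1 hlt)
      exact h0 (Polynomial.leadingCoeff_eq_zero.1 this)
  have hW : wronskian (fiberProd P x' b₀) q' = critProd P x' := by
    ext k
    refine tendsto_nhds_unique ((tendsto_coeff_wronskian (hp b₀) hq k).congr' ?_) (hω k)
    filter_upwards [h] with i hi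
    rw [hi.wronskian_eq]
  have hq0 : q' ≠ 0 := by
    intro h0
    rw [h0, Polynomial.wronskian_zero_right] at hW
    exact (monic_critProd P x').ne_zero hW.symm
  have hs : ∀ b, ∃ c, Tendsto (fun i => s i b) l (𝓝 c) := by
    intro b
    have hne : q'.coeff q'.natDegree ≠ 0 := by simpa using hq0
    refine ⟨_, (((hp b q'.natDegree).sub (hp b₀ q'.natDegree)).div (hq q'.natDegree) hne).congr' ?_⟩
    filter_upwards [h, (hq q'.natDegree).eventually_ne hne] with i hi hi2
    simp only [Pi.div_apply]
    rw [hi.fiberProd_eq b, Polynomial.coeff_add, add_sub_cancel_left, Polynomial.coeff_C_mul,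
      mul_div_cancel_right₀ _ hi2]
  choose s' hs' using hs
  refine ⟨q', s', ⟨hdeg, fun b => ?_, hW⟩, hq, hs'⟩
  ext k
  refine tendsto_nhds_unique (hp b k) ?_
  rw [Polynomial.coeff_add, Polynomial.coeff_C_mul]
  refine ((hp b₀ k).add ((hs' b).mul (hq k))).congr' ?_
  filter_upwards [h] with i hi
  rw [hi.fiberProd_eq b, Polynomial.coeff_add, Polynomial.coeff_C_mul]

/-- A Wronskian of degree 2d - 2 leaves no room for deg q < d - 1. Hence ∞ is a simple pole and is
never critical. -/
theorem IsNormalForm.natDegree_eq {x : Y → ℂ} {b₀ : Z} {q : ℂ[X]} {s : Z → ℂ}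
    (h : IsNormalForm P x b₀ q s) : q.natDegree + 1 = P.degree := by
  have h1 := natDegree_wronskian_le (fiberProd P x b₀) q
  rw [h.wronskian_eq, natDegree_critProd, natDegree_fiberProd] at h1
  have := h.natDegree_lt
  omega

theorem IsNormalForm.ne_zero {x : Y → ℂ} {b₀ : Z} {q : ℂ[X]} {s : Z → ℂ}
    (h : IsNormalForm P x b₀ q s) : q ≠ 0 := by
  intro h0
  have := h.wronskian_eq
  rw [h0, Polynomial.wronskian_zero_right] at this
  exact (monic_critProd P x).ne_zero this.symm

theorem IsPair.isLocalHomeomorphOn {D : ℕ} {A B : ℂ[X]} (h : IsPair D (-A) B)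
    (hA : A.natDegree = D) (hB : B.natDegree + 1 = D) {E : Set ℂ}
    (hW : ∀ z ∉ E, (wronskian A B).eval z ≠ 0) :
    IsLocalHomeomorphOn (pairMap D (-A) B) (((↑) : ℂ → Sphere) '' E)ᶜ := by
  refine isLocalHomeomorphOn_of_forall fun p hp => ?_
  induction p using OnePoint.rec with
  | infty =>
    refine h.isLocalHomeomorphOn_infty ?_ ?_ ?_
    · have hA0 : A ≠ 0 := by rintro rfl; simp at hA; omega
      rw [Polynomial.coeff_neg, neg_ne_zero, ← hA]
      simpa using hA0
    · exact Polynomial.coeff_eq_zero_of_natDegree_lt (by omega)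
    · rw [show D - 1 = B.natDegree by omega]
      simpa using h.right_ne_zero
  | coe z =>
    refine h.isLocalHomeomorphOn_coe ?_
    rw [Polynomial.wronskian_neg_left, Polynomial.eval_neg, neg_ne_zero]
    exact hW z fun hz => hp ⟨z, hz, rfl⟩

/-- A reduced form of the pencil of a normal form. -/
theorem IsNormalForm.exists_reduced {x : Y → ℂ} {b₀ : Z} {q : ℂ[X]} {s : Z → ℂ}
    (h : IsNormalForm P x b₀ q s) : ∃ (D : ℕ) (U A B : ℂ[X]), U ≠ 0 ∧ fiberProd P x b₀ = U * A ∧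
      q = U * B ∧ U.natDegree + D = P.degree ∧ IsPair D (-A) B ∧ A.natDegree = D ∧
      B.natDegree + 1 = D ∧ (∀ z ∉ Set.range x, (wronskian A B).eval z ≠ 0) ∧
      (wronskian A B).natDegree = 2 * D - 2 := by
  have hp0 := (monic_fiberProd P x b₀).ne_zero
  have hq0 := h.ne_zero
  set p := fiberProd P x b₀ with hp
  set U := EuclideanDomain.gcd p q with hU
  have hU0 : U ≠ 0 := fun h0 => hp0 (EuclideanDomain.gcd_eq_zero_iff.1 h0).1
  obtain ⟨A, hA⟩ := EuclideanDomain.gcd_dvd_left p q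
  obtain ⟨B, hB⟩ := EuclideanDomain.gcd_dvd_right p q
  rw [← hU] at hA hB
  have hA0 : A ≠ 0 := by rintro rfl; exact hp0 (by rw [hA, mul_zero])
  have hB0 : B ≠ 0 := by rintro rfl; exact hq0 (by rw [hB, mul_zero])
  have hcop : IsCoprime A B := by
    obtain ⟨α, β, h1⟩ : ∃ α β, U = p * α + q * β := ⟨_, _, EuclideanDomain.gcd_eq_gcd_ab p q⟩
    refine ⟨α, β, mul_left_cancel₀ hU0 ?_⟩
    linear_combination (exp := 1) -h1 - α * hA - β * hB
  have hdA : U.natDegree + A.natDegree = P.degree := by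
    rw [← Polynomial.natDegree_mul hU0 hA0, ← hA, hp, natDegree_fiberProd]
  have hdB : U.natDegree + B.natDegree + 1 = P.degree := by
    rw [← Polynomial.natDegree_mul hU0 hB0, ← hB, h.natDegree_eq]
  -- This identity confines the critical points of the reduced map to the limit marks and gives its
  -- Wronskian degree 2D - 2.
  have hW : U ^ 2 * wronskian A B = critProd P x := by
    rw [← wronskian_mul_mul, ← hA, ← hB, h.wronskian_eq]
  have hW0 : wronskian A B ≠ 0 := by
    intro h0; rw [h0, mul_zero] at hW; exact (monic_critProd P x).ne_zero hW.symm
  refine ⟨A.natDegree, U, A, B, hU0, hA, hB, hdA, ⟨hcop.neg_left, by omega, by simp, by omega, Or.inl ?_⟩,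
    rfl, by omega, fun z hz h0 => ?_, ?_⟩
  · simpa using hA0
  · refine eval_critProd_ne_zero P hz ?_
    rw [← hW, Polynomial.eval_mul, h0, mul_zero]
  · have h3 := congrArg Polynomial.natDegree hW
    rw [Polynomial.natDegree_mul (pow_ne_zero 2 hU0) hW0, Polynomial.natDegree_pow,
      natDegree_critProd] at h3
    omega

theorem hom_mul_vec {d D : ℕ} {U A : ℂ[X]} (hU : U.natDegree ≤ d) (hA : A.natDegree ≤ D)
    (p : Sphere) : hom (d + D) (U * A) (vec p) = hom d U (vec p) * hom D A (vec p) := by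
  induction p using OnePoint.rec with
  | infty =>
    rw [vec_infty, hom_infty, hom_infty, hom_infty, Polynomial.coeff_mul_add_eq_of_natDegree_le hU hA]
  | coe z =>
    rw [vec_coe, hom_coe hU, hom_coe hA, hom_coe (Polynomial.natDegree_mul_le.trans
      (add_le_add hU hA)), Polynomial.eval_mul]

theorem natDegree_eq_sum_rootMultiplicity {A : ℂ[X]} {E : Finset ℂ}
    (hE : ∀ z, A.eval z = 0 → z ∈ E) (hA : A ≠ 0) : A.natDegree = ∑ z ∈ E, A.rootMultiplicity z := by
  classical
  rw [← IsAlgClosed.card_roots_eq_natDegree (p := A), ← Multiset.sum_count_eq_card (s := E)]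
  · exact Finset.sum_congr rfl fun z _ => Polynomial.count_roots A
  · intro z hz
    exact hE z ((Polynomial.mem_roots hA).1 hz)

/-- Since `B` does not vanish at `z`, the term with the derivative of `T` dominates, and in
characteristic 0 it loses exactly one order. -/
theorem rootMultiplicity_wronskian {T B : ℂ[X]} (hT : T ≠ 0) {z : ℂ} (hz : T.eval z = 0)
    (hB : B.eval z ≠ 0) : T.rootMultiplicity z = (wronskian T B).rootMultiplicity z + 1 := by
  obtain ⟨S, hS, hS2⟩ := Polynomial.exists_eq_pow_rootMultiplicity_mul_and_not_dvd T hT z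
  have hpos : 0 < T.rootMultiplicity z := (Polynomial.rootMultiplicity_pos hT).2 hz
  obtain ⟨j, hj⟩ : ∃ j, T.rootMultiplicity z = j + 1 := ⟨T.rootMultiplicity z - 1, by omega⟩
  rw [hj] at hS ⊢
  have hSz : S.eval z ≠ 0 := fun h0 => hS2 (Polynomial.dvd_iff_isRoot.2 h0)
  set V := (X - C z) * S * B.derivative - (C (j + 1 : ℂ) * S + (X - C z) * S.derivative) * B with hV
  have hW : wronskian T B = V * (X - C z) ^ j := by
    rw [hS, hV]
    simp only [wronskian, Polynomial.derivative_mul, Polynomial.derivative_X_sub_C_pow,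
      Nat.add_sub_cancel]
    push_cast
    rw [pow_succ]
    simp only [Polynomial.C_add, Polynomial.C_1]
    ring
  have hVz : V.eval z ≠ 0 := by
    have : V.eval z = -((j + 1 : ℂ) * S.eval z * B.eval z) := by simp [hV]
    rw [this, neg_ne_zero]
    exact mul_ne_zero (mul_ne_zero (by exact_mod_cast Nat.succ_ne_zero j) hSz) hB
  have hV0 : V ≠ 0 := by rintro h0; rw [h0] at hVz; simp at hVz
  rw [hW, Polynomial.rootMultiplicity_mul_X_sub_C_pow hV0, Polynomial.rootMultiplicity_eq_zero hVz,
    zero_add]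

end Portrait

end

section

open Polynomial (C X wronskian)

/-! ### Limits at a vertex -/

variable {Y : Type u} {Z : Type v} [Fintype Y] {P : Portrait Y Z}

/-- The limit pencil of a sequence of marked rational maps, freed from its common factor `U`. -/
structure IsReduced (P : Portrait Y Z) (x : Y → ℂ) (s : Z → ℂ) (D : ℕ) (U A B : ℂ[X]) : Prop where
  left_ne_zero : U ≠ 0
  natDegree_add : U.natDegree + D = P.degree
  isPair : IsPair D (-A) B
  natDegree_left : A.natDegree = D
  natDegree_right : B.natDegree + 1 = D
  fiberProd_eq : ∀ b, fiberProd P x b = U * (A + C (s b) * B)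
  eval_wronskian_ne_zero : ∀ z ∉ Set.range x, (wronskian A B).eval z ≠ 0
  natDegree_wronskian : (wronskian A B).natDegree = 2 * D - 2

namespace IsReduced

variable {x : Y → ℂ} {s : Z → ℂ} {D : ℕ} {U A B : ℂ[X]}

theorem pairMap_eq_iff (h : IsReduced P x s D U A B) (z c : ℂ) :
    pairMap D (-A) B z = (c : Sphere) ↔ (A + C c * B).eval z = 0 := by
  have h1 : (c : Sphere) = ptv (c, 1) := by rw [← vec_coe, ptv_vec]
  rw [h1, pairMap, ptv_eq_ptv_iff (h.isPair.hom_vec_ne_zero z) (by simp), vec_coe,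
    hom_coe h.isPair.left_le, hom_coe h.isPair.right_le]
  simp only [cross, Polynomial.eval_neg, Polynomial.eval_add, Polynomial.eval_mul,
    Polynomial.eval_C]
  rw [← neg_eq_zero]
  ring_nf

theorem pairMap_infty (h : IsReduced P x s D U A B) : pairMap D (-A) B ∞ = ∞ := by
  have h1 : (∞ : Sphere) = ptv (1, 0) := by rw [← vec_infty, ptv_vec]
  conv_rhs => rw [h1]
  rw [pairMap, ptv_eq_ptv_iff (h.isPair.hom_vec_ne_zero ∞) (by simp), vec_infty,
    hom_infty, hom_infty, Polynomial.coeff_eq_zero_of_natDegree_lt (p := B)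
      (by have := h.natDegree_right; omega)]
  simp [cross]

/-- A finite point over s_b is a root of A + s_b B, hence of the fiber polynomial, whose roots are
marks; ∞ goes to ∞. -/
theorem preimage_subset (h : IsReduced P x s D U A B) :
    pairMap D (-A) B ⁻¹' Set.range (fun b => (s b : Sphere)) ⊆ Set.range fun a => (x a : Sphere) := by
  rintro p ⟨b, hb⟩
  induction p using OnePoint.rec with
  | infty =>
    rw [h.pairMap_infty] at hb
    exact absurd hb (OnePoint.coe_ne_infty _)
  | coe z =>
    have h1 := (h.pairMap_eq_iff z (s b)).1 hb.symm
    have h2 : (fiberProd P x b).eval z = 0 := by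
      rw [h.fiberProd_eq, Polynomial.eval_mul, h1, mul_zero]
    obtain ⟨a, -, rfl⟩ := (eval_fiberProd_eq_zero_iff P x b z).1 h2
    exact ⟨a, rfl⟩

theorem pencil_ne_zero (h : IsReduced P x s D U A B) (c : ℂ) : A + C c * B ≠ 0 := by
  have := h.isPair.pencil_ne_zero (w := (c, 1)) (by simp)
  intro h0
  apply this
  linear_combination (exp := 1) -h0 + (by simp : (C (1 : ℂ) : ℂ[X]) = 1) * -A

theorem localDegree_eq (h : IsReduced P x s D U A B) {z c : ℂ}
    (hz : pairMap D (-A) B z = (c : Sphere)) :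
    localDegree (ratOf (-A) B) z = (A + C c * B).rootMultiplicity z := by
  have h1 : (c : Sphere) = ptv (c, 1) := by rw [← vec_coe, ptv_vec]
  rw [h.isPair.localDegree_ratOf (w := (c, 1)) (by simp) (hz.trans h1)]
  rw [show (C ((c, (1 : ℂ)).2) * -A - C ((c, (1 : ℂ)).1) * B : ℂ[X]) = C (-1) * (A + C c * B) by
    simp; ring, mulAt_C_mul (by simp)]
  rfl

open scoped Classical in
-- Both sides are the multiplicity of `z` in the fiber polynomial U (A + s_b B). The part from `U`
-- does not depend on `b`, and the other factor vanishes at `z` only if `s b` is the value there.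
theorem sum_deg_eq (h : IsReduced P x s D U A B) (z : ℂ) (b : Z) :
    ∑ a with x a = z ∧ P.F a = b, P.deg a = U.rootMultiplicity z +
      if (s b : Sphere) = ratMap (ratOf (-A) B) z then localDegree (ratOf (-A) B) z else 0 := by
  rw [← rootMultiplicity_fiberProd, h.fiberProd_eq, Polynomial.rootMultiplicity_mul
    (mul_ne_zero h.left_ne_zero (h.pencil_ne_zero _)), h.isPair.ratMap_ratOf]
  congr 1
  split_ifs with hs
  · rw [h.localDegree_eq hs.symm]
  · exact Polynomial.rootMultiplicity_eq_zero fun h0 => hs ((h.pairMap_eq_iff z (s b)).2 h0).symm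

theorem natDegree_pencil (h : IsReduced P x s D U A B) (c : ℂ) : (A + C c * B).natDegree = D := by
  rw [Polynomial.natDegree_add_eq_left_of_natDegree_lt, h.natDegree_left]
  exact (Polynomial.natDegree_C_mul_le _ _).trans_lt (by
    have := h.natDegree_left; have := h.natDegree_right; omega)

theorem eval_right_ne_zero (h : IsReduced P x s D U A B) {z c : ℂ} (hz : (A + C c * B).eval z = 0) :
    B.eval z ≠ 0 := by
  intro hB
  refine not_isCoprime_of_root (z := z) (A := -A) (B := B) ?_ hB h.isPair.coprime
  simpa [hB] using hz

/-- Riemann–Hurwitz: with E the set of limit marks and S the set of their values, all fibers over S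
lie in E and all critical points lie in E, so |S| D = 2D - 2 + |E|. As |E| ≥ 3, this exceeds 2D, so
|S| ≥ 3. -/
theorem exists_three (h : IsReduced P x s D U A B)
    (hs : ∀ a, ∃ b, pairMap D (-A) B (x a) = (s b : Sphere))
    (hx : ∃ y : Fin 3 → Y, Function.Injective (x ∘ y)) :
    ∃ b : Fin 3 → Z, Function.Injective (s ∘ b) := by
  classical
  choose β hβ using hs
  obtain ⟨y, hy⟩ := hx
  set E : Finset ℂ := Finset.univ.image x with hE
  set S : Finset ℂ := Finset.univ.image fun a => s (β a) with hS
  have hroot : ∀ a, (A + C (s (β a)) * B).eval (x a) = 0 := fun a => (h.pairMap_eq_iff _ _).1 (hβ a)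
  have hW : ∀ c, wronskian (A + C c * B) B = wronskian A B := by
    intro c
    simp [wronskian]; ring
  have hW0 : wronskian A B ≠ 0 := by
    intro h0
    obtain ⟨z, hz⟩ := (Set.finite_range x).exists_notMem
    exact h.eval_wronskian_ne_zero z hz (by simp [h0])
  have hSD : ∀ c ∈ S, ∑ z ∈ E, (A + C c * B).rootMultiplicity z = D := by
    intro c hc
    rw [← natDegree_eq_sum_rootMultiplicity ?_ (h.pencil_ne_zero c), h.natDegree_pencil]
    intro z hz
    obtain ⟨a, -, rfl⟩ := Finset.mem_image.1 hc
    obtain ⟨a', ha'⟩ := h.preimage_subset ⟨β a, ((h.pairMap_eq_iff z _).2 hz).symm⟩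
    exact Finset.mem_image.2 ⟨a', Finset.mem_univ _, OnePoint.coe_injective ha'⟩
  have hES : ∀ z ∈ E, ∑ c ∈ S, (A + C c * B).rootMultiplicity z =
      (wronskian A B).rootMultiplicity z + 1 := by
    intro z hz
    obtain ⟨a, -, rfl⟩ := Finset.mem_image.1 hz
    rw [Finset.sum_eq_single (s (β a)), rootMultiplicity_wronskian (h.pencil_ne_zero _) (hroot a)
      (h.eval_right_ne_zero (hroot a)), hW]
    · intro c _ hc
      refine Polynomial.rootMultiplicity_eq_zero fun h0 => hc ?_
      exact OnePoint.coe_injective (((h.pairMap_eq_iff _ _).2 h0).symm.trans (hβ a))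
    · intro hn
      exact absurd (Finset.mem_image_of_mem _ (Finset.mem_univ a)) hn
  have hWsum : ∑ z ∈ E, (wronskian A B).rootMultiplicity z = 2 * D - 2 := by
    rw [← natDegree_eq_sum_rootMultiplicity ?_ hW0, h.natDegree_wronskian]
    intro z hz
    by_contra hn
    refine h.eval_wronskian_ne_zero z (fun ⟨a, ha⟩ => hn ?_) hz
    exact Finset.mem_image.2 ⟨a, Finset.mem_univ _, ha⟩
  -- Double counting of the multiplicities over pairs of a value in `S` and a point in `E`. Each
  -- point lies over exactly one value, where its multiplicity is one more than that in the
  -- Wronskian.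
  have key : S.card * D = (2 * D - 2) + E.card := by
    have h1 := Finset.sum_comm (s := S) (t := E) (f := fun c z => (A + C c * B).rootMultiplicity z)
    rw [Finset.sum_congr rfl hSD, Finset.sum_congr rfl hES, Finset.sum_add_distrib, hWsum] at h1
    simpa using h1
  have hE3 : 3 ≤ E.card := by
    have : (Finset.univ.image (x ∘ y)).card = 3 := by
      rw [Finset.card_image_of_injective _ hy]; simp
    rw [← this]
    refine Finset.card_le_card fun z hz => ?_
    obtain ⟨i, -, rfl⟩ := Finset.mem_image.1 hz
    exact Finset.mem_image_of_mem _ (Finset.mem_univ _)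
  have hS3 : 3 ≤ S.card := by
    have := h.isPair.pos
    by_contra hlt
    have : S.card * D ≤ 2 * D := Nat.mul_le_mul_right D (by omega)
    omega
  obtain ⟨t, htS, ht⟩ := Finset.exists_subset_card_eq hS3
  have e := (Finset.equivFinOfCardEq ht).symm
  have hmem : ∀ i, ∃ a, s (β a) = e i := fun i => by
    obtain ⟨a, -, ha⟩ := Finset.mem_image.1 (htS (e i).2)
    exact ⟨a, ha⟩
  choose a ha using hmem
  refine ⟨fun i => β (a i), fun i j hij => ?_⟩
  simp only [Function.comp, ha] at hij
  exact e.injective (Subtype.ext hij)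

end IsReduced

theorem IsNormalForm.exists_isReduced {x : Y → ℂ} {b₀ : Z} {q : ℂ[X]} {s : Z → ℂ}
    (h : IsNormalForm P x b₀ q s) : ∃ (D : ℕ) (U A B : ℂ[X]), IsReduced P x s D U A B ∧
      fiberProd P x b₀ = U * A ∧ q = U * B := by
  obtain ⟨D, U, A, B, h1, h2, h3, h4, h5, h6, h7, h8, h9⟩ := h.exists_reduced
  refine ⟨D, U, A, B, ⟨h1, h4, h5, h6, h7, fun b => ?_, h8, h9⟩, h2, h3⟩
  rw [h.fiberProd_eq, h3, h2]
  ring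

end

/-! ### Limit marks go to limit marks; limits in arbitrary coordinates -/

section

open Polynomial (C X wronskian)

theorem exists_smul_zero_eq (p : Sphere) : ∃ m : GL (Fin 2) ℂ, m • ((0 : ℂ) : Sphere) = p := by
  induction p using OnePoint.rec with
  | infty => exact ⟨swapGL, swapGL_smul_zero⟩
  | coe z =>
    have hd : (!![1, z; 0, 1] : Matrix (Fin 2) (Fin 2) ℂ).det ≠ 0 := by
      simp [Matrix.det_fin_two]
    refine ⟨glOf _ hd, ?_⟩
    rw [smul_eq_ptv, vec_coe, coe_glOf, ← ptv_vec (z : Sphere), vec_coe]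
    simp [mv]

/-- Otherwise a disc around G(x' a) avoids the target marks, eventually also those of index n. A
small circle around x' a is mapped into that disc by `f n`, and it separates the mark x n a from
another mark. This contradicts `not_isCoveringMapOn_of_circle`. -/
theorem mem_range_of_tendsto_covering {Y Z : Type*} [Finite Y] [Finite Z]
    {f : ℕ → Sphere → Sphere} {G : Sphere → Sphere} {x : ℕ → Y → ℂ} {x' : Y → ℂ} {s : ℕ → Z → ℂ}
    {s' : Z → ℂ}
    (hf : ∀ p ∉ Set.range fun y => (x' y : Sphere),
      Tendsto (fun w : ℕ × Sphere => f w.1 w.2) (atTop ×ˢ 𝓝 p) (𝓝 (G p)))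
    (hG : Continuous G) (hx : ∀ y, Tendsto (fun n => x n y) atTop (𝓝 (x' y)))
    (hs : ∀ b, Tendsto (fun n => s n b) atTop (𝓝 (s' b)))
    (hcov : ∀ᶠ n in atTop, IsCoveringMapOn (f n) (Set.range fun b => (s n b : Sphere))ᶜ)
    (hfx : ∀ᶠ n in atTop, ∀ y, f n (x n y) ∈ Set.range fun b => (s n b : Sphere))
    {a a₂ : Y} (ha : x' a₂ ≠ x' a) : G (x' a) ∈ Set.range fun b => (s' b : Sphere) := by
  by_contra hGa
  obtain ⟨m, hm⟩ := exists_smul_zero_eq (G (x' a))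
  have hmc : Continuous fun t : ℂ => m • (t : Sphere) :=
    (continuous_const_smul m).comp OnePoint.continuous_coe
  have hopen : IsOpen (Set.range fun b => (s' b : Sphere))ᶜ := (Set.finite_range _).isClosed.isOpen_compl
  obtain ⟨r, hr, hrS⟩ : ∃ r > 0, ∀ t ∈ Metric.closedBall (0 : ℂ) r,
      m • (t : Sphere) ∉ Set.range fun b => (s' b : Sphere) := by
    have : (fun t : ℂ => m • (t : Sphere)) ⁻¹' (Set.range fun b => (s' b : Sphere))ᶜ ∈ 𝓝 (0 : ℂ) :=
      (hopen.preimage hmc).mem_nhds (by change m • _ ∉ _; rwa [hm])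
    exact Metric.nhds_basis_closedBall.mem_iff.1 this
  set V : Set Sphere := (fun t : ℂ => m • (t : Sphere)) '' Metric.ball 0 r with hV
  have hVo : IsOpen V := by
    have : V = (fun p : Sphere => m • p) '' ((↑) '' Metric.ball (0 : ℂ) r) := by
      rw [hV, Set.image_image]
    rw [this]
    exact (Homeomorph.smul m).isOpenMap _ (OnePoint.isOpenEmbedding_coe.isOpenMap _ Metric.isOpen_ball)
  have hVG : (fun z : ℂ => G z) ⁻¹' V ∈ 𝓝 (x' a) :=
    (hVo.preimage (hG.comp OnePoint.continuous_coe)).mem_nhds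
      ⟨0, Metric.mem_ball_self hr, hm⟩
  have hE : (x' '' {y | x' y ≠ x' a})ᶜ ∈ 𝓝 (x' a) := by
    refine ((Set.toFinite _).isClosed.isOpen_compl).mem_nhds ?_
    rintro ⟨y, hy, hy2⟩
    exact hy hy2
  -- The closed disc of radius ρ is mapped into `V` by `G` and contains no limit mark except its
  -- center, so uniform convergence holds on its boundary.
  obtain ⟨ρ, hρ, hρV⟩ := Metric.nhds_basis_closedBall.mem_iff.1 (inter_mem hVG hE)
  have hK : IsCompact (((↑) : ℂ → Sphere) '' Metric.sphere (x' a) ρ) :=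
    (isCompact_sphere _ _).image OnePoint.continuous_coe
  have hKV : ∀ᶠ n in atTop, ∀ p ∈ ((↑) : ℂ → Sphere) '' Metric.sphere (x' a) ρ, f n p ∈ V := by
    refine eventually_forall_mem_of_isCompact hK ?_
    rintro _ ⟨z, hz, rfl⟩
    have hzc := Metric.sphere_subset_closedBall hz
    refine (hf z ?_).eventually (hVo.mem_nhds (hρV hzc).1)
    rintro ⟨y, hy⟩
    have hy := OnePoint.coe_injective hy
    by_cases hya : x' y = x' a
    · rw [← hy, hya] at hz
      have hz := Metric.mem_sphere.1 hz
      rw [dist_self] at hz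
      exact hρ.ne hz
    · exact (hρV hzc).2 ⟨y, hya, hy⟩
  have hW : ∀ᶠ n in atTop, ∀ t ∈ Metric.ball (0 : ℂ) r,
      m • (t : Sphere) ∈ (Set.range fun b => (s n b : Sphere))ᶜ := by
    have hC : IsClosed ((fun t : ℂ => m • (t : Sphere)) '' Metric.closedBall 0 r) :=
      ((isCompact_closedBall _ _).image hmc).isClosed
    have : ∀ᶠ n in atTop, ∀ b,
        (s n b : Sphere) ∈ ((fun t : ℂ => m • (t : Sphere)) '' Metric.closedBall 0 r)ᶜ := by
      refine eventually_all.2 fun b => ?_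
      refine ((OnePoint.continuous_coe.tendsto _).comp (hs b)).eventually (hC.isOpen_compl.mem_nhds ?_)
      rintro ⟨t, ht, ht2⟩
      exact hrS t ht ⟨b, ht2.symm⟩
    filter_upwards [this] with n hn t ht
    rintro ⟨b, hb⟩
    exact hn b ⟨t, Metric.ball_subset_closedBall ht, hb.symm⟩
  have hu₁ : ∀ᶠ n in atTop, x n a ∈ Metric.ball (x' a) ρ :=
    (hx a).eventually (Metric.ball_mem_nhds _ hρ)
  have hu₂ : ∀ᶠ n in atTop, x n a₂ ∈ (Metric.closedBall (x' a) ρ)ᶜ := by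
    refine (hx a₂).eventually (Metric.isClosed_closedBall.isOpen_compl.mem_nhds fun h => ?_)
    exact (hρV h).2 ⟨a₂, ha, rfl⟩
  obtain ⟨n, h1, h2, h3, h4, h5, h6⟩ :=
    (hu₁.and (hu₂.and (hW.and (hKV.and (hcov.and hfx))))).exists
  refine not_isCoveringMapOn_of_circle h5 h3 h1 h2 (fun h => h (h6 a)) (fun h => h (h6 a₂)) fun θ => ?_
  obtain ⟨t, ht, ht2⟩ := h4 _ ⟨_, circleMap_mem_sphere (x' a) hρ.le θ, rfl⟩
  exact ⟨t, ht, ht2.symm⟩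

variable {Y : Type u} {Z : Type v} [Fintype Y] {P : Portrait Y Z}

open scoped Classical in
/-- The limit `G` of marked rational maps in the coordinates `g n` of the source and `h n` of the
target, where the marked points converge to `a` and `ζ`. -/
structure VertexLimit (R : ℕ → MarkedRationalMap P) (g : ℕ → GL (Fin 2) ℂ) (a : Y → Sphere)
    (h : ℕ → GL (Fin 2) ℂ) (ζ : Z → Sphere) (G : RatFunc ℂ) : Prop where
  one_le_ratDegree : 1 ≤ ratDegree G
  tendsto_z : ∀ b, Tendsto (fun n => h n • (R n).z b) atTop (𝓝 (ζ b))
  tendsto_f : ∀ p ∉ Set.range a,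
    Tendsto (fun w : ℕ × Sphere => h w.1 • ratMap (R w.1).f ((g w.1)⁻¹ • w.2)) (atTop ×ˢ 𝓝 p)
      (𝓝 (ratMap G p))
  preimage_range : ratMap G ⁻¹' Set.range ζ = Set.range a
  isLocalHomeomorphOn : IsLocalHomeomorphOn (ratMap G) (Set.range a)ᶜ
  exists_sum_deg_eq : ∀ e ∈ Set.range a, ∃ N, ∀ b, ∑ y with a y = e ∧ P.F y = b, P.deg y =
    N + if ζ b = ratMap G e then localDegree G e else 0
  exists_three : ∃ b : Fin 3 → Z, Function.Injective (ζ ∘ b)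

/-- Every critical point is marked and goes to a marked value, so over the other values the map is a
local homeomorphism; with compactness of the sphere it is a covering there. -/
theorem IsNormalForm.isCoveringMapOn {x : Y → ℂ} {b₀ : Z} {q : ℂ[X]} {s : Z → ℂ}
    (h : IsNormalForm P x b₀ q s) (hp : IsPair P.degree (-fiberProd P x b₀) q)
    (hx : ∀ y, pairMap P.degree (-fiberProd P x b₀) q (x y) = (s (P.F y) : Sphere)) :
    IsCoveringMapOn (pairMap P.degree (-fiberProd P x b₀) q) (Set.range fun b => (s b : Sphere))ᶜ := by
  refine IsCoveringMapOn.of_isLocalHomeomorphOn hp.continuous_pairMap ?_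
  refine (hp.isLocalHomeomorphOn (natDegree_fiberProd P x b₀) h.natDegree_eq
    (E := Set.range x) fun z hz => ?_).mono ?_
  · rw [h.wronskian_eq]
    exact eval_critProd_ne_zero P hz
  · rintro p hp ⟨_, ⟨y, rfl⟩, rfl⟩
    exact hp ⟨P.F y, (hx y).symm⟩

/-- With finite limit marks the normal forms converge, and the reduced pencil of the limit supplies
`G`. The common factor `U` vanishes only at limit marks, so the map converges elsewhere. -/
theorem exists_vertexLimit_of_finite [Finite Z] [Nontrivial Z] {R : ℕ → MarkedRationalMap P} {x' : Y → ℂ}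
    (hR : ∀ y, Tendsto (fun n => (R n).y y) atTop (𝓝 (x' y : Sphere)))
    (h3 : ∃ y : Fin 3 → Y, Function.Injective (x' ∘ y)) :
    ∃ h ζ G, VertexLimit R (fun _ => 1) (fun y => (x' y : Sphere)) h ζ G := by
  classical
  obtain ⟨b₀, b₁, hb⟩ := exists_pair_ne Z
  -- The value 0 stands in for a mark at ∞, which occurs for finitely many n only; `hnf` likewise
  -- carries dummies for these n.
  set x : ℕ → Y → ℂ := fun n y => ((R n).y y).elim 0 id with hx
  have hxR : ∀ᶠ n in atTop, ∀ y, (R n).y y = x n y := by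
    refine eventually_all.2 fun y => ?_
    filter_upwards [(hR y).eventually_ne (OnePoint.coe_ne_infty _)] with n hn
    obtain ⟨z, hz⟩ := OnePoint.ne_infty_iff_exists.1 hn
    simp only [hx, ← hz]
    rfl
  have hxt : ∀ y, Tendsto (fun n => x n y) atTop (𝓝 (x' y)) := by
    intro y
    rw [OnePoint.isOpenEmbedding_coe.tendsto_nhds_iff]
    refine (hR y).congr' ?_
    filter_upwards [hxR] with n hn using hn y
  have hnf : ∀ n, ∃ (q : ℂ[X]) (s : Z → ℂ) (h : GL (Fin 2) ℂ), (∀ y, (R n).y y = x n y) →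
      IsNormalForm P (x n) b₀ q s ∧ IsPair P.degree (-fiberProd P (x n) b₀) q ∧
      (∀ p, h • ratMap (R n).f p = pairMap P.degree (-fiberProd P (x n) b₀) q p) ∧
      ∀ b, h • (R n).z b = (s b : Sphere) := by
    intro n
    by_cases hn : ∀ y, (R n).y y = x n y
    · obtain ⟨q, s, h, h1, h2, h3, h4, h5, h6⟩ := (R n).exists_normal_form hn hb
      exact ⟨q, s, h, fun _ => ⟨⟨h2, h3, h4⟩, h1, h5, h6⟩⟩
    · exact ⟨0, 0, 1, fun h => absurd h hn⟩
  choose q s h hnf using hnf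
  have hev := hxR.mono hnf
  obtain ⟨q', s', hq', hqt, hst⟩ := exists_limit_normal_form hxt (hev.mono fun n hn => hn.1)
  obtain ⟨D, U, A, B, hred, hA, hB⟩ := hq'.exists_isReduced
  have hUne : ∀ p ∉ Set.range fun y => (x' y : Sphere), hom U.natDegree U (vec p) ≠ 0 := by
    intro p hp
    induction p using OnePoint.rec with
    | infty =>
      rw [vec_infty, hom_infty]
      simpa using hred.left_ne_zero
    | coe z =>
      rw [vec_coe, hom_coe le_rfl]
      intro h0
      have : (fiberProd P x' b₀).eval z = 0 := by rw [hA, Polynomial.eval_mul, h0, zero_mul]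
      obtain ⟨y, -, hy⟩ := (eval_fiberProd_eq_zero_iff P x' b₀ z).1 this
      exact hp ⟨y, congrArg _ hy⟩
  have hft : ∀ p ∉ Set.range fun y => (x' y : Sphere), Tendsto (fun w : ℕ × Sphere =>
      h w.1 • ratMap (R w.1).f w.2) (atTop ×ˢ 𝓝 p) (𝓝 (pairMap D (-A) B p)) := by
    intro p hp
    have hA' : -fiberProd P x' b₀ = U * -A := by rw [hA, mul_neg]
    have hvec := hred.isPair.hom_vec_ne_zero p
    have e1 : (hom P.degree (-fiberProd P x' b₀) (vec p), hom P.degree q' (vec p)) =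
        hom U.natDegree U (vec p) • (hom D (-A) (vec p), hom D B (vec p)) := by
      rw [hA', hB, ← hred.natDegree_add, hom_mul_vec le_rfl hred.isPair.left_le,
        hom_mul_vec le_rfl hred.isPair.right_le]
      rfl
    have e2 : pairMap D (-A) B p = pairMap P.degree (-fiberProd P x' b₀) q' p := by
      rw [pairMap, pairMap, e1, ptv_smul (hUne p hp)]
    rw [e2]
    refine Tendsto.congr' ?_ (tendsto_pairMap (l := atTop ×ˢ 𝓝 p) P.degree
      (A := fun w : ℕ × Sphere => -fiberProd P (x w.1) b₀) (B := fun w => q w.1)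
      (fun k => ?_) (fun k => (hqt k).comp tendsto_fst) (p := Prod.snd) tendsto_snd ?_)
    · filter_upwards [hev.prod_inl (𝓝 p)] with w hw
      exact (hw.2.2.1 w.2).symm
    · simp only [Polynomial.coeff_neg]
      exact ((tendsto_coeff_fiberProd hxt b₀ k).comp tendsto_fst).neg
    · rw [e1]
      exact smul_ne_zero (hUne p hp) hvec
  have hmaps : ∀ n, (∀ y, (R n).y y = x n y) →
      ∀ y, pairMap P.degree (-fiberProd P (x n) b₀) (q n) (x n y) = (s n (P.F y) : Sphere) := by
    intro n hn y
    rw [← (hnf n hn).2.2.1, ← hn, (R n).comm, (hnf n hn).2.2.2]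
  have hsurj : ∀ y, ∃ b, pairMap D (-A) B (x' y) = (s' b : Sphere) := by
    intro y
    obtain ⟨t, ht⟩ := h3
    obtain ⟨y₂, hy₂⟩ : ∃ y₂, x' y₂ ≠ x' y := by
      by_contra! hcon
      exact absurd (ht ((hcon (t 0)).trans (hcon (t 1)).symm)) (by decide)
    suffices hmem : pairMap D (-A) B (x' y) ∈ Set.range fun b => (s' b : Sphere) by
      obtain ⟨b, hb⟩ := hmem
      exact ⟨b, hb.symm⟩
    refine mem_range_of_tendsto_covering (f := fun n p => h n • ratMap (R n).f p)
      hft hred.isPair.continuous_pairMap hxt hst ?_ ?_ hy₂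
    · filter_upwards [hxR] with n hn
      have := (hnf n hn).1.isCoveringMapOn (hnf n hn).2.1 (hmaps n hn)
      rwa [show (fun p => h n • ratMap (R n).f p) = pairMap P.degree (-fiberProd P (x n) b₀) (q n) from
        funext (hnf n hn).2.2.1]
    · filter_upwards [hxR] with n hn y
      rw [(hnf n hn).2.2.1, hmaps n hn]
      exact ⟨_, rfl⟩
  have hrat := hred.isPair.ratMap_ratOf
  refine ⟨h, fun b => (s' b : Sphere), ratOf (-A) B, ?_, fun b => ?_, fun p hp => ?_, ?_, ?_, ?_, ?_⟩
  · rw [hred.isPair.ratDegree_ratOf]; exact hred.isPair.pos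
  · refine ((OnePoint.continuous_coe.tendsto _).comp (hst b)).congr' ?_
    filter_upwards [hev] with n hn
    exact (hn.2.2.2 b).symm
  · rw [hrat]
    simpa only [inv_one, one_smul] using hft p hp
  · rw [hrat]
    refine Set.Subset.antisymm hred.preimage_subset ?_
    rintro _ ⟨y, rfl⟩
    obtain ⟨b, hb⟩ := hsurj y
    exact ⟨b, hb.symm⟩
  · rw [hrat]
    have := hred.isPair.isLocalHomeomorphOn hred.natDegree_left hred.natDegree_right
      hred.eval_wronskian_ne_zero
    rwa [← Set.range_comp] at this
  · rintro _ ⟨y, rfl⟩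
    refine ⟨U.rootMultiplicity (x' y), fun b => ?_⟩
    simp only [OnePoint.coe_eq_coe]
    exact hred.sum_deg_eq (x' y) b
  · obtain ⟨b, hb⟩ := hred.exists_three hsurj h3
    exact ⟨b, OnePoint.coe_injective.comp hb⟩

/-- A fixed Moebius map `α` makes all limit marks finite. Precomposing each map with the inverse of
`α * g n` gives a sequence marked by the same portrait, to which the finite case applies; afterwards
`α` is moved into `G`. -/
theorem exists_vertexLimit [Finite Z] [Nontrivial Z] {R : ℕ → MarkedRationalMap P}
    {g : ℕ → GL (Fin 2) ℂ} {a : Y → Sphere}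
    (hR : ∀ y, Tendsto (fun n => g n • (R n).y y) atTop (𝓝 (a y)))
    (h3 : ∃ y : Fin 3 → Y, Function.Injective (a ∘ y)) :
    ∃ h ζ G, VertexLimit R g a h ζ G := by
  classical
  obtain ⟨α, hα⟩ := exists_smul_ne_infty (Set.range a) (Set.finite_range a)
  choose x' hx' using fun y => OnePoint.ne_infty_iff_exists.1 (hα _ ⟨y, rfl⟩)
  have hdeg : ∀ n, 1 ≤ ratDegree (R n).f := fun n => by
    rw [(R n).degree_f]; have := P.two_le_degree; omega
  choose f hf1 hf2 hf3 using fun n => exists_ratMap_comp (hdeg n) (α * g n)⁻¹ 1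
  let R' : ℕ → MarkedRationalMap P := fun n =>
    { f := f n
      y := fun y => (α * g n) • (R n).y y
      z := (R n).z
      degree_f := (hf1 n).trans (R n).degree_f
      y_injective := (MulAction.injective _).comp (R n).y_injective
      z_injective := (R n).z_injective
      comm := fun y => by rw [hf2, inv_smul_smul, one_smul, (R n).comm]
      localDegree_y := fun y => by rw [hf3, inv_smul_smul, (R n).localDegree_y] }
  have hrange : ∀ p, α • p ∈ Set.range (fun y => (x' y : Sphere)) ↔ p ∈ Set.range a := by
    intro p
    simp only [Set.mem_range, hx', smul_left_cancel_iff]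
  obtain ⟨h, ζ, G', hV⟩ := exists_vertexLimit_of_finite (R := R') (x' := x') (fun y => by
    rw [hx']
    simp only [R', mul_smul]
    exact ((continuous_const_smul α).tendsto _).comp (hR y)) (by
    obtain ⟨y, hy⟩ := h3
    refine ⟨y, fun i j hij => hy ?_⟩
    have : α • a (y i) = α • a (y j) := by rw [← hx', ← hx']; exact congrArg _ hij
    exact smul_left_cancel _ this)
  obtain ⟨G, hG1, hG2, hG3⟩ := exists_ratMap_comp hV.one_le_ratDegree α 1
  simp only [one_smul] at hG2
  refine ⟨h, ζ, G, hG1.symm ▸ hV.one_le_ratDegree, hV.tendsto_z, fun p hp => ?_, ?_, ?_, ?_,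
    hV.exists_three⟩
  · rw [hG2]
    refine ((hV.tendsto_f (α • p) (mt (hrange p).1 hp)).comp (tendsto_fst.prodMk
      (((continuous_const_smul α).tendsto p).comp tendsto_snd))).congr fun w => ?_
    simp only [Function.comp, R', hf2, inv_one, one_smul, mul_inv_rev, mul_smul, inv_smul_smul]
  · ext p
    rw [Set.mem_preimage, hG2, ← hrange, ← hV.preimage_range, Set.mem_preimage]
  · rw [show ratMap G = ratMap G' ∘ fun p => α • p from funext hG2]
    exact hV.isLocalHomeomorphOn.comp (isLocalHomeomorphOn_smul α _) fun p hp => mt (hrange p).1 hp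
  · intro e he
    obtain ⟨N, hN⟩ := hV.exists_sum_deg_eq _ ((hrange e).2 he)
    refine ⟨N, fun b => ?_⟩
    rw [hG2, hG3, ← hN]
    simp only [hx', smul_left_cancel_iff]

/-- A triple separated by both limit markings makes the coordinate changes converge to a Moebius map
`m'`, so the new limit is m' ∘ G. -/
theorem VertexLimit.change {R : ℕ → MarkedRationalMap P} {g h h' : ℕ → GL (Fin 2) ℂ}
    {a : Y → Sphere} {ζ ζ' : Z → Sphere} {G : RatFunc ℂ} (hV : VertexLimit R g a h ζ G)
    (hz : ∀ b, Tendsto (fun n => h' n • (R n).z b) atTop (𝓝 (ζ' b))) {b : Fin 3 → Z}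
    (hb : Function.Injective (ζ ∘ b)) (hb' : Function.Injective (ζ' ∘ b)) :
    ∃ G', VertexLimit R g a h' ζ' G' := by
  classical
  obtain ⟨m, m', hm, hm2⟩ := exists_transition hV.tendsto_z hz hb hb'
  have hζ : ∀ b, ζ' b = m' • ζ b := by
    intro b
    refine tendsto_nhds_unique (hz b) ((tendsto_smul hm (hV.tendsto_z b)).congr' ?_)
    filter_upwards [hm2] with n hn using (hn _).symm
  obtain ⟨G', hG1, hG2, hG3⟩ := exists_ratMap_comp hV.one_le_ratDegree 1 m'
  simp only [one_smul] at hG2 hG3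
  have hrange : ∀ p, m' • p ∈ Set.range ζ' ↔ p ∈ Set.range ζ := by
    intro p
    simp only [Set.mem_range, hζ, smul_left_cancel_iff]
  refine ⟨G', hG1.symm ▸ hV.one_le_ratDegree, hz, fun p hp => ?_, ?_, ?_, ?_, ⟨b, hb'⟩⟩
  · rw [hG2]
    refine (tendsto_smul (hm.comp tendsto_fst) (hV.tendsto_f p hp)).congr' ?_
    filter_upwards [hm2.prod_inl (𝓝 p)] with w hw
    exact (hw _).symm
  · ext p
    rw [Set.mem_preimage, hG2, hrange, ← hV.preimage_range, Set.mem_preimage]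
  · rw [show ratMap G' = (fun p => m' • p) ∘ ratMap G from funext hG2]
    exact (isLocalHomeomorphOn_smul m' Set.univ).comp hV.isLocalHomeomorphOn fun _ _ => trivial
  · intro e he
    obtain ⟨N, hN⟩ := hV.exists_sum_deg_eq e he
    refine ⟨N, fun b => ?_⟩
    rw [hG2, hG3, hN]
    congr 1
    exact if_congr (by rw [hζ, smul_left_cancel_iff]) rfl rfl

end

section

/-! ### Branches of trees -/

section Tree

variable {V : Type*} {G : SimpleGraph V} (hT : G.IsTree)

/-- The second vertex of the path from `v` to `x`; it is `v` if `x = v`. -/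
def nxt (v x : V) : V := (hT.existsUnique_path v x).choose.snd

theorem adj_nxt {v x : V} (h : v ≠ x) : G.Adj v (nxt hT v x) :=
  SimpleGraph.Walk.adj_snd (SimpleGraph.Walk.not_nil_of_ne h)

theorem nxt_eq_snd {v x : V} {p : G.Walk v x} (hp : p.IsPath) : nxt hT v x = p.snd := by
  rw [nxt, (hT.existsUnique_path v x).unique (hT.existsUnique_path v x).choose_spec.1 hp]

theorem nxt_self (v : V) : nxt hT v v = v := nxt_eq_snd hT SimpleGraph.Walk.IsPath.nil

/-- This turns statements about branches into arithmetic of distances: in a tree, the distances of a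
vertex to the ends of an edge differ by exactly one. -/
theorem nxt_eq_iff_dist {v u : V} (h : G.Adj v u) (x : V) :
    nxt hT v x = u ↔ G.dist v x = G.dist u x + 1 := by
  constructor
  · rintro hu
    have hvx : v ≠ x := by
      rintro rfl
      rw [nxt_self] at hu
      exact h.ne hu
    obtain ⟨p, hp⟩ := hT.1.exists_walk_length_eq_dist v x
    have hpath := p.isPath_of_length_eq_dist hp
    rw [nxt_eq_snd hT hpath] at hu
    have hnil : ¬p.Nil := SimpleGraph.Walk.not_nil_of_ne hvx
    have h1 := SimpleGraph.Walk.length_tail_add_one hnil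
    have h2 := G.dist_le p.tail
    replace h2 : G.dist u x ≤ p.tail.length := hu ▸ h2
    rcases hT.dist_eq_dist_add_one_of_adj x h with h3 | h3 <;>
    · rw [G.dist_comm (u := x), G.dist_comm (u := x)] at h3
      omega
  · intro hd
    obtain ⟨q, hq⟩ := hT.1.exists_walk_length_eq_dist u x
    have : (SimpleGraph.Walk.cons h q).length = G.dist v x := by
      rw [SimpleGraph.Walk.length_cons, hq, hd]
    rw [nxt_eq_snd hT (SimpleGraph.Walk.isPath_of_length_eq_dist _ this), SimpleGraph.Walk.snd_cons]

theorem dist_eq_or {V : Type*} {G : SimpleGraph V} (hT : G.IsTree) (x : V) {v u : V} (h : G.Adj v u) :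
    G.dist v x = G.dist u x + 1 ∨ G.dist u x = G.dist v x + 1 := by
  simpa only [G.dist_comm (u := x)] using hT.dist_eq_dist_add_one_of_adj x h

/-- An edge cuts the tree into two sides: each vertex is seen through the edge from exactly one of
its ends. -/
theorem nxt_eq_iff_ne {v u : V} (h : G.Adj v u) (x : V) : nxt hT v x = u ↔ nxt hT u x ≠ v := by
  have := dist_eq_or hT x h
  rw [Ne, nxt_eq_iff_dist hT h, nxt_eq_iff_dist hT h.symm]
  omega

theorem nxt_of_adj {v u : V} (h : G.Adj v u) : nxt hT v u = u := by
  rw [nxt_eq_iff_ne hT h, nxt_self]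
  exact h.ne'

theorem nxt_nxt_ne {v x : V} (h : v ≠ x) : nxt hT (nxt hT v x) x ≠ v :=
  (nxt_eq_iff_ne hT (adj_nxt hT h) x).1 rfl

theorem nxt_eq_of_adj {v t t' : V} (h : G.Adj t t') (ht : v ≠ t) (ht' : v ≠ t') :
    nxt hT v t = nxt hT v t' := by
  wlog hd : G.dist t v = G.dist t' v + 1 generalizing t t'
  · exact (this h.symm ht' ht ((dist_eq_or hT v h).resolve_left hd)).symm
  have hu := adj_nxt hT ht'
  have h1 := (nxt_eq_iff_dist hT hu t').1 rfl
  rw [nxt_eq_iff_dist hT hu]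
  have h2 : G.dist (nxt hT v t') t ≤ G.dist (nxt hT v t') t' + G.dist t' t := hT.1.dist_triangle
  rw [SimpleGraph.dist_eq_one_iff_adj.2 h.symm] at h2
  have h3 := dist_eq_or hT t hu
  rw [G.dist_comm (u := t), G.dist_comm (u := t')] at hd
  omega

/-- A branch at `v` that does not contain `w` lies wholly in the branch at `w` that contains `v`.
The induction walks from `x` towards `v`. -/
theorem nxt_eq_or {v w : V} (hvw : v ≠ w) (x : V) :
    nxt hT v x = nxt hT v w ∨ nxt hT w x = nxt hT w v := by
  induction hn : G.dist x v generalizing x with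
  | zero =>
    rw [hT.1.dist_eq_zero_iff] at hn
    exact Or.inr (by rw [hn])
  | succ n ih =>
    by_cases hx : nxt hT v x = nxt hT v w
    · exact Or.inl hx
    refine Or.inr ?_
    have hxv : x ≠ v := by rintro rfl; simp at hn
    have hxw : x ≠ w := fun h => hx (by rw [h])
    have hadj := adj_nxt hT hxv
    have hd := (nxt_eq_iff_dist hT hadj v).1 rfl
    by_cases hx' : nxt hT x v = v
    · rw [hx'] at hadj
      exact nxt_eq_of_adj hT hadj hxw.symm hvw.symm
    · have h1 := nxt_eq_of_adj hT hadj hxv.symm (Ne.symm hx')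
      rw [h1] at hx
      have hxw' : nxt hT x v ≠ w := fun h => hx (by rw [h])
      rw [nxt_eq_of_adj hT hadj hxw.symm hxw'.symm]
      exact (ih _ (by omega)).resolve_left hx

end Tree

namespace TreeOfSpheres

variable {X : Type u} (T : TreeOfSpheres.{u, w₁} X)

theorem marking_eq (v : T.I) (x : X) : T.marking v x =
    T.attach v ⟨nxt T.isTree (Sum.inr v) (Sum.inl x), adj_nxt T.isTree (by simp)⟩ := rfl

theorem marking_eq_attach_iff (v : T.I) (x : X) (t : T.graph.neighborSet (Sum.inr v)) :
    T.marking v x = T.attach v t ↔ nxt T.isTree (Sum.inr v) (Sum.inl x) = t.1 := by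
  rw [marking_eq, (T.attach_injective v).eq_iff, Subtype.ext_iff]

theorem marking_eq_marking_iff (v : T.I) (x y : X) : T.marking v x = T.marking v y ↔
    nxt T.isTree (Sum.inr v) (Sum.inl x) = nxt T.isTree (Sum.inr v) (Sum.inl y) :=
  T.marking_eq_attach_iff v x _

theorem exists_adj_ne (v : T.I) (s t : X ⊕ T.I) :
    ∃ r, T.graph.Adj (Sum.inr v) r ∧ r ≠ s ∧ r ≠ t := by
  obtain ⟨r, hr, hr2⟩ := Set.exists_mem_notMem_of_ncard_lt_ncard (s := {s, t})
    (t := T.graph.neighborSet (Sum.inr v))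
    (lt_of_le_of_lt (Set.ncard_insert_le _ _) (by rw [Set.ncard_singleton]; exact T.stable v))
  simp only [Set.mem_insert_iff, Set.mem_singleton_iff, not_or] at hr2
  exact ⟨r, hr, hr2⟩

theorem eq_of_adj_leaf {x : X} {s t : X ⊕ T.I} (hs : T.graph.Adj (Sum.inl x) s)
    (ht : T.graph.Adj (Sum.inl x) t) : s = t := by
  obtain ⟨r, hr⟩ := Set.ncard_eq_one.1 (T.leaf x)
  have h1 : s ∈ T.graph.neighborSet (Sum.inl x) := hs
  have h2 : t ∈ T.graph.neighborSet (Sum.inl x) := ht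
  rw [hr] at h1 h2
  exact h1.trans h2.symm

theorem nxt_eq_leaf_iff {w : T.I} {a : X} (hs : T.graph.Adj (Sum.inr w) (Sum.inl a)) (x : X) :
    nxt T.isTree (Sum.inr w) (Sum.inl x) = Sum.inl a ↔ x = a := by
  refine ⟨fun h => ?_, fun h => by rw [h]; exact nxt_of_adj T.isTree hs⟩
  rw [nxt_eq_iff_ne T.isTree hs] at h
  by_contra hne
  have hne' : (Sum.inl a : X ⊕ T.I) ≠ Sum.inl x := fun h => hne (Sum.inl_injective h).symm
  exact h (T.eq_of_adj_leaf (adj_nxt T.isTree hne') hs.symm)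

variable [Finite X]

/-- A vertex of the branch farthest from `v` is a leaf, since an internal one has an edge leading
further away. -/
theorem exists_leaf {v u : X ⊕ T.I} (h : T.graph.Adj v u) :
    ∃ x : X, nxt T.isTree v (Sum.inl x) = u := by
  have := T.finite_I
  obtain ⟨t, ht, hmax⟩ := Set.exists_max_image {t | nxt T.isTree v t = u} (T.graph.dist v)
    (Set.toFinite _) ⟨u, nxt_of_adj T.isTree h⟩
  replace ht : nxt T.isTree v t = u := ht
  rcases t with x | i
  · exact ⟨x, ht⟩
  exfalso
  have htv : v ≠ Sum.inr i := by
    rintro rfl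
    rw [nxt_self] at ht
    exact h.ne ht
  obtain ⟨r, hr, hr1, -⟩ := T.exists_adj_ne i (nxt T.isTree (Sum.inr i) v) (Sum.inr i)
  have hrv : v ≠ r := by
    rintro rfl
    exact hr1 (nxt_of_adj T.isTree hr).symm
  have h1 := hmax r ((nxt_eq_of_adj T.isTree hr htv hrv).symm.trans ht)
  have h2 := (nxt_eq_iff_dist T.isTree hr v).not.1 (Ne.symm hr1)
  have h3 := dist_eq_or T.isTree v hr
  rw [T.graph.dist_comm (u := v), T.graph.dist_comm (u := v)] at h1
  omega

theorem range_marking (v : T.I) : Set.range (T.marking v) = T.attachSet v := by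
  refine Set.Subset.antisymm ?_ ?_
  · rintro _ ⟨x, rfl⟩
    exact ⟨_, (T.marking_eq v x).symm⟩
  · rintro _ ⟨t, rfl⟩
    obtain ⟨x, hx⟩ := T.exists_leaf t.2
    exact ⟨x, (T.marking_eq_attach_iff v x t).2 hx⟩

/-- Minimize the sum of the distances to the three leaves. If two of them lay in the same direction,
a step that way would shorten two distances and lengthen at most one, each by 1. -/
theorem exists_median {x : Fin 3 → X} (hx : Function.Injective x) :
    ∃ v : T.I, Function.Injective (T.marking v ∘ x) := by
  have := T.finite_I
  have : Nonempty (X ⊕ T.I) := ⟨Sum.inl (x 0)⟩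
  obtain ⟨v, hv⟩ := Finite.exists_min fun v : X ⊕ T.I => ∑ i, T.graph.dist v (Sum.inl (x i))
  have key : ∀ i j, i ≠ j → v ≠ Sum.inl (x i) → nxt T.isTree v (Sum.inl (x i)) ≠
      nxt T.isTree v (Sum.inl (x j)) := by
    intro i j hij hvi heq
    have hadj := adj_nxt T.isTree hvi
    have h1 := (nxt_eq_iff_dist T.isTree hadj _).1 rfl
    have h2 := (nxt_eq_iff_dist T.isTree hadj _).1 heq.symm
    have h3 := hv (nxt T.isTree v (Sum.inl (x i)))
    have h4 := fun k => dist_eq_or T.isTree (Sum.inl (x k)) hadj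
    have h40 := h4 0
    have h41 := h4 1
    have h42 := h4 2
    simp only [Fin.sum_univ_three] at h3
    fin_cases i <;> fin_cases j <;> simp at hij h1 h2 h3 h40 h41 h42 <;> omega
  rcases v with a | v
  · exfalso
    have hleaf : ∀ i j, i ≠ j → Sum.inl a ≠ (Sum.inl (x i) : X ⊕ T.I) →
        Sum.inl a ≠ (Sum.inl (x j) : X ⊕ T.I) → False := fun i j hij hi hj =>
      key i j hij hi (T.eq_of_adj_leaf (adj_nxt T.isTree hi) (adj_nxt T.isTree hj))
    have : ∀ i j, i ≠ j → a = x i ∨ a = x j := by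
      intro i j hij
      by_contra! hcon
      exact hleaf i j hij (fun h => hcon.1 (Sum.inl_injective h)) fun h => hcon.2 (Sum.inl_injective h)
    have h01 := this 0 1 (by decide)
    have h02 := this 0 2 (by decide)
    have h12 := this 1 2 (by decide)
    have n01 := hx.ne (show (0 : Fin 3) ≠ 1 by decide)
    have n02 := hx.ne (show (0 : Fin 3) ≠ 2 by decide)
    have n12 := hx.ne (show (1 : Fin 3) ≠ 2 by decide)
    grind
  · refine ⟨v, fun i j hij => ?_⟩
    by_contra hne
    exact key i j hne (by simp) ((T.marking_eq_marking_iff v _ _).1 hij)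

/-- The first vertex after `v` on the way to `w` is internal, so it has a third edge; a leaf behind
that edge hangs off the path. -/
theorem exists_leaf_between {v w : T.I} (hvw : v ≠ w) (h : ¬T.graph.Adj (Sum.inr v) (Sum.inr w)) :
    ∃ x : X, nxt T.isTree (Sum.inr v) (Sum.inl x) = nxt T.isTree (Sum.inr v) (Sum.inr w) ∧
      nxt T.isTree (Sum.inr w) (Sum.inl x) = nxt T.isTree (Sum.inr w) (Sum.inr v) := by
  have hvw' : (Sum.inr v : X ⊕ T.I) ≠ Sum.inr w := fun h => hvw (Sum.inr_injective h)
  have hadj := adj_nxt T.isTree hvw'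
  have hne := nxt_nxt_ne T.isTree hvw'
  set u := nxt T.isTree (Sum.inr v) (Sum.inr w) with hu
  have huw : u ≠ Sum.inr w := fun h' => h (h' ▸ hadj)
  have hadj2 := adj_nxt T.isTree huw
  rcases hu' : u with a | i
  · rw [hu'] at hadj hadj2 hne
    exact absurd (T.eq_of_adj_leaf hadj2 hadj.symm) hne
  · obtain ⟨t, ht, ht1, ht2⟩ := T.exists_adj_ne i (Sum.inr v) (nxt T.isTree u (Sum.inr w))
    obtain ⟨x, hx⟩ := T.exists_leaf ht
    rw [← hu'] at hx
    refine ⟨x, ?_, ?_⟩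
    · rw [nxt_eq_iff_ne T.isTree (hu' ▸ hadj), ← hu', hx]
      exact ht1
    · rw [(nxt_eq_or T.isTree huw (Sum.inl x)).resolve_left (by rw [hx]; exact ht2)]
      exact nxt_eq_of_adj T.isTree hadj.symm huw.symm hvw'.symm

/-- Two complementary branches are the two sides of an edge. -/
theorem eq_of_compl_branch {w w' : T.I} {s s' : X ⊕ T.I}
    (h : ∀ x, nxt T.isTree (Sum.inr w) (Sum.inl x) = s ↔
      nxt T.isTree (Sum.inr w') (Sum.inl x) ≠ s') : s = Sum.inr w' ∧ s' = Sum.inr w := by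
  have hww : w ≠ w' := by
    rintro rfl
    obtain ⟨t, ht, h1, h2⟩ := T.exists_adj_ne w s s'
    obtain ⟨x, hx⟩ := T.exists_leaf ht
    have := h x
    rw [hx] at this
    exact h1 (this.2 h2)
  have hww' : (Sum.inr w : X ⊕ T.I) ≠ Sum.inr w' := fun h => hww (Sum.inr_injective h)
  -- If not, choose a leaf at `w'` neither in direction `s'` nor towards `w`. By hypothesis it lies
  -- in direction `s` from `w`, but it is also seen from `w` in the direction of `w'`.
  have h1 : s = nxt T.isTree (Sum.inr w) (Sum.inr w') := by
    by_contra hne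
    obtain ⟨t, ht, ht1, ht2⟩ := T.exists_adj_ne w' s' (nxt T.isTree (Sum.inr w') (Sum.inr w))
    obtain ⟨x, hx⟩ := T.exists_leaf ht
    rcases nxt_eq_or T.isTree hww' (Sum.inl x) with h2 | h2
    · rw [(h x).2 (by rw [hx]; exact ht1)] at h2
      exact hne h2
    · exact ht2 (hx.symm.trans h2)
  have h2 : s' = nxt T.isTree (Sum.inr w') (Sum.inr w) := by
    by_contra hne
    obtain ⟨t, ht, ht1, ht2⟩ := T.exists_adj_ne w s (nxt T.isTree (Sum.inr w) (Sum.inr w'))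
    obtain ⟨x, hx⟩ := T.exists_leaf ht
    rcases nxt_eq_or T.isTree hww'.symm (Sum.inl x) with h2 | h2
    · have : nxt T.isTree (Sum.inr w') (Sum.inl x) = s' := by
        by_contra hcon
        exact ht1 (hx.symm.trans ((h x).2 hcon))
      exact hne (this.symm.trans h2)
    · exact ht2 (hx.symm.trans h2)
  have hadj : T.graph.Adj (Sum.inr w) (Sum.inr w') := by
    by_contra hcon
    obtain ⟨x, hx1, hx2⟩ := T.exists_leaf_between hww hcon
    exact (h x).1 (hx1.trans h1.symm) (hx2.trans h2.symm)
  exact ⟨h1.trans (nxt_of_adj T.isTree hadj), h2.trans (nxt_of_adj T.isTree hadj.symm)⟩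

/-- A branch with only one leaf is an edge to this leaf. -/
theorem eq_leaf_of_branch {w : T.I} {s : X ⊕ T.I} (hs : T.graph.Adj (Sum.inr w) s) {b : X}
    (h : ∀ x, nxt T.isTree (Sum.inr w) (Sum.inl x) = s → x = b) : s = Sum.inl b := by
  rcases s with a | i
  · rw [h a (nxt_of_adj T.isTree hs)]
  · exfalso
    obtain ⟨t, ht, h1, -⟩ := T.exists_adj_ne i (Sum.inr w) (Sum.inr w)
    obtain ⟨t', ht', h1', h2'⟩ := T.exists_adj_ne i (Sum.inr w) t
    obtain ⟨x, hx⟩ := T.exists_leaf ht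
    obtain ⟨x', hx'⟩ := T.exists_leaf ht'
    have e1 := h x ((nxt_eq_iff_ne T.isTree hs _).2 (by rw [hx]; exact h1))
    have e2 := h x' ((nxt_eq_iff_ne T.isTree hs _).2 (by rw [hx']; exact h1'))
    rw [e1, ← e2, hx'] at hx
    exact h2' hx

end TreeOfSpheres

end

section

/-! ### Convergence to a cover -/

theorem mulAt_pos {D : ℕ} {E : ℂ[X]} (hE : E ≠ 0) (hD : E.natDegree ≤ D) (hD1 : 1 ≤ D) {p : Sphere}
    (hp : hom D E (vec p) = 0) : 1 ≤ mulAt D E p := by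
  induction p using OnePoint.rec with
  | infty =>
    rw [vec_infty, hom_infty] at hp
    change 1 ≤ D - E.natDegree
    have : E.natDegree ≠ D := by
      rintro rfl
      exact hE (Polynomial.leadingCoeff_eq_zero.1 hp)
    omega
  | coe z =>
    rw [vec_coe, hom_coe hD] at hp
    exact (Polynomial.rootMultiplicity_pos hE).2 hp

theorem one_le_localDegree {r : RatFunc ℂ} (hr : 1 ≤ ratDegree r) (p : Sphere) :
    1 ≤ localDegree r p := by
  have h := isPair_num_denom hr
  set w : ℂ × ℂ := (hom (ratDegree r) r.num (vec p), hom (ratDegree r) r.denom (vec p)) with hw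
  have hw0 : w ≠ 0 := h.hom_vec_ne_zero p
  have hp : ratMap r p = ptv w := by rw [ratMap_eq_pairMap]; rfl
  rw [localDegree_eq_mulAt hw0 hp]
  refine mulAt_pos (h.pencil_ne_zero hw0) (natDegree_pencil_le h.left_le h.right_le _ _) hr ?_
  rw [sub_eq_add_neg, ← neg_mul, ← Polynomial.C_neg, hom_add, hom_C_mul, hom_C_mul, hw]
  ring

theorem tendstoLocUnifOn_of_forall {F : ℕ → Sphere → Sphere} {f : Sphere → Sphere} {s : Set Sphere}
    (hf : Continuous f) (h : ∀ p ∈ s, Tendsto (fun w : ℕ × Sphere => F w.1 w.2) (atTop ×ˢ 𝓝 p) (𝓝 (f p))) :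
    Cover.TendstoLocUnifOn F f s := by
  let _ : UniformSpace Sphere := Cover.sphereUniformSpace
  change TendstoLocallyUniformlyOn F f atTop s
  rw [tendstoLocallyUniformlyOn_iff_forall_tendsto]
  intro p hp
  have h1 : Tendsto (fun w : ℕ × Sphere => f w.2) (atTop ×ˢ 𝓝 p) (𝓝 (f p)) :=
    (hf.tendsto p).comp tendsto_snd
  have h2 : Tendsto (fun w : ℕ × Sphere => (f w.2, F w.1 w.2)) (atTop ×ˢ 𝓝 p) (𝓝 (f p, f p)) :=
    h1.prodMk_nhds (h p hp)
  exact (h2.mono_left (prod_mono le_rfl nhdsWithin_le_nhds)).mono_right (nhds_le_uniformity _)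

theorem TreeOfSpheres.exists_three_marking {X : Type u} [Finite X] (T : TreeOfSpheres.{u, w₁} X) (v : T.I) :
    ∃ x : Fin 3 → X, Function.Injective (T.marking v ∘ x) := by
  obtain ⟨r₀, h₀, -, -⟩ := T.exists_adj_ne v (Sum.inr v) (Sum.inr v)
  obtain ⟨r₁, h₁, h₁₀, -⟩ := T.exists_adj_ne v r₀ r₀
  obtain ⟨r₂, h₂, h₂₀, h₂₁⟩ := T.exists_adj_ne v r₀ r₁
  obtain ⟨x₀, hx₀⟩ := T.exists_leaf h₀
  obtain ⟨x₁, hx₁⟩ := T.exists_leaf h₁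
  obtain ⟨x₂, hx₂⟩ := T.exists_leaf h₂
  refine ⟨![x₀, x₁, x₂], fun i j hij => ?_⟩
  have := (T.marking_eq_marking_iff v _ _).1 hij
  fin_cases i <;> fin_cases j <;> simp_all

/-- A third leaf would have to be reached through the edge from both of its ends, as neither end has
another edge. -/
theorem TreeOfSpheres.not_adj_leaf_leaf {X : Type u} [Finite X] (hX : 3 ≤ Nat.card X)
    (T : TreeOfSpheres.{u, w₁} X) (a b : X) : ¬T.graph.Adj (Sum.inl a) (Sum.inl b) := by
  intro h
  obtain ⟨x, -, hx⟩ := Set.exists_mem_notMem_of_ncard_lt_ncard (s := {a, b}) (t := Set.univ)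
    (lt_of_le_of_lt (Set.ncard_insert_le _ _) (by rw [Set.ncard_singleton, Set.ncard_univ]; exact hX))
  simp only [Set.mem_insert_iff, Set.mem_singleton_iff, not_or] at hx
  have h1 : nxt T.isTree (Sum.inl a) (Sum.inl x) = Sum.inl b := T.eq_of_adj_leaf
    (adj_nxt T.isTree fun h => hx.1 (Sum.inl_injective h).symm) h
  rw [nxt_eq_iff_ne T.isTree h] at h1
  exact h1 (T.eq_of_adj_leaf (adj_nxt T.isTree fun h => hx.2 (Sum.inl_injective h).symm) h.symm)

variable {Y : Type u} {Z : Type v} [Fintype Y] {P : Portrait Y Z}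

open scoped Classical in
/-- The two sides of an edge have complementary images, and the same local degree. -/
theorem compl_of_add_eq {S S' : Set Z} (hS : S.Nonempty) (hS' : S'.Nonempty) (hSc : Sᶜ.Nonempty)
    (hSc' : S'ᶜ.Nonempty) {N N' δ δ' d : ℕ} (hδ : 1 ≤ δ) (hδ' : 1 ≤ δ')
    (h : ∀ b, (N + if b ∈ S then δ else 0) + (N' + if b ∈ S' then δ' else 0) = d) :
    (∀ b, b ∈ S ↔ b ∉ S') ∧ δ = δ' := by
  obtain ⟨b₁, h₁⟩ := hS
  obtain ⟨b₂, h₂⟩ := hS'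
  obtain ⟨b₃, h₃⟩ := hSc
  obtain ⟨b₄, h₄⟩ := hSc'
  have k := fun b => h b
  have k₁ := h b₁
  have k₂ := h b₂
  have k₃ := h b₃
  have k₄ := h b₄
  rw [if_pos h₁] at k₁
  rw [if_pos h₂] at k₂
  rw [if_neg h₃] at k₃
  rw [if_neg h₄] at k₄
  -- The sum of δ on `S` and δ' on `S'` is constant in `b`. A point of both sets would give the
  -- value δ + δ', attained only on both, although `S` is proper; a point of neither would give 0,
  -- although `S` is nonempty.
  refine ⟨fun b => ⟨fun hb hb' => ?_, fun hb => ?_⟩, ?_⟩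
  · have := h b
    rw [if_pos hb, if_pos hb'] at this
    split_ifs at k₃ <;> omega
  · by_contra hb'
    have := h b
    rw [if_neg hb, if_neg hb'] at this
    split_ifs at k₁ <;> omega
  · split_ifs at k₁ k₂ k₃ k₄ <;> omega

open scoped Classical in
-- On `S` the left side is positive, so `S` is contained in {c}; a point outside `S` then shows N =
-- 0.
theorem eq_singleton_of_eq {S : Set Z} (hS : S.Nonempty) (hSc : Sᶜ.Nonempty) {N δ δ' : ℕ} {c : Z}
    (hδ : 1 ≤ δ)
    (h : ∀ b, (N + if b ∈ S then δ else 0) = if b = c then δ' else 0) :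
    (∀ b, b ∈ S ↔ b = c) ∧ δ = δ' := by
  obtain ⟨b₁, h₁⟩ := hS
  obtain ⟨b₂, h₂⟩ := hSc
  have k₁ := h b₁
  have k₂ := h b₂
  rw [if_pos h₁] at k₁
  rw [if_neg h₂] at k₂
  have e₁ : b₁ = c := by
    by_contra hne
    rw [if_neg hne] at k₁
    omega
  have e₂ : b₂ ≠ c := by
    rintro rfl
    exact h₂ (e₁ ▸ h₁)
  rw [if_neg e₂] at k₂
  rw [if_pos e₁] at k₁
  refine ⟨fun b => ⟨fun hb => ?_, fun hb => by rw [hb, ← e₁]; exact h₁⟩, by omega⟩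
  by_contra hne
  have := h b
  rw [if_pos hb, if_neg hne] at this
  omega

section Branch

open scoped Classical

variable {TY : TreeOfSpheres.{u, w₁} Y}

/-- The two branches of an edge partition the leaves, so together they contain the full fiber over
`b`. -/
theorem sum_deg_branch_add {v v' : TY.I} (h : TY.graph.Adj (Sum.inr v) (Sum.inr v')) (b : Z) :
    ∑ y with TY.marking v y = TY.attach v ⟨_, h⟩ ∧ P.F y = b, P.deg y +
      ∑ y with TY.marking v' y = TY.attach v' ⟨_, h.symm⟩ ∧ P.F y = b, P.deg y = P.degree := by
  rw [← P.sum_fiber b, ← Finset.sum_filter_add_sum_filter_not (Finset.univ.filter fun y => P.F y = b)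
    fun y => TY.marking v y = TY.attach v ⟨_, h⟩]
  simp only [Finset.filter_filter]
  congr 2
  · ext y; simp [and_comm]
  · ext y
    simp only [Finset.mem_filter, Finset.mem_univ, true_and, TY.marking_eq_attach_iff,
      nxt_eq_iff_ne TY.isTree h, not_not, and_comm]

theorem sum_deg_leaf {v : TY.I} {a : Y} (h : TY.graph.Adj (Sum.inr v) (Sum.inl a)) (b : Z) :
    ∑ y with TY.marking v y = TY.attach v ⟨_, h⟩ ∧ P.F y = b, P.deg y =
      if b = P.F a then P.deg a else 0 := by
  simp only [TY.marking_eq_attach_iff, TY.nxt_eq_leaf_iff h]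
  rw [Finset.sum_filter, Finset.sum_eq_single a]
  · simp [eq_comm]
  · intro y _ hy
    simp [hy]
  · simp

end Branch

end

/-! ### Assembling the limits at the vertices into a cover -/

section

variable {Y : Type u} {Z : Type v} [Fintype Y] {P : Portrait Y Z}

section Branch

variable {TY : TreeOfSpheres.{u, w₁} Y} {TZ : TreeOfSpheres.{v, w₂} Z}

/-- The leaves in the direction of `s` from `v`. -/
def TreeOfSpheres.branch {X : Type u} (T : TreeOfSpheres.{u, w₁} X) (v : T.I) (s : X ⊕ T.I) : Set X :=
  {x | nxt T.isTree (Sum.inr v) (Sum.inl x) = s}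

open scoped Classical in
-- The leaves of a branch are those whose limit is its attaching point, so the counting formula
-- applies to branches. The set of target marks going to the image point is nonempty as limit marks
-- go to limit marks, and proper as there are three values.
theorem VertexLimit.exists_sum_eq {R : ℕ → MarkedRationalMap P}
    {g h : ℕ → GL (Fin 2) ℂ} {v : TY.I} {ζ : Z → Sphere} {G : RatFunc ℂ}
    (hV : VertexLimit R g (TY.marking v) h ζ G) (t : TY.graph.neighborSet (Sum.inr v)) :
    {b | ζ b = ratMap G (TY.attach v t)}.Nonempty ∧ {b | ζ b = ratMap G (TY.attach v t)}ᶜ.Nonempty ∧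
      ∃ N, ∀ b, ∑ y with TY.marking v y = TY.attach v t ∧ P.F y = b, P.deg y =
        N + if b ∈ {b | ζ b = ratMap G (TY.attach v t)} then localDegree G (TY.attach v t) else 0 := by
  have he : TY.attach v t ∈ Set.range (TY.marking v) := by
    rw [TY.range_marking]
    exact ⟨_, rfl⟩
  have he' := he
  rw [← hV.preimage_range] at he'
  obtain ⟨b, hb⟩ := hV.exists_three
  obtain ⟨N, hN⟩ := hV.exists_sum_deg_eq _ he
  refine ⟨he', ?_, N, fun b => ?_⟩
  · by_contra hcon
    rw [Set.not_nonempty_iff_eq_empty, Set.compl_empty_iff] at hcon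
    have h1 : ∀ b, ζ b = ratMap G (TY.attach v t) := fun b => by
      have : b ∈ {b | ζ b = ratMap G (TY.attach v t)} := hcon ▸ Set.mem_univ b
      exact this
    exact absurd (hb ((h1 (b 0)).trans (h1 (b 1)).symm)) (by decide)
  · rw [hN b]
    rfl

/-- At the two ends of an edge the fibers over the edge are complementary, and the local degrees
agree. -/
theorem VertexLimit.eq_iff_ne {R : ℕ → MarkedRationalMap P} {g h g' h' : ℕ → GL (Fin 2) ℂ}
    {v v' : TY.I} {ζ ζ' : Z → Sphere} {G G' : RatFunc ℂ} (hV : VertexLimit R g (TY.marking v) h ζ G)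
    (hV' : VertexLimit R g' (TY.marking v') h' ζ' G') (e : TY.graph.Adj (Sum.inr v) (Sum.inr v')) :
    (∀ b, ζ b = ratMap G (TY.attach v ⟨_, e⟩) ↔ ζ' b ≠ ratMap G' (TY.attach v' ⟨_, e.symm⟩)) ∧
      localDegree G (TY.attach v ⟨_, e⟩) = localDegree G' (TY.attach v' ⟨_, e.symm⟩) := by
  obtain ⟨h1, h2, N, hN⟩ := hV.exists_sum_eq ⟨_, e⟩
  obtain ⟨h1', h2', N', hN'⟩ := hV'.exists_sum_eq ⟨_, e.symm⟩
  exact compl_of_add_eq h1 h1' h2 h2' (one_le_localDegree hV.one_le_ratDegree _)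
    (one_le_localDegree hV'.one_le_ratDegree _) (N := N) (N' := N') (d := P.degree) fun b => by
      rw [← hN, ← hN']
      exact sum_deg_branch_add e b

/-- The branch consists of one leaf, so its degree sum is concentrated over one value. -/
theorem VertexLimit.eq_iff_of_leaf {R : ℕ → MarkedRationalMap P} {g h : ℕ → GL (Fin 2) ℂ}
    {v : TY.I} {ζ : Z → Sphere} {G : RatFunc ℂ} (hV : VertexLimit R g (TY.marking v) h ζ G)
    {a : Y} (e : TY.graph.Adj (Sum.inr v) (Sum.inl a)) :
    (∀ b, ζ b = ratMap G (TY.attach v ⟨_, e⟩) ↔ b = P.F a) ∧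
      localDegree G (TY.attach v ⟨_, e⟩) = P.deg a := by
  obtain ⟨h1, h2, N, hN⟩ := hV.exists_sum_eq ⟨_, e⟩
  exact eq_singleton_of_eq h1 h2 (one_le_localDegree hV.one_le_ratDegree _)
    (N := N) (c := P.F a) (δ' := P.deg a) fun b => by rw [← hN]; exact sum_deg_leaf e b

theorem VertexLimit.exists_attach_eq [Finite Z] {R : ℕ → MarkedRationalMap P}
    {g h : ℕ → GL (Fin 2) ℂ} {v : TY.I} {w : TZ.I} {G : RatFunc ℂ}
    (hV : VertexLimit R g (TY.marking v) h (TZ.marking w) G) (t : TY.graph.neighborSet (Sum.inr v)) :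
    ∃ s, TZ.attach w s = ratMap G (TY.attach v t) := by
  have he : TY.attach v t ∈ Set.range (TY.marking v) := by
    rw [TY.range_marking]
    exact ⟨_, rfl⟩
  rwa [← hV.preimage_range, Set.mem_preimage, TZ.range_marking] at he

/-- The images of the edge seen from its two ends are branches with complementary sets of leaves,
hence the two sides of one edge of the target tree, with ends `w` and `w'`. -/
theorem VertexLimit.attach_eq_of_internal [Finite Z] {R : ℕ → MarkedRationalMap P}
    {g h g' h' : ℕ → GL (Fin 2) ℂ} {v v' : TY.I} {w w' : TZ.I} {G G' : RatFunc ℂ}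
    (hV : VertexLimit R g (TY.marking v) h (TZ.marking w) G)
    (hV' : VertexLimit R g' (TY.marking v') h' (TZ.marking w') G')
    (e : TY.graph.Adj (Sum.inr v) (Sum.inr v')) :
    ∃ e' : TZ.graph.Adj (Sum.inr w) (Sum.inr w'),
      ratMap G (TY.attach v ⟨_, e⟩) = TZ.attach w ⟨_, e'⟩ := by
  obtain ⟨⟨s, hs⟩, hs2⟩ := hV.exists_attach_eq ⟨_, e⟩
  obtain ⟨⟨s', hs'⟩, hs2'⟩ := hV'.exists_attach_eq ⟨_, e.symm⟩
  have key := (hV.eq_iff_ne hV' e).1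
  simp only [← hs2, ← hs2', Ne, TZ.marking_eq_attach_iff] at key
  obtain ⟨rfl, -⟩ := TZ.eq_of_compl_branch key
  exact ⟨hs, hs2.symm⟩

theorem VertexLimit.attach_eq_of_leaf [Finite Z] {R : ℕ → MarkedRationalMap P}
    {g h : ℕ → GL (Fin 2) ℂ} {v : TY.I} {w : TZ.I} {G : RatFunc ℂ}
    (hV : VertexLimit R g (TY.marking v) h (TZ.marking w) G) {a : Y}
    (e : TY.graph.Adj (Sum.inr v) (Sum.inl a)) :
    ∃ e' : TZ.graph.Adj (Sum.inr w) (Sum.inl (P.F a)),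
      ratMap G (TY.attach v ⟨_, e⟩) = TZ.attach w ⟨_, e'⟩ := by
  obtain ⟨⟨s, hs⟩, hs2⟩ := hV.exists_attach_eq ⟨_, e⟩
  have key := (hV.eq_iff_of_leaf e).1
  simp only [← hs2, TZ.marking_eq_attach_iff] at key
  obtain rfl := TZ.eq_leaf_of_branch hs fun b => (key b).1
  exact ⟨hs, hs2.symm⟩

theorem VertexLimit.mapsTo [Finite Z] {R : ℕ → MarkedRationalMap P}
    {g h : ℕ → GL (Fin 2) ℂ} {v : TY.I} {w : TZ.I} {G : RatFunc ℂ}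
    (hV : VertexLimit R g (TY.marking v) h (TZ.marking w) G) :
    ratMap G ⁻¹' (TZ.attachSet w)ᶜ = (TY.attachSet v)ᶜ := by
  rw [Set.preimage_compl, ← TZ.range_marking, hV.preimage_range, TY.range_marking]

end Branch

theorem exists_cover [Finite Z] [Nontrivial Z] (hY : 3 ≤ Nat.card Y) {R : ℕ → MarkedRationalMap P}
    {TY : TreeOfSpheres.{u, w₁} Y} {TZ : TreeOfSpheres.{v, w₂} Z}
    (hTY : TreeOfSpheres.SpheresTendsto (fun n => (R n).y) TY)
    (hTZ : TreeOfSpheres.SpheresTendsto (fun n => (R n).z) TZ) :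
    ∃ C : Cover TY TZ, C.MapsTendsto R := by
  obtain ⟨φY, hφY⟩ := hTY
  obtain ⟨φZ, hφZ⟩ := hTZ
  have hex : ∀ v, ∃ w G, VertexLimit R (fun n => φY n v) (TY.marking v) (fun n => φZ n w)
      (TZ.marking w) G := by
    intro v
    obtain ⟨h, ζ, G, hV⟩ := exists_vertexLimit (R := R) (g := fun n => φY n v) (a := TY.marking v)
      (fun y => tendsto_pi_nhds.1 (hφY v) y) (TY.exists_three_marking v)
    obtain ⟨b, hb⟩ := hV.exists_three
    -- The image of `v` must separate a triple that the limit at `v` separates. This is the median,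
    -- and the common triple allows the change to the given coordinates at `w`.
    obtain ⟨w, hw⟩ := TZ.exists_median hb.of_comp
    obtain ⟨G', hG'⟩ := hV.change (h' := fun n => φZ n w) (ζ' := TZ.marking w)
      (fun b => tendsto_pi_nhds.1 (hφZ w) b) hb hw
    exact ⟨w, G', hG'⟩
  choose F f hV using hex
  have hE : ∀ v t (e : TY.graph.Adj (Sum.inr v) t),
      ∃ e' : TZ.graph.Adj (Sum.inr (F v)) (Sum.map P.F F t),
        ratMap (f v) (TY.attach v ⟨_, e⟩) = TZ.attach (F v) ⟨_, e'⟩ := by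
    rintro v (a | v') e
    · exact (hV v).attach_eq_of_leaf e
    · exact (hV v).attach_eq_of_internal (hV v') e
  have hadj : ∀ {s t : Y ⊕ TY.I}, TY.graph.Adj s t →
      TZ.graph.Adj (Sum.map P.F F s) (Sum.map P.F F t) := by
    intro s t h
    rcases s with a | v
    · rcases t with a' | v
      · exact absurd h (TY.not_adj_leaf_leaf hY a a')
      · exact (hE v _ h.symm).choose.symm
    · exact (hE v _ h).choose
  have hmaps : ∀ v, Set.MapsTo (ratMap (f v)) (TY.attachSet v)ᶜ (TZ.attachSet (F v))ᶜ := fun v =>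
    (hV v).mapsTo.ge
  let C : Cover TY TZ :=
    { leafMap := P.F
      vertexMap := F
      map_adj := hadj
      f := f
      nonconstant := fun v => (hV v).one_le_ratDegree
      mapsTo := hmaps
      isCoveringMap := fun v => isCoveringMap_restrict (hmaps v) (hV v).mapsTo
        (IsCoveringMapOn.of_isLocalHomeomorphOn (continuous_ratMap (hV v).one_le_ratDegree) (by
          rw [(hV v).mapsTo, ← TY.range_marking]
          exact (hV v).isLocalHomeomorphOn))
      map_attach := fun v t => (hE v t.1 t.2).choose_spec
      localDegree_eq := fun v v' h => ((hV v).eq_iff_ne (hV v') h).2 }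
  refine ⟨C, ⟨rfl, fun a v h => ((hV v).eq_iff_of_leaf h).2⟩, φY, φZ, hφY, hφZ, fun v => ?_⟩
  refine tendstoLocUnifOn_of_forall (continuous_ratMap (hV v).one_le_ratDegree) fun p hp => ?_
  refine (hV v).tendsto_f p ?_
  rwa [TY.range_marking]

end

section

/-! ### The tree of a compatible family of partitions -/

/-- Maps with at least three values, any two of which are compatible, and which separate all
triples. The values themselves do not matter, only the partitions into fibers do. -/
structure IsSystem {X J β : Type*} (A : J → X → β) : Prop where
  exists_third : ∀ j x y, ∃ z, A j z ≠ A j x ∧ A j z ≠ A j y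
  exists_cover : ∀ j j', j ≠ j' → ∃ x x', ∀ y, A j y = A j x ∨ A j' y = A j' x'
  separates : ∀ x y z, x ≠ y → x ≠ z → y ≠ z → ∃ j, A j x ≠ A j y ∧ A j x ≠ A j z ∧ A j y ≠ A j z

namespace IsSystem

section

variable {X J β : Type*} {A : J → X → β} (hA : IsSystem A)

/-- If j ≠ j', a class of each together cover the set. A common class that differs from one of these
is contained in the other and equal to it, so some partition would have at most two classes. -/
theorem eq_of_class_eq {j j' : J} {x x' : X} (hA : IsSystem A)
    (h : ∀ y, A j y = A j x ↔ A j' y = A j' x') : j = j' := by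
  by_contra hne
  obtain ⟨a, a', ha⟩ := hA.exists_cover j j' hne
  obtain ⟨z, hz1, hz2⟩ := hA.exists_third j a x
  obtain ⟨z', hz1', hz2'⟩ := hA.exists_third j' a' x'
  have h1 := ha x
  have h2 := ha z
  have h3 := ha z'
  have h4 := h x
  have h5 := h z
  have h6 := h z'
  have h7 := ha x'
  have h8 := h x'
  grind

/-- Take a smallest class of `z` containing `S`. If it contained some t outside `S`, an index
separating `t`, `z` and a point outside this class would have, by the hypothesis on `S` and by
compatibility, a strictly smaller class of `z` containing `S`. -/
theorem exists_class_eq_of_subset [Finite J] [Finite X] {S : Set X} {z : X} (hA : IsSystem A) (hz : z ∈ S)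
    (hS : ∀ x ∉ S, ∀ y ∉ S, ∀ j, A j x ≠ A j y → A j x ≠ A j z → A j y ≠ A j z →
      ∀ t ∈ S, A j t = A j z) {j₀ : J} (h₀ : ∀ t ∈ S, A j₀ t = A j₀ z) :
    ∃ j, ∀ t, A j t = A j z ↔ t ∈ S := by
  obtain ⟨j, hj, hmin⟩ := Set.exists_min_image {j | ∀ t ∈ S, A j t = A j z}
    (fun j => {t | A j t = A j z}.ncard) (Set.toFinite _) ⟨j₀, h₀⟩
  refine ⟨j, fun t => ⟨fun ht => ?_, hj t⟩⟩
  by_contra htS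
  obtain ⟨y, hy, -⟩ := hA.exists_third j z z
  have hyS : y ∉ S := fun h => hy (hj y h)
  obtain ⟨j', h1, h2, h3⟩ := hA.separates t y z (fun h => hy (h ▸ ht)) (fun h => htS (h ▸ hz))
    fun h => hyS (h ▸ hz)
  have hj' := hS t htS y hyS j' h1 h2 h3
  have hjj : j ≠ j' := by
    rintro rfl
    exact h2 ht
  obtain ⟨a, a', ha⟩ := hA.exists_cover j j' hjj
  refine absurd (hmin j' hj') (not_le.2 (Set.ncard_lt_ncard ⟨fun s hs => ?_, fun hsub => h2 (hsub ht)⟩))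
  replace hs : A j' s = A j' z := hs
  change A j s = A j z
  have e1 := ha t
  have e2 := ha y
  have e3 := ha z
  have e4 := ha s
  grind

theorem exists_class_singleton [Finite J] [Finite X] (hA : IsSystem A) (hX : 3 ≤ Nat.card X) (x : X) :
    ∃ j, ∀ t, A j t = A j x ↔ t = x := by
  obtain ⟨y, -, hy⟩ := Set.exists_mem_notMem_of_ncard_lt_ncard (s := {x}) (t := Set.univ)
    (by rw [Set.ncard_singleton, Set.ncard_univ]; omega)
  obtain ⟨z, -, hz⟩ := Set.exists_mem_notMem_of_ncard_lt_ncard (s := {x, y}) (t := Set.univ)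
    (lt_of_le_of_lt (Set.ncard_insert_le _ _) (by rw [Set.ncard_singleton, Set.ncard_univ]; exact hX))
  simp only [Set.mem_insert_iff, Set.mem_singleton_iff, not_or] at hy hz
  obtain ⟨j₀, -⟩ := hA.separates x y z (Ne.symm hy) (Ne.symm hz.1) (Ne.symm hz.2)
  refine hA.exists_class_eq_of_subset (S := {x}) (z := x) rfl ?_ (j₀ := j₀) ?_
  · rintro _ - _ - j - - - t rfl; rfl
  · rintro t rfl; rfl

/-- Let S be the complement of the class. An index separating two points of the class from `z` in S
is constant on S by compatibility, so S is itself a class of some index. These pairs of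
complementary classes are the internal edges of the tree. -/
theorem exists_class_compl [Finite J] [Finite X] (hA : IsSystem A) {j : J} {x y : X} (hxy : x ≠ y)
    (h : A j x = A j y) : ∃ j' z, ∀ t, A j t = A j x ↔ A j' t ≠ A j' z := by
  obtain ⟨z, hz, -⟩ := hA.exists_third j x x
  have key : ∀ s, A j s = A j x → ∀ s', A j s' = A j x → ∀ i, A i s ≠ A i s' → A i s ≠ A i z →
      A i s' ≠ A i z → ∀ t, A j t ≠ A j x → A i t = A i z := by
    intro s hs s' hs' i h1 h2 h3 t ht
    have hij : j ≠ i := by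
      rintro rfl
      exact h1 (hs.trans hs'.symm)
    obtain ⟨a, a', ha⟩ := hA.exists_cover j i hij
    have e1 := ha s
    have e2 := ha s'
    have e3 := ha z
    have e4 := ha t
    grind
  have hxz : x ≠ z := fun h => hz (by rw [h])
  have hyz : y ≠ z := by
    rintro rfl
    exact hz h.symm
  obtain ⟨j₀, h1, h2, h3⟩ := hA.separates x y z hxy hxz hyz
  obtain ⟨j', hj'⟩ := hA.exists_class_eq_of_subset (S := {t | A j t ≠ A j x}) (z := z) hz
    (fun s hs s' hs' => key s (not_not.1 hs) s' (not_not.1 hs')) (key x rfl y h.symm j₀ h1 h2 h3)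
  refine ⟨j', z, fun t => ?_⟩
  have := hj' t
  rw [Set.mem_ofPred_eq] at this
  rw [Ne, this, not_not]

/-- The fiber of `A j` through `x` is the branch of the neighbor `t` of `j`. -/
def IsBranch (A : J → X → β) (j : J) (x : X) : X ⊕ J → Prop
  | Sum.inl a => ∀ y, A j y = A j x ↔ y = a
  | Sum.inr j' => ∃ z, ∀ y, A j y = A j x ↔ A j' y ≠ A j' z

theorem exists_isBranch [Finite J] [Finite X] (hA : IsSystem A) (j : J) (x : X) :
    ∃ t, IsBranch A j x t := by
  by_cases h : ∀ y, A j y = A j x → y = x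
  · exact ⟨Sum.inl x, fun y => ⟨h y, fun h => by rw [h]⟩⟩
  · push Not at h
    obtain ⟨y, hy, hyx⟩ := h
    obtain ⟨j', z, hz⟩ := hA.exists_class_compl hyx.symm hy.symm
    exact ⟨Sum.inr j', z, hz⟩

theorem isBranch_unique (hA : IsSystem A) {j : J} {x : X} {t t' : X ⊕ J} (h : IsBranch A j x t)
    (h' : IsBranch A j x t') : t = t' := by
  have key : ∀ a j', IsBranch A j x (Sum.inl a) → ¬IsBranch A j x (Sum.inr j') := by
    rintro a j' h ⟨z, hz⟩
    obtain ⟨s, hs1, hs2⟩ := hA.exists_third j' z a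
    have e1 := (hz s).2 hs1
    exact hs2 (by rw [(h s).1 e1])
  rcases t with a | i <;> rcases t' with a' | i'
  · rw [(h' a).1 ((h a).2 rfl)]
  · exact absurd h' (key _ _ h)
  · exact absurd h (key _ _ h')
  · obtain ⟨z, hz⟩ := h
    obtain ⟨z', hz'⟩ := h'
    rw [hA.eq_of_class_eq (j := i) (j' := i') (x := z) (x' := z') fun y => by
      rw [← not_iff_not, ← Ne, ← hz, hz']]

theorem eq_of_isBranch (hA : IsSystem A) {j : J} {x x' : X} {t : X ⊕ J} (h : IsBranch A j x t)
    (h' : IsBranch A j x' t) : A j x = A j x' := by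
  rcases t with a | i
  · rw [(h x).1 rfl, (h' x').1 rfl]
  · obtain ⟨z, hz⟩ := h
    obtain ⟨z', hz'⟩ := h'
    obtain ⟨s, hs1, hs2⟩ := hA.exists_third i z z'
    exact ((hz s).2 hs1).symm.trans ((hz' s).2 hs2)

theorem isBranch_congr {j : J} {x x' : X} {t : X ⊕ J} (hx : A j x = A j x') (h : IsBranch A j x t) :
    IsBranch A j x' t := by
  rcases t with a | i
  · intro y; rw [← hx]; exact h y
  · obtain ⟨z, hz⟩ := h
    exact ⟨z, fun y => by rw [← hx]; exact hz y⟩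

theorem isBranch_symm {j j' : J} {x : X} (h : IsBranch A j x (Sum.inr j')) :
    ∃ z, IsBranch A j' z (Sum.inr j) ∧ ∀ y, A j y = A j x ↔ A j' y ≠ A j' z := by
  obtain ⟨z, hz⟩ := h
  exact ⟨z, ⟨x, fun y => by rw [← not_iff_not, ← Ne, ← hz, not_not]⟩, hz⟩

theorem not_isBranch_self (hA : IsSystem A) {j : J} {x : X} : ¬IsBranch A j x (Sum.inr j) := by
  rintro ⟨z, hz⟩
  obtain ⟨s, hs1, hs2⟩ := hA.exists_third j x z
  exact hs1 ((hz s).2 hs2)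

/-- Passing to the neighbor in the direction of `x` shrinks the class of `x`; this is the measure
for descent towards a leaf. -/
theorem ncard_lt_of_isBranch [Finite X] (hA : IsSystem A) {j j' : J} {x : X}
    (h : IsBranch A j x (Sum.inr j')) :
    {y | A j' y = A j' x}.ncard < {y | A j y = A j x}.ncard := by
  obtain ⟨z, -, hz⟩ := isBranch_symm h
  have hx := (hz x).1 rfl
  refine Set.ncard_lt_ncard ⟨fun y hy => ?_, fun hsub => ?_⟩
  · replace hy : A j' y = A j' x := hy
    exact (hz y).2 (by rw [hy]; exact hx)
  · obtain ⟨s, hs1, hs2⟩ := hA.exists_third j' x z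
    exact hs1 (hsub ((hz s).2 hs2))

/-- The graph of a system: a leaf is adjacent to the partitions of which it is a class, and two
partitions are adjacent if they have complementary classes. -/
def graph (hA : IsSystem A) : SimpleGraph (X ⊕ J) where
  Adj
    | Sum.inl _, Sum.inl _ => False
    | Sum.inl a, Sum.inr j => ∃ x, IsBranch A j x (Sum.inl a)
    | Sum.inr j, t => ∃ x, IsBranch A j x t
  symm := ⟨by
    rintro (a | j) (a' | j') h
    · exact h
    · exact h
    · exact h
    · obtain ⟨x, hx⟩ := h
      obtain ⟨z, hz, -⟩ := isBranch_symm hx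
      exact ⟨z, hz⟩⟩
  loopless := ⟨by
    rintro (a | j) h
    · exact h
    · obtain ⟨x, hx⟩ := h
      exact hA.not_isBranch_self hx⟩

theorem adj_inr_iff {j : J} {t : X ⊕ J} : hA.graph.Adj (Sum.inr j) t ↔ ∃ x, IsBranch A j x t := Iff.rfl

theorem isBranch_inl_iff {j : J} {x a : X} :
    IsBranch A j x (Sum.inl a) ↔ x = a ∧ ∀ y, A j y = A j a → y = a := by
  constructor
  · intro h
    have hxa := (h x).1 rfl
    subst hxa
    exact ⟨rfl, fun y => (h y).1⟩
  · rintro ⟨rfl, h⟩ y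
    exact ⟨h y, fun h => by rw [h]⟩

variable [Finite X] [Finite J]

theorem reachable (j : J) (x : X) : hA.graph.Reachable (Sum.inr j) (Sum.inl x) := by
  induction hn : {y | A j y = A j x}.ncard using Nat.strong_induction_on generalizing j with
  | _ n ih =>
    obtain ⟨t, ht⟩ := hA.exists_isBranch j x
    have hadj : hA.graph.Adj (Sum.inr j) t := ⟨x, ht⟩
    rcases t with a | j'
    · rw [(isBranch_inl_iff.1 ht).1]
      exact hadj.reachable
    · exact hadj.reachable.trans (ih _ (hn ▸ hA.ncard_lt_of_isBranch ht) j' rfl)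

theorem connected (hX : 3 ≤ Nat.card X) : hA.graph.Connected := by
  have hne : Nonempty X := (Nat.card_pos_iff.1 (by omega)).1
  obtain ⟨x₀⟩ := hne
  have : ∀ t, hA.graph.Reachable t (Sum.inl x₀) := by
    rintro (a | j)
    · obtain ⟨j, hj⟩ := hA.exists_class_singleton hX a
      have hadj : hA.graph.Adj (Sum.inr j) (Sum.inl a) := ⟨a, hj⟩
      exact hadj.symm.reachable.trans (hA.reachable j x₀)
    · exact hA.reachable j x₀
  exact { preconnected := fun s t => (this s).trans (this t).symm, nonempty := ⟨Sum.inl x₀⟩ }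

theorem isTree (hX : 3 ≤ Nat.card X) : hA.graph.IsTree := by
  classical
  have hconn := hA.connected hX
  rw [SimpleGraph.isTree_iff_connected_and_card]
  -- Connectedness gives one inequality between the numbers of vertices and edges. For the other,
  -- each vertex other than a root leaf `x₀` is sent to its edge towards `x₀`, and this map hits
  -- every edge.
  refine ⟨hconn, le_antisymm ?_ hconn.card_vert_le_card_edgeSet_add_one⟩
  have hne : Nonempty X := (Nat.card_pos_iff.1 (by omega)).1
  obtain ⟨x₀⟩ := hne
  have hpar : ∀ t : {t : X ⊕ J // t ≠ Sum.inl x₀}, ∃ s, hA.graph.Adj t.1 s ∧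
      ∀ j, t.1 = Sum.inr j → IsBranch A j x₀ s := by
    rintro ⟨a | j, ht⟩
    · obtain ⟨j, hj⟩ := hA.exists_class_singleton hX a
      have hadj : hA.graph.Adj (Sum.inr j) (Sum.inl a) := ⟨a, hj⟩
      exact ⟨Sum.inr j, hadj.symm, by simp⟩
    · obtain ⟨t, ht⟩ := hA.exists_isBranch j x₀
      refine ⟨t, ⟨x₀, ht⟩, fun j' hj' => ?_⟩
      rwa [← Sum.inr_injective hj']
  choose p hp1 hp2 using hpar
  let φ : {t : X ⊕ J // t ≠ Sum.inl x₀} → hA.graph.edgeSet := fun t => ⟨s(t.1, p t), hp1 t⟩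
  have hφ : Function.Surjective φ := by
    have key : ∀ j t, hA.graph.Adj (Sum.inr j) t → IsBranch A j x₀ t →
        ∃ t', (φ t' : Sym2 (X ⊕ J)) = s(Sum.inr j, t) := by
      intro j t _ h
      refine ⟨⟨Sum.inr j, by simp⟩, ?_⟩
      change s(Sum.inr j, _) = _
      rw [hA.isBranch_unique h (hp2 ⟨Sum.inr j, by simp⟩ j rfl)]
    -- If the edge does not lead from `j` towards `x₀`, it leads towards `x₀` from its other end.
    have key2 : ∀ j t, hA.graph.Adj (Sum.inr j) t →
        ∃ t', (φ t' : Sym2 (X ⊕ J)) = s(Sum.inr j, t) := by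
      rintro j t ⟨x, hx⟩
      by_cases hx₀ : A j x = A j x₀
      · exact key j t ⟨x, hx⟩ (isBranch_congr hx₀ hx)
      · rcases t with a | j'
        · obtain ⟨rfl, hx'⟩ := isBranch_inl_iff.1 hx
          have hne : (Sum.inl x : X ⊕ J) ≠ Sum.inl x₀ := fun h => hx₀ (by rw [Sum.inl_injective h])
          refine ⟨⟨Sum.inl x, hne⟩, ?_⟩
          change s(Sum.inl x, _) = _
          have h1 := hp1 ⟨Sum.inl x, hne⟩
          rcases h2 : p ⟨Sum.inl x, hne⟩ with b | i
          · rw [h2] at h1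
            exact h1.elim
          · rw [h2] at h1
            obtain ⟨y, hy⟩ := h1
            rw [hA.eq_of_class_eq (j := i) (j' := j) (x := y) (x' := x) fun t =>
              (hy t).trans (hx t).symm, Sym2.eq_swap]
        · obtain ⟨z, hz, hz2⟩ := isBranch_symm hx
          have h3 : A j' x₀ = A j' z := by
            by_contra hcon
            exact hx₀ ((hz2 x₀).2 hcon).symm
          obtain ⟨t', ht'⟩ := key j' (Sum.inr j) ⟨z, hz⟩ (isBranch_congr h3.symm hz)
          exact ⟨t', ht'.trans Sym2.eq_swap⟩
    rintro ⟨e, he⟩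
    induction e using Sym2.ind with
    | _ s t =>
      rcases s with a | j
      · rcases t with a' | j
        · exact he.elim
        · obtain ⟨t', ht'⟩ := key2 j (Sum.inl a) (SimpleGraph.Adj.symm he)
          exact ⟨t', Subtype.ext (ht'.trans Sym2.eq_swap)⟩
      · obtain ⟨t', ht'⟩ := key2 j t he
        exact ⟨t', Subtype.ext ht'⟩
  have h1 := Nat.card_le_card_of_surjective φ hφ
  have h2 : Nat.card {t : X ⊕ J // t ≠ Sum.inl x₀} + 1 = Nat.card (X ⊕ J) := by
    have := Set.ncard_add_ncard_compl ({Sum.inl x₀} : Set (X ⊕ J))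
    rw [Set.ncard_singleton] at this
    rw [← this, add_comm]
    rfl
  omega

end

end IsSystem

end

/-! ### The tree of spheres of a system -/

section

namespace IsSystem

variable {X : Type u} {J : Type w₁} {A : J → X → Sphere} [Finite X] [Finite J]

theorem ncard_neighborSet_leaf (hA : IsSystem A) (hX : 3 ≤ Nat.card X) (x : X) :
    (hA.graph.neighborSet (Sum.inl x)).ncard = 1 := by
  obtain ⟨j, hj⟩ := hA.exists_class_singleton hX x
  rw [Set.ncard_eq_one]
  refine ⟨Sum.inr j, Set.ext fun t => ⟨fun ht => ?_, fun ht => ?_⟩⟩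
  · rcases t with a | i
    · exact ht.elim
    · obtain ⟨y, hy⟩ := ht
      rw [Set.mem_singleton_iff, hA.eq_of_class_eq (j := i) (j' := j) (x := y) (x' := x) fun t =>
        (hy t).trans (hj t).symm]
  · rw [Set.mem_singleton_iff.1 ht]
    exact ⟨x, hj⟩

theorem three_le_ncard_neighborSet [Nonempty X] (hA : IsSystem A) (j : J) :
    3 ≤ (hA.graph.neighborSet (Sum.inr j)).ncard := by
  have hex : ∀ x y, ∃ t, hA.graph.Adj (Sum.inr j) t ∧ ∃ z, IsBranch A j z t ∧ A j z ≠ A j x ∧ A j z ≠ A j y := by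
    intro x y
    obtain ⟨z, hz1, hz2⟩ := hA.exists_third j x y
    obtain ⟨t, ht⟩ := hA.exists_isBranch j z
    exact ⟨t, ⟨z, ht⟩, z, ht, hz1, hz2⟩
  by_contra! hlt
  have hlt' : (hA.graph.neighborSet (Sum.inr j)).ncard ≤ 2 := by omega
  obtain ⟨x₀⟩ := ‹Nonempty X›
  obtain ⟨t₀, h₀, z₀, hb₀, -, -⟩ := hex x₀ x₀
  obtain ⟨t₁, h₁, z₁, hb₁, n₁, -⟩ := hex z₀ z₀
  obtain ⟨t₂, h₂, z₂, hb₂, n₂, n₂'⟩ := hex z₀ z₁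
  have e₁ : t₁ ≠ t₀ := fun h => n₁ (hA.eq_of_isBranch (h ▸ hb₁) hb₀)
  have e₂ : t₂ ≠ t₀ := fun h => n₂ (hA.eq_of_isBranch (h ▸ hb₂) hb₀)
  have e₃ : t₂ ≠ t₁ := fun h => n₂' (hA.eq_of_isBranch (h ▸ hb₂) hb₁)
  have : ({t₀, t₁, t₂} : Set (X ⊕ J)).ncard = 3 := Set.ncard_eq_three.2 ⟨t₀, t₁, t₂, e₁.symm, e₂.symm, e₃.symm, rfl⟩
  have hsub : ({t₀, t₁, t₂} : Set (X ⊕ J)) ⊆ hA.graph.neighborSet (Sum.inr j) := by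
    rintro t (rfl | rfl | rfl)
    exacts [h₀, h₁, h₂]
  have := Set.ncard_le_ncard hsub
  omega

/-- The tree of spheres of a system, with the values of the system as attaching points. -/
def tree (hA : IsSystem A) (hX : 3 ≤ Nat.card X) : TreeOfSpheres.{u, w₁} X where
  I := J
  finite_I := inferInstance
  graph := hA.graph
  isTree := hA.isTree hX
  leaf := hA.ncard_neighborSet_leaf hX
  stable :=
    have : Nonempty X := (Nat.card_pos_iff.1 (by omega)).1
    hA.three_le_ncard_neighborSet
  attach j t := A j (hA.adj_inr_iff.1 t.2).choose
  attach_injective j := by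
    intro t t' h
    have h1 := (hA.adj_inr_iff.1 t.2).choose_spec
    have h2 := (hA.adj_inr_iff.1 t'.2).choose_spec
    exact Subtype.ext (hA.isBranch_unique (isBranch_congr h h1) h2)

/-- Induction on the size of the class of `x`: if the path to `x` left `j` elsewhere, it would
return from the neighbor `j'` to `j`, but by induction the direction of `x` at `j'` is a class that
the edge to `j` excludes. -/
theorem nxt_tree (hA : IsSystem A) (hX : 3 ≤ Nat.card X) (j : J) (x : X) :
    IsBranch A j x (nxt (hA.isTree hX) (Sum.inr j) (Sum.inl x)) := by
  induction hn : {y | A j y = A j x}.ncard using Nat.strong_induction_on generalizing j with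
  | _ n ih =>
    obtain ⟨t, ht⟩ := hA.exists_isBranch j x
    have hadj : hA.graph.Adj (Sum.inr j) t := ⟨x, ht⟩
    suffices nxt (hA.isTree hX) (Sum.inr j) (Sum.inl x) = t by rwa [this]
    rcases t with a | j'
    · obtain ⟨rfl, -⟩ := isBranch_inl_iff.1 ht
      exact nxt_of_adj _ hadj
    · rw [nxt_eq_iff_ne _ hadj]
      intro hcon
      have h1 := ih _ (hn ▸ hA.ncard_lt_of_isBranch ht) j' rfl
      rw [hcon] at h1
      obtain ⟨z, hz, hz2⟩ := isBranch_symm ht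
      exact (hz2 x).1 rfl (hA.eq_of_isBranch h1 hz)

theorem marking_tree (hA : IsSystem A) (hX : 3 ≤ Nat.card X) (j : J) :
    (hA.tree hX).marking j = A j := by
  funext x
  have h1 := hA.nxt_tree hX j x
  exact hA.eq_of_isBranch (hA.adj_inr_iff.1 ⟨x, h1⟩).choose_spec h1

end IsSystem

end

section

/-! ### Existence of limit trees -/

theorem exists_ne_ne_of_injective {β : Type*} {b : Fin 3 → β} (hb : Function.Injective b) (p q : β) :
    ∃ i, b i ≠ p ∧ b i ≠ q := by
  by_contra! hcon
  have n01 := hb.ne (show (0 : Fin 3) ≠ 1 by decide)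
  have n02 := hb.ne (show (0 : Fin 3) ≠ 2 by decide)
  have n12 := hb.ne (show (1 : Fin 3) ≠ 2 by decide)
  have c0 := hcon 0
  have c1 := hcon 1
  have c2 := hcon 2
  rcases eq_or_ne (b 0) p with h0 | h0 <;> rcases eq_or_ne (b 1) p with h1 | h1 <;>
    rcases eq_or_ne (b 2) p with h2 | h2 <;> grind

theorem injective_cons_three {β : Type*} {p q r : β} (hpq : p ≠ q) (hpr : p ≠ r) (hqr : q ≠ r) :
    Function.Injective ![p, q, r] := by
  intro i j hij
  fin_cases i <;> fin_cases j <;> simp_all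

/-- The vertices are the partitions into fibers of all limit markings with at least three values.
There are finitely many, and `ker_eq_or_cover` makes distinct ones compatible. Using partitions
rather than triples identifies triples with the same median. -/
theorem exists_tree_of_separates {X : Type u} [Finite X] (hX : 3 ≤ Nat.card X) {x : ℕ → X → Sphere}
    (hsep : ∀ y : Fin 3 → X, Function.Injective y → ∃ (g : ℕ → GL (Fin 2) ℂ) (a : X → Sphere),
      (∀ t, Tendsto (fun n => g n • x n t) atTop (𝓝 (a t))) ∧ Function.Injective (a ∘ y)) :
    ∃ T : TreeOfSpheres.{u, w₁} X, TreeOfSpheres.SpheresTendsto x T := by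
  let K : Set (Setoid X) := {s | ∃ (g : ℕ → GL (Fin 2) ℂ) (a : X → Sphere),
    (∀ t, Tendsto (fun n => g n • x n t) atTop (𝓝 (a t))) ∧
      (∃ y : Fin 3 → X, Function.Injective (a ∘ y)) ∧ s = Setoid.ker a}
  have hfin : Finite (Setoid X) := Finite.of_injective (fun s : Setoid X => s.r) fun s s' h => by
    ext a b
    exact iff_of_eq (congrFun (congrFun h a) b)
  obtain ⟨m, ⟨e⟩⟩ := Finite.exists_equiv_fin K
  choose g a ha h3 hker using fun s : K => s.2
  -- Indexing by a lifted `Fin m` puts the internal vertices into an arbitrary universe.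
  let κ : ULift.{w₁} (Fin m) → K := fun j => e.symm j.down
  have hκ : ∀ j j', κ j = κ j' → j = j' := fun j j' h => ULift.down_injective (e.symm.injective h)
  have hA : IsSystem fun j => a (κ j) := by
    refine ⟨fun j y z => ?_, fun j j' hjj => ?_, fun y z t h1 h2 h3 => ?_⟩
    · obtain ⟨b, hb⟩ := h3 (κ j)
      obtain ⟨i, hi⟩ := exists_ne_ne_of_injective hb (a (κ j) y) (a (κ j) z)
      exact ⟨b i, hi⟩
    · refine (ker_eq_or_cover (ha (κ j)) (ha (κ j')) ?_).resolve_left fun h => hjj (hκ _ _ ?_)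
      · obtain ⟨b, hb⟩ := h3 (κ j)
        exact ⟨b 0, b 1, hb.ne (by decide)⟩
      · refine Subtype.ext ?_
        rw [hker (κ j), hker (κ j')]
        ext p q
        exact h p q
    · obtain ⟨g', a', ha', hinj⟩ := hsep ![y, z, t] (injective_cons_three h1 h2 h3)
      have hmem : Setoid.ker a' ∈ K := ⟨g', a', ha', ⟨_, hinj⟩, rfl⟩
      have hj : κ ⟨e ⟨_, hmem⟩⟩ = ⟨_, hmem⟩ := e.symm_apply_apply _
      have hiff : ∀ p q, a (κ ⟨e ⟨_, hmem⟩⟩) p = a (κ ⟨e ⟨_, hmem⟩⟩) q ↔ a' p = a' q := fun p q => by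
        have h4 := hker (κ ⟨e ⟨_, hmem⟩⟩)
        have h5 := congrArg (fun s : Setoid X => s p q) (h4.symm.trans (congrArg Subtype.val hj))
        exact iff_of_eq h5
      refine ⟨⟨e ⟨_, hmem⟩⟩, ?_, ?_, ?_⟩ <;> rw [Ne, hiff]
      · exact hinj.ne (show (0 : Fin 3) ≠ 1 by decide)
      · exact hinj.ne (show (0 : Fin 3) ≠ 2 by decide)
      · exact hinj.ne (show (1 : Fin 3) ≠ 2 by decide)
  refine ⟨hA.tree hX, fun n j => g (κ j) n, fun j => ?_⟩
  rw [hA.marking_tree hX j, tendsto_pi_nhds]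
  exact ha (κ j)

/-- Normalizing the triple to 0, 1, ∞ turns the positions of the other marks into cross ratios. -/
theorem exists_normalization_of_crossRatios {X : Type u} {x : ℕ → X → Sphere}
    (hx : ∀ n, Function.Injective (x n)) {L : (Fin 4 ↪ X) → Sphere}
    (hL : Tendsto (fun n => crossRatios (x n)) atTop (𝓝 L)) {y : Fin 3 → X}
    (hy : Function.Injective y) : ∃ (g : ℕ → GL (Fin 2) ℂ) (a : X → Sphere),
      (∀ t, Tendsto (fun n => g n • x n t) atTop (𝓝 (a t))) ∧ Function.Injective (a ∘ y) := by
  have hne : ∀ n i j, i ≠ j → ptv (vec (x n (y i))) ≠ ptv (vec (x n (y j))) := fun n i j hij => by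
    rw [ptv_vec, ptv_vec]
    exact (hx n).ne (hy.ne hij)
  have hdet : ∀ n, (normMat (vec (x n (y 0))) (vec (x n (y 1))) (vec (x n (y 2)))).det ≠ 0 := fun n =>
    det_normMat_ne_zero (vec_ne_zero _) (vec_ne_zero _) (vec_ne_zero _) (hne n 0 1 (by decide))
      (hne n 0 2 (by decide)) (hne n 1 2 (by decide))
  let g : ℕ → GL (Fin 2) ℂ := fun n => glOf _ (hdet n)
  have hg : ∀ n p, g n • p = crossRatio (x n (y 0)) (x n (y 1)) (x n (y 2)) p := fun n p => by
    rw [smul_eq_ptv, coe_glOf, mv_normMat, cross_vec, cross_vec, cross_vec, cross_vec]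
    rfl
  have h0 : ∀ n, g n • x n (y 0) = ((0 : ℂ) : Sphere) := fun n => by
    rw [smul_eq_ptv, coe_glOf, ptv_mv_normMat_zero (hdet n)]
  have h1 : ∀ n, g n • x n (y 1) = ((1 : ℂ) : Sphere) := fun n => by
    rw [smul_eq_ptv, coe_glOf, ptv_mv_normMat_one (hdet n)]
  have h2 : ∀ n, g n • x n (y 2) = (∞ : Sphere) := fun n => by
    rw [smul_eq_ptv, coe_glOf, ptv_mv_normMat_infty]
  have hlim : ∀ t, ∃ p, Tendsto (fun n => g n • x n t) atTop (𝓝 p) := by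
    intro t
    by_cases ht : ∃ i, y i = t
    · obtain ⟨i, rfl⟩ := ht
      fin_cases i
      · exact ⟨_, (tendsto_const_nhds (x := ((0 : ℂ) : Sphere))).congr fun n => (h0 n).symm⟩
      · exact ⟨_, (tendsto_const_nhds (x := ((1 : ℂ) : Sphere))).congr fun n => (h1 n).symm⟩
      · exact ⟨_, (tendsto_const_nhds (x := (∞ : Sphere))).congr fun n => (h2 n).symm⟩
    · push Not at ht
      let q : Fin 4 ↪ X := ⟨Fin.snoc y t, by
        rw [Fin.snoc_injective_iff]
        exact ⟨hy, fun ⟨i, hi⟩ => ht i hi⟩⟩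
      refine ⟨L q, (tendsto_pi_nhds.1 hL q).congr fun n => ?_⟩
      rw [hg]
      rfl
  choose a ha using hlim
  have e0 : a (y 0) = ((0 : ℂ) : Sphere) := tendsto_nhds_unique (ha _)
    (tendsto_const_nhds.congr fun n => (h0 n).symm)
  have e1 : a (y 1) = ((1 : ℂ) : Sphere) := tendsto_nhds_unique (ha _)
    (tendsto_const_nhds.congr fun n => (h1 n).symm)
  have e2 : a (y 2) = (∞ : Sphere) := tendsto_nhds_unique (ha _)
    (tendsto_const_nhds.congr fun n => (h2 n).symm)
  refine ⟨g, a, ha, fun i j hij => ?_⟩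
  have hz : ((0 : ℂ) : Sphere) ≠ ((1 : ℂ) : Sphere) := OnePoint.coe_injective.ne zero_ne_one
  have hc := fun z : ℂ => OnePoint.coe_ne_infty z
  have hc' := fun z : ℂ => OnePoint.infty_ne_coe z
  fin_cases i <;> fin_cases j <;> simp [e0, e1, e2] at hij ⊢

/-- A constant pencil member vanishes at ∞ because the degree is at least 1; any other one has a
finite root. -/
theorem surjective_ratMap {r : RatFunc ℂ} (hr : 1 ≤ ratDegree r) : Function.Surjective (ratMap r) := by
  intro p
  have h := isPair_num_denom hr
  have hw := vec_ne_zero p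
  have hE := h.pencil_ne_zero hw
  have hle := natDegree_pencil_le h.left_le h.right_le (vec p).2 (vec p).1
  set E := Polynomial.C (vec p).2 * r.num - Polynomial.C (vec p).1 * r.denom with hEdef
  obtain ⟨q, hq⟩ : ∃ q, hom (ratDegree r) E (vec q) = 0 := by
    by_cases hd : E.natDegree = 0
    · refine ⟨∞, ?_⟩
      rw [vec_infty, hom_infty]
      exact Polynomial.coeff_eq_zero_of_natDegree_lt (by omega)
    · obtain ⟨z, hz⟩ := IsAlgClosed.exists_root E fun h0 => hd (Polynomial.natDegree_eq_of_degree_eq_some h0)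
      refine ⟨z, ?_⟩
      rw [vec_coe, hom_coe hle]
      exact hz
  refine ⟨q, ?_⟩
  rw [ratMap_eq_pairMap, ← ptv_vec p, pairMap, ptv_eq_ptv_iff (h.hom_vec_ne_zero q) hw]
  rw [hEdef, sub_eq_add_neg, ← neg_mul, ← Polynomial.C_neg, hom_add, hom_C_mul, hom_C_mul] at hq
  simp only [cross]
  linear_combination hq

variable {Y : Type u} {Z : Type v} [Fintype Y] {P : Portrait Y Z}

/-- Otherwise at each vertex two of the three marks meet, at the image of some attaching point. Take
such an edge with the smallest branch. It cannot end at a leaf, over which only one mark lies; at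
its other end two of the marks meet again, along an edge with a smaller branch. -/
theorem exists_separating_vertex (hY : 3 ≤ Nat.card Y) {R : ℕ → MarkedRationalMap P}
    {TY : TreeOfSpheres.{u, w₁} Y} {g h : TY.I → ℕ → GL (Fin 2) ℂ} {ζ : TY.I → Z → Sphere}
    {G : TY.I → RatFunc ℂ} (hV : ∀ v, VertexLimit R (g v) (TY.marking v) (h v) (ζ v) (G v))
    {b : Fin 3 → Z} (hb : Function.Injective b) : ∃ v, Function.Injective (ζ v ∘ b) := by
  by_contra hcon
  have hfin := TY.finite_I
  have hpair : ∀ v, ∃ (t : TY.graph.neighborSet (Sum.inr v)) (i j : Fin 3), i ≠ j ∧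
      ζ v (b i) = ratMap (G v) (TY.attach v t) ∧ ζ v (b j) = ratMap (G v) (TY.attach v t) := by
    intro v
    have h1 : ¬Function.Injective (ζ v ∘ b) := fun h => hcon ⟨v, h⟩
    rw [Function.Injective] at h1
    push Not at h1
    obtain ⟨i, j, hij, hne⟩ := h1
    obtain ⟨p, hp⟩ := surjective_ratMap (hV v).one_le_ratDegree (ζ v (b i))
    have hp2 : p ∈ Set.range (TY.marking v) := by
      rw [← (hV v).preimage_range]
      exact ⟨b i, hp.symm⟩
    rw [TY.range_marking] at hp2
    obtain ⟨t, rfl⟩ := hp2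
    exact ⟨t, i, j, hne, hp.symm, hij.symm.trans hp.symm⟩
  have hne : Nonempty TY.I := by
    obtain ⟨f⟩ : Nonempty (Fin 3 ↪ Y) := by
      rw [Function.Embedding.nonempty_iff_card_le, Fintype.card_fin, ← Nat.card_eq_fintype_card]
      exact hY
    exact ⟨(TY.exists_median f.injective).choose⟩
  let S : Set (Σ v : TY.I, TY.graph.neighborSet (Sum.inr v)) := {e | ∃ i j : Fin 3, i ≠ j ∧
    ζ e.1 (b i) = ratMap (G e.1) (TY.attach e.1 e.2) ∧
      ζ e.1 (b j) = ratMap (G e.1) (TY.attach e.1 e.2)}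
  obtain ⟨⟨v, t, ht⟩, ⟨i, j, hij, hi, hj⟩, hmin⟩ := Set.exists_min_image S
    (fun e => (TY.branch e.1 e.2.1).ncard) (Set.toFinite _) (by
      obtain ⟨v⟩ := hne
      obtain ⟨t, h⟩ := hpair v
      exact ⟨⟨v, t⟩, h⟩)
  rcases t with a | v'
  · have key := ((hV v).eq_iff_of_leaf ht).1
    exact hij (hb (((key _).1 hi).trans ((key _).1 hj).symm))
  · have key := ((hV v).eq_iff_ne (hV v') ht).1
    obtain ⟨⟨t', ht'⟩, i', j', hij', hi', hj'⟩ := hpair v'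
    -- The edge does not lead back: the marks meeting at its two ends are complementary, but two
    -- pairs out of three always intersect.
    have hne' : t' ≠ Sum.inr v := by
      rintro rfl
      have k1 : ∀ k, ζ v (b k) = ratMap (G v) (TY.attach v ⟨_, ht⟩) →
        ζ v' (b k) ≠ ratMap (G v') (TY.attach v' ⟨_, ht'⟩) := fun k => (key (b k)).1
      have n1 : i ≠ i' := by rintro rfl; exact k1 _ hi hi'
      have n2 : i ≠ j' := by rintro rfl; exact k1 _ hi hj'
      have n3 : j ≠ i' := by rintro rfl; exact k1 _ hj hi'
      have n4 : j ≠ j' := by rintro rfl; exact k1 _ hj hj'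
      omega
    refine absurd (hmin ⟨v', t', ht'⟩ ⟨i', j', hij', hi', hj'⟩) (not_le.2 ?_)
    refine Set.ncard_lt_ncard ⟨fun x hx => ?_, fun hsub => ?_⟩
    · replace hx : nxt TY.isTree (Sum.inr v') (Sum.inl x) = t' := hx
      exact (nxt_eq_iff_ne TY.isTree ht _).2 (by rw [hx]; exact hne')
    · obtain ⟨r, hr, hr1, hr2⟩ := TY.exists_adj_ne v' t' (Sum.inr v)
      obtain ⟨x, hx⟩ := TY.exists_leaf hr
      have h1 : x ∈ TY.branch v (Sum.inr v') :=
        (nxt_eq_iff_ne TY.isTree ht _).2 (by rw [hx]; exact hr2)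
      exact hr1 (hx.symm.trans (hsub h1))

/-- The target coordinates found at the vertices of the source tree serve as the normalizations that
separate triples of target marks, so no hypothesis on their cross ratios is needed. -/
theorem exists_cover_of_crossRatios [Finite Z] (hY : 3 ≤ Nat.card Y) (hZ : 3 ≤ Nat.card Z)
    {R : ℕ → MarkedRationalMap P} {L : (Fin 4 ↪ Y) → Sphere}
    (hL : Tendsto (fun n => crossRatios (R n).y) atTop (𝓝 L)) :
    ∃ (TY : TreeOfSpheres.{u, w₁} Y) (TZ : TreeOfSpheres.{v, w₂} Z) (C : Cover TY TZ),
      C.MapsTendsto R := by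
  have hZ' : Nontrivial Z := (Finite.one_lt_card_iff_nontrivial).1 (by omega)
  obtain ⟨TY, hTY⟩ := exists_tree_of_separates.{u, w₁} hY (x := fun n => (R n).y) fun y hy =>
    exists_normalization_of_crossRatios (fun n => (R n).y_injective) hL hy
  obtain ⟨φ, hφ⟩ := id hTY
  choose h ζ G hV using fun v => exists_vertexLimit (R := R) (g := fun n => φ n v)
    (a := TY.marking v) (fun y => tendsto_pi_nhds.1 (hφ v) y) (TY.exists_three_marking v)
  obtain ⟨TZ, hTZ⟩ := exists_tree_of_separates.{v, w₂} hZ (x := fun n => (R n).z) fun b hb => by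
    obtain ⟨v, hv⟩ := exists_separating_vertex hY hV hb
    exact ⟨h v, ζ v, (hV v).tendsto_z, hv⟩
  obtain ⟨C, hC⟩ := exists_cover hY hTY hTZ
  exact ⟨TY, TZ, C, hC⟩

end

end TreesOfSpheres

end

theorem mainTheorem5 {Y : Type u} {Z : Type v} [Fintype Y] [Fintype Z]
    (hY : 3 ≤ Fintype.card Y) (hZ : 3 ≤ Fintype.card Z)
    (P : TreesOfSpheres.Portrait Y Z) (R : ℕ → TreesOfSpheres.MarkedRationalMap P) :
    (∀ (TY : TreesOfSpheres.TreeOfSpheres.{u, w₁} Y)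
        (TZ : TreesOfSpheres.TreeOfSpheres.{v, w₂} Z),
      TreesOfSpheres.TreeOfSpheres.SpheresTendsto (fun n => (R n).y) TY →
      TreesOfSpheres.TreeOfSpheres.SpheresTendsto (fun n => (R n).z) TZ →
        ∃ C : TreesOfSpheres.Cover TY TZ, C.MapsTendsto R) ∧
    ((∃ L : (Fin 4 ↪ Y) → TreesOfSpheres.Sphere,
        Tendsto (fun n => TreesOfSpheres.crossRatios (R n).y) atTop (𝓝 L)) →
      ∃ (TY : TreesOfSpheres.TreeOfSpheres.{u, w₁} Y)
        (TZ : TreesOfSpheres.TreeOfSpheres.{v, w₂} Z)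
        (C : TreesOfSpheres.Cover TY TZ), C.MapsTendsto R) := by
  rw [← Nat.card_eq_fintype_card] at hY hZ
  have hZ' : Nontrivial Z := Finite.one_lt_card_iff_nontrivial.1 (by omega)
  exact ⟨fun TY TZ hTY hTZ => TreesOfSpheres.exists_cover hY hTY hTZ,
    fun ⟨_, hL⟩ => TreesOfSpheres.exists_cover_of_crossRatios hY hZ hL⟩
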